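/- For points of the plane let $d$ be the Euclidean distance. For a finite set $P$ of points, the skyline is $$\mathrm{sky}(P)=\{p\in P : \text{for all } q\in P\setminus\{p\},\ x(q)<x(p)\text{ or } y(q)<y(p)\}.$$ For $Q\subseteq \mathrm{sky}(P)$ let $\psi(Q,P)=\max_{p\in \mathrm{sky}(P)}\min_{q\in Q} d(p,q)$ (a minimum over the empty set being $\infty$), and for an integer $k\ge 1$ let $$\mathrm{opt}(P,k)=\min\{\psi(Q,P) : Q\subseteq \mathrm{sky}(P),\ |Q|\le k\}.$$ An optimal solution is a set $Q\subseteq \mathrm{sky}(P)$ with $|Q|\le k$ and $\psi(Q,P)=\mathrm{opt}(P,k)$. Consider the real RAM: a program is a finite text with assignments, conditionals and loops that works on integer and real variables and on randomly accessible integer and real arrays, where each elementary operation (reading or writing a variable or an array cell, reading a constant, $+$, $-$ and halving of integers, $+$, $-$, $\cdot$ and $\sqrt{\ }$ of reals, comparing two integers or two reals, a logical connective, a branching) takes one unit of time. **Theorem.** (1) There are a real RAM program and a constant $C$ such that, for every set $P$ of $n$ points in the plane and every integer $k$ with $1\le k\le h$, where $h=|\mathrm{sky}(P)|$, the program, given $k$,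 $n$ and an array of the points of $P$ (in any order), computes $\mathrm{opt}(P,k)$ and an optimal solution in at most $C\,n\,(1+\log h)$ time, that is, in $O(n\log h)$ time. (2) If the skyline is already available, $O(h\log h)$ time suffices: there are a real RAM program and a constant $C$ such that, for all $P$, $k$ and $h$ as in (1), the program, given $k$, $h$ and an array of the points of $\mathrm{sky}(P)$, computes $\mathrm{opt}(P,k)$ and an optimal solution in at most $C\,h\,(1+\log h)$ time. -/

import Mathlib

/-! ## Skylines in the plane and their representatives -/

/-- The Euclidean plane; `p 0` and `p 1` are the `x`- and `y`-coordinate of `p`. -/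
abbrev Point : Type := EuclideanSpace ℝ (Fin 2)

open Classical in
/-- The skyline (Pareto front) of `P`: the points of `P` that no other point of `P` dominates. -/
noncomputable def sky (P : Finset Point) : Finset Point :=
  P.filter fun p => ∀ q ∈ P \ {p}, q 0 < p 0 ∨ q 1 < p 1

/-- `ψ(Q, P)`, the maximum over `p ∈ sky P` of the minimum over `q ∈ Q` of the Euclidean distance.
It is a finite number if `Q` is nonempty; a minimum over the empty set is `∞`. -/
noncomputable def psi (Q P : Finset Point) : ENNReal :=
  (sky P).sup fun p => Q.inf fun q => edist p q

/-- The feasible solutions: the subsets of the skyline with at most `k` points. -/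
noncomputable def feasible (P : Finset Point) (k : ℕ) : Finset (Finset Point) :=
  (sky P).powerset.filter fun Q => Q.card ≤ k

/-- `opt(P, k)`, the minimum of `ψ(Q, P)` over the feasible solutions `Q`. -/
noncomputable def opt (P : Finset Point) (k : ℕ) : ENNReal :=
  (feasible P k).inf fun Q => psi Q P

/-- A feasible solution that attains `opt(P, k)`. -/
def IsOptimalSolution (P : Finset Point) (k : ℕ) (Q : Finset Point) : Prop :=
  Q ∈ feasible P k ∧ psi Q P = opt P k

/-! ## The real RAM

Programs are finite texts of an imperative language with assignments, conditionals and loops. They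
work on integer and real variables and on integer and real arrays with random access. Each
elementary operation takes one unit of time: reading a constant, a variable or an array cell,
`+`, `-` and halving of integers, `+`, `-`, `*` and square root of reals, each comparison and logical
connective, each write and each branching. There is no conversion between reals and integers (in
particular no floor function) and no integer multiplication. -/

namespace RealRAM

/-- A memory content. Variables and arrays are named by natural numbers, so that a program accesses
only finitely many variables and arrays; every array has a cell for every natural number. -/
structure State where
  ivar : ℕ → ℕ
  rvar : ℕ → ℝ
  iarr : ℕ → ℕ → ℕ
  rarr : ℕ → ℕ → ℝ

/-- Expressions with natural numbers as values; `sub` is truncated, `half` rounds down. -/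
inductive IExpr where
  | const (m : ℕ)
  | var (x : ℕ)
  | cell (a : ℕ) (i : IExpr)
  | add (e f : IExpr)
  | sub (e f : IExpr)
  | half (e : IExpr)

/-- Expressions with real values. -/
inductive RExpr where
  | const (m : ℤ)
  | var (x : ℕ)
  | cell (a : ℕ) (i : IExpr)
  | add (e f : RExpr)
  | sub (e f : RExpr)
  | mul (e f : RExpr)
  | sqrt (e : RExpr)

/-- Tests: comparisons of two integers or of two reals, and their Boolean combinations. -/
inductive BExpr where
  | ile (e f : IExpr)
  | rle (e f : RExpr)
  | neg (b : BExpr)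
  | conj (b c : BExpr)

/-- Programs. -/
inductive Cmd where
  | skip
  | setI (x : ℕ) (e : IExpr)
  | setR (x : ℕ) (e : RExpr)
  | storeI (a : ℕ) (i : IExpr) (e : IExpr)
  | storeR (a : ℕ) (i : IExpr) (e : RExpr)
  | seq (c d : Cmd)
  | cond (b : BExpr) (c d : Cmd)
  | loop (b : BExpr) (c : Cmd)

def IExpr.eval (s : State) : IExpr → ℕ
  | .const m => m
  | .var x => s.ivar x
  | .cell a i => s.iarr a (i.eval s)
  | .add e f => e.eval s + f.eval s
  | .sub e f => e.eval s - f.eval s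
  | .half e => e.eval s / 2

noncomputable def RExpr.eval (s : State) : RExpr → ℝ
  | .const m => m
  | .var x => s.rvar x
  | .cell a i => s.rarr a (i.eval s)
  | .add e f => e.eval s + f.eval s
  | .sub e f => e.eval s - f.eval s
  | .mul e f => e.eval s * f.eval s
  | .sqrt e => Real.sqrt (e.eval s)

def BExpr.Holds (s : State) : BExpr → Prop
  | .ile e f => e.eval s ≤ f.eval s
  | .rle e f => e.eval s ≤ f.eval s
  | .neg b => ¬ b.Holds s
  | .conj b c => b.Holds s ∧ c.Holds s

/-- The time for evaluating an integer expression. -/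
def IExpr.cost : IExpr → ℕ
  | .const _ => 1
  | .var _ => 1
  | .cell _ i => i.cost + 1
  | .add e f => e.cost + f.cost + 1
  | .sub e f => e.cost + f.cost + 1
  | .half e => e.cost + 1

/-- The time for evaluating a real expression. -/
def RExpr.cost : RExpr → ℕ
  | .const _ => 1
  | .var _ => 1
  | .cell _ i => i.cost + 1
  | .add e f => e.cost + f.cost + 1
  | .sub e f => e.cost + f.cost + 1
  | .mul e f => e.cost + f.cost + 1
  | .sqrt e => e.cost + 1

/-- The time for evaluating a test. -/
def BExpr.cost : BExpr → ℕ
  | .ile e f => e.cost + f.cost + 1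
  | .rle e f => e.cost + f.cost + 1
  | .neg b => b.cost + 1
  | .conj b c => b.cost + c.cost + 1

def State.setI (s : State) (x v : ℕ) : State :=
  { s with ivar := Function.update s.ivar x v }

def State.setR (s : State) (x : ℕ) (v : ℝ) : State :=
  { s with rvar := Function.update s.rvar x v }

def State.storeI (s : State) (a i v : ℕ) : State :=
  { s with iarr := Function.update s.iarr a (Function.update (s.iarr a) i v) }

def State.storeR (s : State) (a i : ℕ) (v : ℝ) : State :=
  { s with rarr := Function.update s.rarr a (Function.update (s.rarr a) i v) }

/-- `Exec c s s' t`: the program `c`, started on the memory `s`, halts with the memory `s'` after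
exactly `t` units of time. -/
inductive Exec : Cmd → State → State → ℕ → Prop
  | skip (s : State) : Exec .skip s s 1
  | setI (s : State) (x : ℕ) (e : IExpr) :
      Exec (.setI x e) s (s.setI x (e.eval s)) (e.cost + 1)
  | setR (s : State) (x : ℕ) (e : RExpr) :
      Exec (.setR x e) s (s.setR x (e.eval s)) (e.cost + 1)
  | storeI (s : State) (a : ℕ) (i e : IExpr) :
      Exec (.storeI a i e) s (s.storeI a (i.eval s) (e.eval s)) (i.cost + e.cost + 1)
  | storeR (s : State) (a : ℕ) (i : IExpr) (e : RExpr) :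
      Exec (.storeR a i e) s (s.storeR a (i.eval s) (e.eval s)) (i.cost + e.cost + 1)
  | seq {c d : Cmd} {s s' s'' : State} {t u : ℕ} :
      Exec c s s' t → Exec d s' s'' u → Exec (.seq c d) s s'' (t + u)
  | condTrue {b : BExpr} {c d : Cmd} {s s' : State} {t : ℕ} :
      b.Holds s → Exec c s s' t → Exec (.cond b c d) s s' (b.cost + 1 + t)
  | condFalse {b : BExpr} {c d : Cmd} {s s' : State} {t : ℕ} :
      ¬ b.Holds s → Exec d s s' t → Exec (.cond b c d) s s' (b.cost + 1 + t)
  | loopDone {b : BExpr} {c : Cmd} {s : State} :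
      ¬ b.Holds s → Exec (.loop b c) s s (b.cost + 1)
  | loopStep {b : BExpr} {c : Cmd} {s s' s'' : State} {t u : ℕ} :
      b.Holds s → Exec c s s' t → Exec (.loop b c) s' s'' u →
      Exec (.loop b c) s s'' (b.cost + 1 + t + u)

/-- The machine is deterministic: final memory and running time are unique. -/
theorem Exec.unique {c : Cmd} {s s₁ s₂ : State} {t₁ t₂ : ℕ}
    (h₁ : Exec c s s₁ t₁) (h₂ : Exec c s s₂ t₂) : s₁ = s₂ ∧ t₁ = t₂ := by
  induction h₁ generalizing s₂ t₂ with
  | seq _ _ ih ih' =>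
    cases h₂ with
    | seq a b => obtain ⟨rfl, rfl⟩ := ih a; obtain ⟨rfl, rfl⟩ := ih' b; exact ⟨rfl, rfl⟩
  | condTrue hb _ ih =>
    cases h₂ with
    | condTrue _ a => obtain ⟨rfl, rfl⟩ := ih a; exact ⟨rfl, rfl⟩
    | condFalse hn _ => exact absurd hb hn
  | condFalse hb _ ih =>
    cases h₂ with
    | condTrue hn _ => exact absurd hn hb
    | condFalse _ a => obtain ⟨rfl, rfl⟩ := ih a; exact ⟨rfl, rfl⟩
  | loopDone hb =>
    cases h₂ with
    | loopDone _ => exact ⟨rfl, rfl⟩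
    | loopStep hn _ _ => exact absurd hn hb
  | loopStep hb _ _ ih ih' =>
    cases h₂ with
    | loopDone hn => exact absurd hb hn
    | loopStep _ a b => obtain ⟨rfl, rfl⟩ := ih a; obtain ⟨rfl, rfl⟩ := ih' b; exact ⟨rfl, rfl⟩
  | _ => cases h₂; exact ⟨rfl, rfl⟩

/-- The first `m` cells of the real arrays `a` and `b` contain the `x`- and `y`-coordinates of the
points of `P`, in some order, each point exactly once. -/
def State.Lists (s : State) (a b m : ℕ) (P : Finset Point) : Prop :=
  Set.BijOn (fun i => (!₂[s.rarr a i, s.rarr b i] : Point)) (Set.Iio m) (P : Set Point)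

/-- The input: the points of `P` in the arrays `0` and `1`, their number in the integer variable
`0`, and `k` in the integer variable `1`. The rest of the memory is arbitrary. -/
def State.IsInput (s : State) (P : Finset Point) (k : ℕ) : Prop :=
  s.ivar 0 = P.card ∧ s.ivar 1 = k ∧ s.Lists 0 1 P.card P

/-- The output: the number `opt(P, k)` in the real variable `0`, and the points of an optimal
solution in the arrays `2` and `3`, with their number in the integer variable `2`. -/
def State.IsOutput (s : State) (P : Finset Point) (k : ℕ) : Prop :=
  0 ≤ s.rvar 0 ∧ ENNReal.ofReal (s.rvar 0) = opt P k ∧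
    ∃ Q : Finset Point, IsOptimalSolution P k Q ∧ s.Lists 2 3 (s.ivar 2) Q

end RealRAM

namespace RealRAM

/-! ## Total correctness with running times -/

/-- `Run c s Q`: the program `c` halts on `s`, with a memory and a running time that satisfy `Q`. -/
def Run (c : Cmd) (s : State) (Q : State → ℕ → Prop) : Prop :=
  ∃ s' t, Exec c s s' t ∧ Q s' t

theorem Run.mono {c : Cmd} {s : State} {Q Q' : State → ℕ → Prop} (h : Run c s Q)
    (hQ : ∀ s' t, Q s' t → Q' s' t) : Run c s Q' := by
  obtain ⟨s', t, he, hq⟩ := h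
  exact ⟨s', t, he, hQ _ _ hq⟩

theorem run_skip {s : State} {Q : State → ℕ → Prop} : Run .skip s Q ↔ Q s 1 :=
  ⟨fun ⟨_, _, he, h⟩ => by cases he; exact h, fun h => ⟨_, _, .skip s, h⟩⟩

theorem run_setI {s : State} {x : ℕ} {e : IExpr} {Q : State → ℕ → Prop} :
    Run (.setI x e) s Q ↔ Q (s.setI x (e.eval s)) (e.cost + 1) :=
  ⟨fun ⟨_, _, he, h⟩ => by cases he; exact h, fun h => ⟨_, _, .setI s x e, h⟩⟩

theorem run_setR {s : State} {x : ℕ} {e : RExpr} {Q : State → ℕ → Prop} :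
    Run (.setR x e) s Q ↔ Q (s.setR x (e.eval s)) (e.cost + 1) :=
  ⟨fun ⟨_, _, he, h⟩ => by cases he; exact h, fun h => ⟨_, _, .setR s x e, h⟩⟩

theorem run_storeI {s : State} {a : ℕ} {i e : IExpr} {Q : State → ℕ → Prop} :
    Run (.storeI a i e) s Q ↔ Q (s.storeI a (i.eval s) (e.eval s)) (i.cost + e.cost + 1) :=
  ⟨fun ⟨_, _, he, h⟩ => by cases he; exact h, fun h => ⟨_, _, .storeI s a i e, h⟩⟩

theorem run_storeR {s : State} {a : ℕ} {i : IExpr} {e : RExpr} {Q : State → ℕ → Prop} :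
    Run (.storeR a i e) s Q ↔ Q (s.storeR a (i.eval s) (e.eval s)) (i.cost + e.cost + 1) :=
  ⟨fun ⟨_, _, he, h⟩ => by cases he; exact h, fun h => ⟨_, _, .storeR s a i e, h⟩⟩

theorem run_seq {s : State} {c d : Cmd} {Q : State → ℕ → Prop} :
    Run (.seq c d) s Q ↔ Run c s fun s' t => Run d s' fun s'' u => Q s'' (t + u) := by
  constructor
  · rintro ⟨_, _, he, h⟩
    cases he with
    | seq h₁ h₂ => exact ⟨_, _, h₁, _, _, h₂, h⟩
  · rintro ⟨_, _, h₁, _, _, h₂, h⟩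
    exact ⟨_, _, .seq h₁ h₂, h⟩

theorem run_cond {s : State} {b : BExpr} {c d : Cmd} {Q : State → ℕ → Prop} :
    Run (.cond b c d) s Q ↔ (b.Holds s → Run c s fun s' t => Q s' (b.cost + 1 + t)) ∧
      (¬ b.Holds s → Run d s fun s' t => Q s' (b.cost + 1 + t)) := by
  constructor
  · rintro ⟨_, _, he, h⟩
    cases he with
    | condTrue hb h₁ => exact ⟨fun _ => ⟨_, _, h₁, h⟩, fun hn => absurd hb hn⟩
    | condFalse hb h₁ => exact ⟨fun hn => absurd hn hb, fun _ => ⟨_, _, h₁, h⟩⟩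
  · rintro ⟨h₁, h₂⟩
    by_cases hb : b.Holds s
    · obtain ⟨_, _, he, h⟩ := h₁ hb
      exact ⟨_, _, .condTrue hb he, h⟩
    · obtain ⟨_, _, he, h⟩ := h₂ hb
      exact ⟨_, _, .condFalse hb he, h⟩

/-- The rule for loops, with an invariant `I` and a potential `Φ` that pays for the time. -/
theorem Run.loop {b : BExpr} {c : Cmd} (I : State → Prop) (Φ : State → ℕ) {s : State} (hs : I s)
    (step : ∀ s, I s → b.Holds s → Run c s fun s' t => I s' ∧ b.cost + 1 + t + Φ s' ≤ Φ s) :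
    Run (.loop b c) s fun s' t => I s' ∧ ¬ b.Holds s' ∧ t + Φ s' ≤ Φ s + (b.cost + 1) := by
  -- A round costs at least `b.cost + 1 > 0`, so `Φ` strictly decreases: the potential that bounds
  -- the time also proves termination.
  induction hn : Φ s using Nat.strong_induction_on generalizing s with
  | _ n ih =>
    by_cases hb : b.Holds s
    · obtain ⟨s', t, he, hI, hΦ⟩ := step s hs hb
      obtain ⟨s'', u, he', hI', hb', hu⟩ := ih (Φ s') (by omega) hI rfl
      exact ⟨s'', _, .loopStep hb he he', hI', hb', by omega⟩
    · exact ⟨s, _, .loopDone hb, hs, hb, by omega⟩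

/-! ### Frames -/

def Cmd.ivars : Cmd → List ℕ
  | .setI x _ => [x]
  | .seq c d => c.ivars ++ d.ivars
  | .cond _ c d => c.ivars ++ d.ivars
  | .loop _ c => c.ivars
  | _ => []

def Cmd.rvars : Cmd → List ℕ
  | .setR x _ => [x]
  | .seq c d => c.rvars ++ d.rvars
  | .cond _ c d => c.rvars ++ d.rvars
  | .loop _ c => c.rvars
  | _ => []

def Cmd.iarrs : Cmd → List ℕ
  | .storeI a _ _ => [a]
  | .seq c d => c.iarrs ++ d.iarrs
  | .cond _ c d => c.iarrs ++ d.iarrs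
  | .loop _ c => c.iarrs
  | _ => []

def Cmd.rarrs : Cmd → List ℕ
  | .storeR a _ _ => [a]
  | .seq c d => c.rarrs ++ d.rarrs
  | .cond _ c d => c.rarrs ++ d.rarrs
  | .loop _ c => c.rarrs
  | _ => []

/-- `s'` agrees with `s` outside the variables and arrays that `c` writes to. -/
structure Frame (c : Cmd) (s s' : State) : Prop where
  ivar : ∀ x, x ∉ c.ivars → s'.ivar x = s.ivar x
  rvar : ∀ x, x ∉ c.rvars → s'.rvar x = s.rvar x
  iarr : ∀ a, a ∉ c.iarrs → s'.iarr a = s.iarr a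
  rarr : ∀ a, a ∉ c.rarrs → s'.rarr a = s.rarr a

@[simp] theorem State.setI_ivar (s : State) (x v y : ℕ) :
    (s.setI x v).ivar y = if y = x then v else s.ivar y := Function.update_apply ..
@[simp] theorem State.setI_rvar (s : State) (x v : ℕ) : (s.setI x v).rvar = s.rvar := rfl
@[simp] theorem State.setI_iarr (s : State) (x v : ℕ) : (s.setI x v).iarr = s.iarr := rfl
@[simp] theorem State.setI_rarr (s : State) (x v : ℕ) : (s.setI x v).rarr = s.rarr := rfl
@[simp] theorem State.setR_ivar (s : State) (x : ℕ) (v : ℝ) : (s.setR x v).ivar = s.ivar := rfl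
@[simp] theorem State.setR_rvar (s : State) (x : ℕ) (v : ℝ) (y : ℕ) :
    (s.setR x v).rvar y = if y = x then v else s.rvar y := Function.update_apply ..
@[simp] theorem State.setR_iarr (s : State) (x : ℕ) (v : ℝ) : (s.setR x v).iarr = s.iarr := rfl
@[simp] theorem State.setR_rarr (s : State) (x : ℕ) (v : ℝ) : (s.setR x v).rarr = s.rarr := rfl
@[simp] theorem State.storeI_ivar (s : State) (a i v : ℕ) :
    (s.storeI a i v).ivar = s.ivar := rfl
@[simp] theorem State.storeI_rvar (s : State) (a i v : ℕ) :
    (s.storeI a i v).rvar = s.rvar := rfl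
@[simp] theorem State.storeI_iarr (s : State) (a i v b : ℕ) :
    (s.storeI a i v).iarr b = if b = a then Function.update (s.iarr a) i v else s.iarr b :=
  Function.update_apply ..
@[simp] theorem State.storeI_rarr (s : State) (a i v : ℕ) :
    (s.storeI a i v).rarr = s.rarr := rfl
@[simp] theorem State.storeR_ivar (s : State) (a i : ℕ) (v : ℝ) :
    (s.storeR a i v).ivar = s.ivar := rfl
@[simp] theorem State.storeR_rvar (s : State) (a i : ℕ) (v : ℝ) :
    (s.storeR a i v).rvar = s.rvar := rfl
@[simp] theorem State.storeR_iarr (s : State) (a i : ℕ) (v : ℝ) :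
    (s.storeR a i v).iarr = s.iarr := rfl
@[simp] theorem State.storeR_rarr (s : State) (a i : ℕ) (v : ℝ) (b : ℕ) :
    (s.storeR a i v).rarr b = if b = a then Function.update (s.rarr a) i v else s.rarr b :=
  Function.update_apply ..

/-- The sets of written names are syntactic, so for a concrete program `by decide` settles which
variables and arrays survive. Specifications can then list only what changes. -/
theorem Exec.frame {c : Cmd} {s s' : State} {t : ℕ} (h : Exec c s s' t) : Frame c s s' := by
  induction h with
  | seq _ _ h₁ h₂ =>
    constructor <;> intro x hx <;> simp only [Cmd.ivars, Cmd.rvars, Cmd.iarrs, Cmd.rarrs,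
      List.mem_append, not_or] at hx
    · rw [h₂.ivar x hx.2, h₁.ivar x hx.1]
    · rw [h₂.rvar x hx.2, h₁.rvar x hx.1]
    · rw [h₂.iarr x hx.2, h₁.iarr x hx.1]
    · rw [h₂.rarr x hx.2, h₁.rarr x hx.1]
  | condTrue _ _ h₁ =>
    constructor <;> intro x hx <;> simp only [Cmd.ivars, Cmd.rvars, Cmd.iarrs, Cmd.rarrs,
      List.mem_append, not_or] at hx
    · exact h₁.ivar x hx.1
    · exact h₁.rvar x hx.1
    · exact h₁.iarr x hx.1
    · exact h₁.rarr x hx.1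
  | condFalse _ _ h₁ =>
    constructor <;> intro x hx <;> simp only [Cmd.ivars, Cmd.rvars, Cmd.iarrs, Cmd.rarrs,
      List.mem_append, not_or] at hx
    · exact h₁.ivar x hx.2
    · exact h₁.rvar x hx.2
    · exact h₁.iarr x hx.2
    · exact h₁.rarr x hx.2
  | loopStep _ _ _ h₁ h₂ =>
    constructor <;> intro x hx
    · rw [h₂.ivar x hx, h₁.ivar x hx]
    · rw [h₂.rvar x hx, h₁.rvar x hx]
    · rw [h₂.iarr x hx, h₁.iarr x hx]
    · rw [h₂.rarr x hx, h₁.rarr x hx]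
  | _ =>
    constructor <;> intro x hx <;>
      simp_all [Cmd.ivars, Cmd.rvars, Cmd.iarrs, Cmd.rarrs]

theorem Run.frame {c : Cmd} {s : State} {Q : State → ℕ → Prop} (h : Run c s Q) :
    Run c s fun s' t => Q s' t ∧ Frame c s s' := by
  obtain ⟨s', t, he, hq⟩ := h
  exact ⟨s', t, he, hq, he.frame⟩

/-! ### Abbreviations for programs -/

infixr:60 " ;; " => Cmd.seq

abbrev IExpr.succ (e : IExpr) : IExpr := .add e (.const 1)

abbrev BExpr.ilt (e f : IExpr) : BExpr := .neg (.ile f e)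

abbrev BExpr.rlt (e f : RExpr) : BExpr := .neg (.rle f e)

abbrev BExpr.disj (b c : BExpr) : BExpr := .neg (.conj (.neg b) (.neg c))

end RealRAM

/-! ## Segments of sequences as lists -/

/-- The list of the values `A i, …, A (j - 1)`. -/
def seg {α : Type*} (A : ℕ → α) (i j : ℕ) : List α := (List.range' i (j - i)).map A

section seg
variable {α : Type*} {A B : ℕ → α} {i j k : ℕ}

theorem seg_nil (h : j ≤ i) : seg A i j = [] := by
  simp [seg, Nat.sub_eq_zero_of_le h]

theorem seg_cons (h : i < j) : seg A i j = A i :: seg A (i + 1) j := by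
  obtain ⟨d, rfl⟩ := Nat.exists_eq_add_of_lt h
  simp [seg, show i + d + 1 - i = d + 1 by omega, show i + d + 1 - (i + 1) = d by omega,
    List.range'_succ]

theorem seg_append (h : i ≤ j) (h' : j ≤ k) : seg A i j ++ seg A j k = seg A i k := by
  obtain ⟨d, rfl⟩ := Nat.exists_eq_add_of_le h
  obtain ⟨e, rfl⟩ := Nat.exists_eq_add_of_le h'
  simp only [seg, ← List.map_append, show i + d + e - (i + d) = e by omega,
    show i + d - i = d by omega, show i + d + e - i = d + e by omega]
  congr 1
  simp

theorem seg_succ (h : i ≤ j) : seg A i (j + 1) = seg A i j ++ [A j] := by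
  rw [← seg_append h (Nat.le_succ j), seg_cons (Nat.lt_succ_self j), seg_nil le_rfl]

theorem seg_congr (h : ∀ x, i ≤ x → x < j → A x = B x) : seg A i j = seg B i j := by
  apply List.map_congr_left
  intro x hx
  rw [List.mem_range'_1] at hx
  exact h x hx.1 (by omega)

theorem mem_seg {a : α} : a ∈ seg A i j ↔ ∃ x, i ≤ x ∧ x < j ∧ A x = a := by
  simp only [seg, List.mem_map, List.mem_range'_1]
  exact ⟨fun ⟨x, hx, h⟩ => ⟨x, hx.1, by omega, h⟩, fun ⟨x, h₁, h₂, h⟩ => ⟨x, ⟨h₁, by omega⟩, h⟩⟩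

theorem length_seg : (seg A i j).length = j - i := by simp [seg]

theorem pairwise_seg {R : α → α → Prop} :
    (seg A i j).Pairwise R ↔ ∀ x y, i ≤ x → x < y → y < j → R (A x) (A y) := by
  rw [seg, List.pairwise_map, List.pairwise_iff_getElem]
  simp only [List.length_range', List.getElem_range', one_mul]
  constructor
  · intro h x y hx hxy hy
    have := h (x - i) (y - i) (by omega) (by omega) (by omega)
    rwa [Nat.add_sub_cancel' hx, Nat.add_sub_cancel' (by omega)] at this
  · intro h x y hx hy hxy
    exact h _ _ (by omega) (by omega) (by omega)

end seg

/-! ## Merging -/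

namespace RealRAM

/-- The pairs in the real arrays `a` and `b`. -/
def State.pairs (s : State) (a b i : ℕ) : ℝ × ℝ := (s.rarr a i, s.rarr b i)

/-- The blocks of length `w` of the first `n` terms of `A` are sorted by decreasing first entry. -/
def BlockSorted (A : ℕ → ℝ × ℝ) (n w : ℕ) : Prop :=
  ∀ b, w ∣ b → (seg A b (min (b + w) n)).Pairwise fun p q => q.1 ≤ p.1

theorem blockSorted_one (A : ℕ → ℝ × ℝ) (n : ℕ) : BlockSorted A n 1 := by
  intro b _
  rw [pairwise_seg]
  omega

open Classical in
/-- The merge of two lists by decreasing first entry. -/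
noncomputable def mergeDesc (l m : List (ℝ × ℝ)) : List (ℝ × ℝ) :=
  l.merge m fun p q => decide (q.1 ≤ p.1)

theorem mergeDesc_perm (l m : List (ℝ × ℝ)) : (mergeDesc l m).Perm (l ++ m) :=
  List.merge_perm_append _

theorem mergeDesc_pairwise {l m : List (ℝ × ℝ)} (hl : l.Pairwise fun p q => q.1 ≤ p.1)
    (hm : m.Pairwise fun p q => q.1 ≤ p.1) : (mergeDesc l m).Pairwise fun p q => q.1 ≤ p.1 := by
  have := List.pairwise_merge (le := fun p q : ℝ × ℝ => open Classical in decide (q.1 ≤ p.1))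
    (by simp only [decide_eq_true_eq]; exact fun a b c h h' => h'.trans h)
    (by simp only [Bool.or_eq_true, decide_eq_true_eq]; exact fun a b => le_total _ _) l m
    (by simpa using hl) (by simpa using hm)
  simpa [mergeDesc] using this

theorem mergeDesc_nil_left (m : List (ℝ × ℝ)) : mergeDesc [] m = m := by simp [mergeDesc]

theorem mergeDesc_nil_right (l : List (ℝ × ℝ)) : mergeDesc l [] = l := by simp [mergeDesc]

theorem mergeDesc_cons_of_le {a b : ℝ × ℝ} (l m : List (ℝ × ℝ)) (h : b.1 ≤ a.1) :
    mergeDesc (a :: l) (b :: m) = a :: mergeDesc l (b :: m) := by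
  simp [mergeDesc, h]

theorem mergeDesc_cons_of_not_le {a b : ℝ × ℝ} (l m : List (ℝ × ℝ)) (h : ¬ b.1 ≤ a.1) :
    mergeDesc (a :: l) (b :: m) = b :: mergeDesc (a :: l) m := by
  simp [mergeDesc, h]

/-- One step of the merge of the segments `i, …, mid - 1` and `j, …, e - 1`. -/
def mergeStep : Cmd :=
  .cond (.conj (.ilt (.var 8) (.var 6))
      (.disj (.ile (.var 7) (.var 9)) (.rle (.cell 0 (.var 9)) (.cell 0 (.var 8)))))
    (.storeR 4 (.var 10) (.cell 0 (.var 8)) ;; .storeR 5 (.var 10) (.cell 1 (.var 8)) ;;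
      .setI 8 (.succ (.var 8)))
    (.storeR 4 (.var 10) (.cell 0 (.var 9)) ;; .storeR 5 (.var 10) (.cell 1 (.var 9)) ;;
      .setI 9 (.succ (.var 9))) ;;
  .setI 10 (.succ (.var 10))

def mergeLoop : Cmd := .loop (.ilt (.var 10) (.var 7)) mergeStep

theorem State.pairs_update {s s' : State} {a b o : ℕ} {x y : ℝ}
    (ha : s'.rarr a = Function.update (s.rarr a) o x)
    (hb : s'.rarr b = Function.update (s.rarr b) o y) :
    s'.pairs a b = Function.update (s.pairs a b) o (x, y) := by
  funext z
  by_cases hz : z = o <;> simp [State.pairs, ha, hb, hz]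

theorem seg_update_succ {α : Type*} (A : ℕ → α) {i o : ℕ} (h : i ≤ o) (a : α) :
    seg (Function.update A o a) i (o + 1) = seg A i o ++ [a] := by
  rw [seg_succ h, Function.update_self]
  congr 1
  exact seg_congr fun x _ hx => Function.update_of_ne (by omega) _ _

/-- The output so far followed by the merge of the two remaining segments never changes. The
equation `o + mid = i + j` makes both segments empty when the output position reaches `e`. -/
theorem mergeLoop_spec (s : State) {b mid e : ℕ} (h₁ : b ≤ mid) (h₂ : mid ≤ e)
    (hmid : s.ivar 6 = mid) (he : s.ivar 7 = e) (hi : s.ivar 8 = b) (hj : s.ivar 9 = mid)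
    (ho : s.ivar 10 = b) :
    Run mergeLoop s fun s' t => t ≤ 50 * (e - b) + 10 ∧
      seg (s'.pairs 4 5) 0 e = seg (s.pairs 4 5) 0 b ++
        mergeDesc (seg (s.pairs 0 1) b mid) (seg (s.pairs 0 1) mid e) := by
  refine (Run.loop (fun s' => ∃ i j o, s'.ivar 6 = mid ∧ s'.ivar 7 = e ∧ s'.ivar 8 = i ∧
    s'.ivar 9 = j ∧ s'.ivar 10 = o ∧ b ≤ i ∧ i ≤ mid ∧ mid ≤ j ∧ j ≤ e ∧ o + mid = i + j ∧
    s'.pairs 0 1 = s.pairs 0 1 ∧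
    seg (s'.pairs 4 5) 0 o ++ mergeDesc (seg (s.pairs 0 1) i mid) (seg (s.pairs 0 1) j e) =
      seg (s.pairs 4 5) 0 b ++ mergeDesc (seg (s.pairs 0 1) b mid) (seg (s.pairs 0 1) mid e))
    (fun s' => 50 * (e - s'.ivar 10))
    ⟨b, mid, b, hmid, he, hi, hj, ho, le_rfl, h₁, le_rfl, h₂, by omega, rfl, rfl⟩ ?_).mono ?_
  · rintro s' ⟨i, j, o, h6, h7, h8, h9, h10, hbi, him, hmj, hje, hsum, hA, hseg⟩ hb
    simp only [BExpr.Holds, IExpr.eval, h10, h7, not_le] at hb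
    simp only [mergeStep, run_seq, run_cond, run_storeR, run_setI, BExpr.Holds, IExpr.eval,
      RExpr.eval, h6, h7, h8, h9, h10, IExpr.cost, RExpr.cost, BExpr.cost, State.storeR_ivar,
      State.setI_ivar, State.storeR_rarr]
    have hX : ∀ x, s'.rarr 0 x = (s.pairs 0 1 x).1 := fun x => by rw [← hA]; rfl
    have hY : ∀ x, s'.rarr 1 x = (s.pairs 0 1 x).2 := fun x => by rw [← hA]; rfl
    refine ⟨fun hc => ?_, fun hc => ?_⟩
    · refine ⟨⟨i + 1, j, o + 1, ?_⟩, ?_⟩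
      · simp only [↓reduceIte, Nat.reduceEqDiff, true_and]
        refine ⟨by omega, by omega, hmj, hje, by omega, ?_, ?_⟩
        · rw [← hA]; rfl
        · rw [State.pairs_update (s := s') (o := o) (x := s'.rarr 0 i) (y := s'.rarr 1 i)
            (by simp) (by simp), seg_update_succ _ (Nat.zero_le _), ← hseg]
          rw [seg_cons (A := s.pairs 0 1) (i := i) (j := mid) (by omega)]
          have hp : (s'.rarr 0 i, s'.rarr 1 i) = s.pairs 0 1 i := by rw [hX, hY]
          rw [hp, List.append_assoc]
          congr 1
          rcases Nat.lt_or_ge j e with hj' | hj'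
          · rw [seg_cons hj', mergeDesc_cons_of_le]
            · rfl
            · rw [← hX, ← hX]
              by_contra hcon
              exact hc.2 ⟨by omega, hcon⟩
          · rw [seg_nil hj', mergeDesc_nil_right, mergeDesc_nil_right]
            rfl
      · simp only [↓reduceIte, Nat.reduceEqDiff]
        omega
    · have hj' : j < e := by
        by_contra hcon
        exact hc ⟨by omega, fun h => h.1 (by omega)⟩
      refine ⟨⟨i, j + 1, o + 1, ?_⟩, ?_⟩
      · simp only [↓reduceIte, Nat.reduceEqDiff, true_and]
        refine ⟨by omega, by omega, by omega, by omega, by omega, ?_, ?_⟩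
        · rw [← hA]; rfl
        · rw [State.pairs_update (s := s') (o := o) (x := s'.rarr 0 j) (y := s'.rarr 1 j)
            (by simp) (by simp), seg_update_succ _ (Nat.zero_le _), ← hseg]
          rw [seg_cons (A := s.pairs 0 1) (i := j) (j := e) (by omega)]
          have hp : (s'.rarr 0 j, s'.rarr 1 j) = s.pairs 0 1 j := by rw [hX, hY]
          rw [hp, List.append_assoc]
          congr 1
          rcases Nat.lt_or_ge i mid with hi' | hi'
          · rw [seg_cons hi', mergeDesc_cons_of_not_le]
            · rfl
            · rw [← hX, ← hX]
              exact fun hcon => hc ⟨by omega, fun h => h.2 hcon⟩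
          · rw [seg_nil hi', mergeDesc_nil_left, mergeDesc_nil_left]
            rfl
      · simp only [↓reduceIte, Nat.reduceEqDiff]
        omega
  · rintro s' t ⟨⟨i, j, o, h6, h7, h8, h9, h10, hbi, him, hmj, hje, hsum, hA, hseg⟩, hb, ht⟩
    simp only [BExpr.Holds, IExpr.eval, h10, h7, not_not] at hb
    simp only [BExpr.cost, IExpr.cost, ho] at ht
    refine ⟨by omega, ?_⟩
    rw [← hseg, seg_nil (i := i) (by omega), seg_nil (i := j) (by omega), mergeDesc_nil_left,
      List.append_nil, show o = e by omega]

/-- Sets the variable `x` to the minimum of the variables `x` and `y`. -/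
def setMin (x y : ℕ) : Cmd := .cond (.ilt (.var y) (.var x)) (.setI x (.var y)) .skip

/-- The postcondition is asked for all times up to a bound, so that callers need not treat the two
branches separately. -/
theorem run_setMin {x y : ℕ} {s : State} {Q : State → ℕ → Prop}
    (h : ∀ t ≤ 10, Q (s.setI x (min (s.ivar x) (s.ivar y))) t) : Run (setMin x y) s Q := by
  simp only [setMin, run_cond, run_setI, run_skip, BExpr.Holds, IExpr.eval, IExpr.cost, BExpr.cost]
  refine ⟨fun hc => ?_, fun hc => ?_⟩
  · have := h 7 (by omega)
    rwa [min_eq_right (by omega)] at this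
  · have := h 6 (by omega)
    rw [min_eq_left (by omega)] at this
    convert this using 1
    simp [State.setI]

/-- Merges the blocks of length `w` in pairs, from the arrays `0`, `1` to the arrays `4`, `5`. -/
def mergeBlocks : Cmd :=
  .loop (.ilt (.var 5) (.var 0))
    (.setI 6 (.add (.var 5) (.var 4)) ;; setMin 6 0 ;;
      .setI 7 (.add (.add (.var 5) (.var 4)) (.var 4)) ;; setMin 7 0 ;;
      .setI 8 (.var 5) ;; .setI 9 (.var 6) ;; .setI 10 (.var 5) ;; mergeLoop ;;
      .setI 5 (.var 7))

theorem eq_of_seg_eq {α : Type*} {A B : ℕ → α} {n : ℕ} (h : seg A 0 n = seg B 0 n) {x : ℕ}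
    (hx : x < n) : A x = B x := by
  have := congrArg (fun l => l[x]?) h
  simpa [seg, hx] using this

/-- Every round advances `b` by at least one, so its constant overhead is charged to the cells it
writes. The last pair of blocks may be cut off at `n`; hence the alternative `b = n` to divisibility
in the invariant. -/
theorem mergeBlocks_spec (s : State) {n w : ℕ} (hn : s.ivar 0 = n) (hw : s.ivar 4 = w)
    (hb : s.ivar 5 = 0) (hw0 : 0 < w) (hs : BlockSorted (s.pairs 0 1) n w) :
    Run mergeBlocks s fun s' t => t ≤ 150 * n + 10 ∧
      (seg (s'.pairs 4 5) 0 n).Perm (seg (s.pairs 0 1) 0 n) ∧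
      BlockSorted (s'.pairs 4 5) n (w + w) := by
  refine (Run.loop (fun s' => ∃ b, s'.ivar 0 = n ∧ s'.ivar 4 = w ∧ s'.ivar 5 = b ∧ b ≤ n ∧
    (b = n ∨ w + w ∣ b) ∧ s'.rarr 0 = s.rarr 0 ∧ s'.rarr 1 = s.rarr 1 ∧
    (seg (s'.pairs 4 5) 0 b).Perm (seg (s.pairs 0 1) 0 b) ∧
    ∀ c, w + w ∣ c → c < b →
      (seg (s'.pairs 4 5) c (min (c + (w + w)) n)).Pairwise fun p q => q.1 ≤ p.1)
    (fun s' => 150 * (n - s'.ivar 5))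
    ⟨0, hn, hw, hb, Nat.zero_le _, Or.inr (dvd_zero _), rfl, rfl, by simp [seg], by simp⟩ ?_).mono ?_
  · rintro s₁ ⟨b, h0, h4, h5, hbn, hdvd, hX, hY, hperm, hsort⟩ hlt
    simp only [BExpr.Holds, IExpr.eval, h0, h5, not_le] at hlt
    have hdvd' : w + w ∣ b := hdvd.resolve_left hlt.ne
    simp only [run_seq, run_setI]
    refine run_setMin fun t₁ ht₁ => run_setMin fun t₂ ht₂ => ?_
    set mid := min (b + w) n with hmid
    set e := min (b + (w + w)) n with he
    have hA : s₁.pairs 0 1 = s.pairs 0 1 := by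
      funext x; simp [State.pairs, hX, hY]
    refine (mergeLoop_spec _ (b := b) (mid := mid) (e := e) (by omega) (by omega) ?_ ?_ ?_ ?_
      ?_).frame.mono ?_
    · simp [IExpr.eval, h0, h4, h5, hmid]
    · simp [IExpr.eval, h0, h4, h5, he, add_assoc]
    · simp [IExpr.eval, h5]
    · simp [IExpr.eval, h0, h4, h5, hmid]
    · simp [IExpr.eval, h5]
    rintro s₂ t ⟨⟨ht, hseg⟩, hF⟩
    have f0 : s₂.ivar 0 = n := by rw [hF.ivar 0 (by decide)]; simp [h0]
    have f4 : s₂.ivar 4 = w := by rw [hF.ivar 4 (by decide)]; simp [h4]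
    have f7 : s₂.ivar 7 = e := by
      rw [hF.ivar 7 (by decide)]; simp [IExpr.eval, h0, h4, h5, he, add_assoc]
    have fX : s₂.rarr 0 = s.rarr 0 := by rw [hF.rarr 0 (by decide)]; simpa using hX
    have fY : s₂.rarr 1 = s.rarr 1 := by rw [hF.rarr 1 (by decide)]; simpa using hY
    replace hseg : seg (s₂.pairs 4 5) 0 e = seg (s₁.pairs 4 5) 0 b ++
        mergeDesc (seg (s₁.pairs 0 1) b mid) (seg (s₁.pairs 0 1) mid e) := hseg
    rw [hA] at hseg
    have hpre : seg (s₂.pairs 4 5) 0 b = seg (s₁.pairs 4 5) 0 b ∧ seg (s₂.pairs 4 5) b e =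
        mergeDesc (seg (s.pairs 0 1) b mid) (seg (s.pairs 0 1) mid e) := by
      rw [← seg_append (Nat.zero_le b) (by omega : b ≤ e)] at hseg
      exact List.append_inj hseg (by simp [length_seg])
    refine ⟨⟨e, ?_⟩, ?_⟩
    · simp only [IExpr.eval, State.setI_ivar, State.setI_rarr, f0, f4, f7, fX, fY, ↓reduceIte,
        Nat.reduceEqDiff, true_and]
      refine ⟨by omega, ?_, ?_, ?_⟩
      · rcases le_total (b + (w + w)) n with h | h
        · rw [he, min_eq_left h]
          exact Or.inr ((Nat.dvd_add_left (dvd_refl _)).2 hdvd')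
        · exact Or.inl (min_eq_right h)
      · change (seg (s₂.pairs 4 5) 0 e).Perm _
        rw [hseg, ← seg_append (A := s.pairs 0 1) (Nat.zero_le b) (by omega : b ≤ e),
          ← seg_append (A := s.pairs 0 1) (by omega : b ≤ mid) (by omega : mid ≤ e)]
        exact hperm.append (mergeDesc_perm _ _)
      · intro c hc hce
        change (seg (s₂.pairs 4 5) c _).Pairwise _
        rcases Nat.lt_or_ge c b with hcb | hcb
        · have hcb' : c + (w + w) ≤ b := by
            obtain ⟨x, rfl⟩ := hc
            obtain ⟨y, rfl⟩ := hdvd'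
            have : x < y := Nat.lt_of_mul_lt_mul_left hcb
            calc (w + w) * x + (w + w) = (w + w) * (x + 1) := by ring
              _ ≤ (w + w) * y := Nat.mul_le_mul_left _ this
          rw [seg_congr (B := s₁.pairs 4 5)]
          · exact hsort c hc hcb
          · intro x _ hx
            exact eq_of_seg_eq hpre.1 (by omega)
        · have hcb' : c = b := by
            obtain ⟨x, rfl⟩ := hc
            obtain ⟨y, rfl⟩ := hdvd'
            have h1 : (w + w) * x < (w + w) * (y + 1) := by
              rw [mul_add, mul_one]; omega
            have h2 := Nat.lt_of_mul_lt_mul_left h1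
            have h3 : (w + w) * x ≤ (w + w) * y := Nat.mul_le_mul_left _ (by omega)
            omega
          subst hcb'
          rw [← he, hpre.2]
          refine mergeDesc_pairwise (hs c (dvd_trans ⟨2, by ring⟩ hc)) ?_
          rcases le_total (c + w) n with h | h
          · have hm : mid = c + w := min_eq_left h
            have := hs (c + w) ((Nat.dvd_add_left (dvd_refl _)).2 (dvd_trans ⟨2, by ring⟩ hc))
            rw [hm, he, ← add_assoc]
            exact this
          · rw [seg_nil (by omega)]
            exact List.Pairwise.nil
    · simp only [IExpr.eval, State.setI_ivar, f7, h5, ↓reduceIte, IExpr.cost, BExpr.cost]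
      omega
  · rintro s' t ⟨⟨b, h0, h4, h5, hbn, hdvd, hX, hY, hperm, hsort⟩, hlt, ht⟩
    simp only [BExpr.Holds, IExpr.eval, h0, h5, not_not] at hlt
    simp only [BExpr.cost, IExpr.cost, hb] at ht
    obtain rfl : b = n := by omega
    refine ⟨by omega, hperm, fun c hc => ?_⟩
    rcases Nat.lt_or_ge c b with h | h
    · exact hsort c hc h
    · rw [seg_nil (by omega)]
      exact List.Pairwise.nil

/-- Copies the first `n` cells of the arrays `4`, `5` to the arrays `0`, `1`. -/
def copyBack : Cmd :=
  .loop (.ilt (.var 8) (.var 0))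
    (.storeR 0 (.var 8) (.cell 4 (.var 8)) ;; .storeR 1 (.var 8) (.cell 5 (.var 8)) ;;
      .setI 8 (.succ (.var 8)))

theorem copyBack_spec (s : State) {n : ℕ} (hn : s.ivar 0 = n) (hi : s.ivar 8 = 0) :
    Run copyBack s fun s' t => t ≤ 30 * n + 10 ∧
      seg (s'.pairs 0 1) 0 n = seg (s.pairs 4 5) 0 n := by
  refine (Run.loop (fun s' => ∃ i ≤ n, s'.ivar 0 = n ∧ s'.ivar 8 = i ∧
    s'.pairs 4 5 = s.pairs 4 5 ∧ seg (s'.pairs 0 1) 0 i = seg (s.pairs 4 5) 0 i)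
    (fun s' => 30 * (n - s'.ivar 8))
    ⟨0, Nat.zero_le _, hn, hi, rfl, by simp [seg]⟩ ?_).mono ?_
  · rintro s' ⟨i, hin, h0, h8, hB, hseg⟩ hb
    simp only [BExpr.Holds, IExpr.eval, h0, h8, not_le] at hb
    simp only [run_seq, run_storeR, run_setI, IExpr.eval, RExpr.eval, IExpr.cost, RExpr.cost,
      BExpr.cost, State.storeR_ivar, State.setI_ivar, h8, ↓reduceIte]
    refine ⟨⟨i + 1, by omega, ?_⟩, by omega⟩
    simp only [h0, Nat.reduceEqDiff, ↓reduceIte, true_and]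
    refine ⟨by rw [← hB]; rfl, ?_⟩
    rw [State.pairs_update (s := s') (o := i) (x := s'.rarr 4 i) (y := s'.rarr 5 i) (by simp)
      (by simp), seg_update_succ _ (Nat.zero_le _), hseg, seg_succ (Nat.zero_le _), ← hB]
    rfl
  · rintro s' t ⟨⟨i, hin, h0, h8, hB, hseg⟩, hb, ht⟩
    simp only [BExpr.Holds, IExpr.eval, h0, h8, not_not] at hb
    simp only [BExpr.cost, IExpr.cost, hi] at ht
    obtain rfl : i = n := by omega
    exact ⟨by omega, hseg⟩

/-- Merges the blocks of length `w` of the arrays `0`, `1` in pairs, and doubles `w`. -/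
def mergePass : Cmd :=
  .setI 5 (.const 0) ;; mergeBlocks ;; .setI 8 (.const 0) ;; copyBack ;;
    .setI 4 (.add (.var 4) (.var 4))

theorem BlockSorted.congr {A B : ℕ → ℝ × ℝ} {n w : ℕ} (h : BlockSorted A n w)
    (hAB : seg A 0 n = seg B 0 n) : BlockSorted B n w := by
  intro b hb
  rw [seg_congr fun x _ hx => (eq_of_seg_eq hAB (by omega)).symm]
  exact h b hb

theorem mergePass_spec (s : State) {n w : ℕ} (hn : s.ivar 0 = n) (hw : s.ivar 4 = w)
    (hw0 : 0 < w) (hs : BlockSorted (s.pairs 0 1) n w) :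
    Run mergePass s fun s' t => t ≤ 180 * n + 40 ∧ s'.ivar 4 = w + w ∧
      (seg (s'.pairs 0 1) 0 n).Perm (seg (s.pairs 0 1) 0 n) ∧
      BlockSorted (s'.pairs 0 1) n (w + w) := by
  simp only [mergePass, run_seq, run_setI]
  refine (mergeBlocks_spec (s.setI 5 _) (n := n) (w := w) (by simp [hn]) (by simp [hw])
    (by simp [IExpr.eval]) hw0 hs).frame.mono ?_
  rintro s₁ t₁ ⟨⟨ht₁, hperm, hsort⟩, hF₁⟩
  refine (copyBack_spec (s₁.setI 8 _) (n := n)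
    (by simp only [State.setI_ivar, Nat.reduceEqDiff, ↓reduceIte]
        rw [hF₁.ivar 0 (by decide)]; simp [hn])
    (by simp [IExpr.eval])).frame.mono ?_
  rintro s₂ t₂ ⟨⟨ht₂, hseg⟩, hF₂⟩
  have hseg' : seg (s₂.pairs 0 1) 0 n = seg (s₁.pairs 4 5) 0 n := hseg
  refine ⟨?_, ?_, ?_, ?_⟩
  · simp only [IExpr.cost]
    omega
  · simp only [IExpr.eval, State.setI_ivar, ↓reduceIte]
    rw [hF₂.ivar 4 (by decide)]
    simp only [State.setI_ivar, Nat.reduceEqDiff, ↓reduceIte]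
    rw [hF₁.ivar 4 (by decide)]
    simp [hw]
  · change (seg (s₂.pairs 0 1) 0 n).Perm _
    rw [hseg']
    exact hperm
  · exact hsort.congr hseg'.symm

end RealRAM

namespace RealRAM

/-! ## Sorting -/

/-- Sorts the first `n` cells of the arrays `0`, `1` by decreasing entry of the array `0`. -/
def mergeSort : Cmd :=
  .setI 4 (.const 1) ;; .loop (.ilt (.var 4) (.var 0)) mergePass

/-- Before each pass the width is `2 ^ l < n`, so there are at most `L` passes. `L` is left free
because the search uses one `L` for the lists of all levels. -/
theorem mergeSort_spec (s : State) {n L : ℕ} (hn : s.ivar 0 = n) (hL : n ≤ 2 ^ L) :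
    Run mergeSort s fun s' t => t ≤ (180 * n + 50) * L + 20 ∧
      (seg (s'.pairs 0 1) 0 n).Perm (seg (s.pairs 0 1) 0 n) ∧
      (seg (s'.pairs 0 1) 0 n).Pairwise fun p q => q.1 ≤ p.1 := by
  simp only [mergeSort, run_seq, run_setI]
  refine (Run.loop (fun s' => ∃ l ≤ L, s'.ivar 0 = n ∧ s'.ivar 4 = 2 ^ l ∧
    (seg (s'.pairs 0 1) 0 n).Perm (seg (s.pairs 0 1) 0 n) ∧ BlockSorted (s'.pairs 0 1) n (2 ^ l))
    (fun s' => (180 * n + 50) * (L - Nat.log 2 (s'.ivar 4)))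
    ?_ ?_).mono ?_
  · exact ⟨0, Nat.zero_le _, by simp [hn], by simp [IExpr.eval], List.Perm.refl _,
      blockSorted_one _ _⟩
  · rintro s₁ ⟨l, hl, h0, h4, hperm, hsort⟩ hb
    simp only [BExpr.Holds, IExpr.eval, h0, h4, not_le] at hb
    refine (mergePass_spec s₁ h0 h4 (by positivity) hsort).frame.mono ?_
    rintro s₂ t ⟨⟨ht, h4', hperm', hsort'⟩, hF⟩
    have hlt : l < L := by
      by_contra hcon
      exact absurd (hL.trans (Nat.pow_le_pow_right two_pos (not_lt.1 hcon))) hb.not_ge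
    have h2 : 2 ^ l + 2 ^ l = 2 ^ (l + 1) := by ring
    rw [h2] at h4' hsort'
    refine ⟨⟨l + 1, hlt, by rw [hF.ivar 0 (by decide), h0], h4', hperm'.trans hperm, hsort'⟩, ?_⟩
    simp only [h4, h4', Nat.log_pow one_lt_two, BExpr.cost, IExpr.cost]
    obtain ⟨d, rfl⟩ := Nat.exists_eq_add_of_lt hlt
    rw [show l + d + 1 - (l + 1) = d by omega, show l + d + 1 - l = d + 1 by omega, mul_add_one]
    omega
  · rintro s₁ t ⟨⟨l, hl, h0, h4, hperm, hsort⟩, hb, ht⟩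
    simp only [BExpr.Holds, IExpr.eval, h0, h4, not_not] at hb
    simp only [BExpr.cost, IExpr.cost, IExpr.eval, State.setI_ivar, ↓reduceIte, Nat.log_one_right,
      Nat.sub_zero] at ht ⊢
    refine ⟨by omega, hperm, ?_⟩
    have := hsort 0 (dvd_zero _)
    rwa [zero_add, min_eq_right hb] at this

end RealRAM

/-! ## Distances along a monotone sequence and greedy covers -/

/-- A symmetric function on the indices below `h` that, like the distances along a monotone
sequence, grows when the interval between the indices grows. -/
structure IntervalMono (f : ℕ → ℕ → ℝ) (h : ℕ) : Prop where
  symm : ∀ i j, f i j = f j i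
  self : ∀ i, f i i = 0
  mono : ∀ i i' j' j, i ≤ i' → i' ≤ j' → j' ≤ j → j < h → f i' j' ≤ f i j

theorem IntervalMono.nonneg {f : ℕ → ℕ → ℝ} {h : ℕ} (hf : IntervalMono f h) {i j : ℕ} (hi : i < h)
    (hj : j < h) : 0 ≤ f i j := by
  rcases le_total i j with hij | hij
  · rw [← hf.self i]
    exact hf.mono i i i j le_rfl le_rfl hij hj
  · rw [hf.symm, ← hf.self j]
    exact hf.mono j j j i le_rfl le_rfl hij hi

/-- `Q` covers the indices below `h` within `f`-distance `r`. -/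
def Covers (f : ℕ → ℕ → ℝ) (h : ℕ) (r : ℝ) (Q : Finset ℕ) : Prop :=
  (∀ q ∈ Q, q < h) ∧ ∀ p < h, ∃ q ∈ Q, f q p ≤ r

/-- The state of the greedy cover after the indices below `m`: there are `cnt` centers
`ctr 0 < ⋯ < ctr (cnt - 1) = c`, and the interval of the last one starts at `a`. The left ends of
the intervals form a set of indices no two of which have a common center. -/
structure GreedyInv (f : ℕ → ℕ → ℝ) (h : ℕ) (r : ℝ) (m cnt a c : ℕ) (ctr : ℕ → ℕ) : Prop where
  pos : 0 < m → 0 < cnt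
  last : 0 < cnt → ctr (cnt - 1) = c ∧ a ≤ c ∧ c < m
  strict : ∀ t t', t < t' → t' < cnt → ctr t < ctr t'
  cover_before : ∀ q < m, q < a → ∃ t, t + 1 < cnt ∧ f (ctr t) q ≤ r
  cover_after : ∀ q < m, a ≤ q → f c q ≤ r
  anchors : ∃ A : Finset ℕ, A.card = cnt ∧ (∀ a' ∈ A, a' ≤ a ∧ a' < m) ∧
    (∀ a' ∈ A, ∀ q < m, f q a' ≤ r → q ≤ c) ∧
    ∀ a₁ ∈ A, ∀ a₂ ∈ A, a₁ ≠ a₂ → ∀ q < h, f q a₁ ≤ r → ¬ f q a₂ ≤ r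

namespace GreedyInv

variable {f : ℕ → ℕ → ℝ} {h : ℕ} {r : ℝ} {m cnt a c : ℕ} {ctr : ℕ → ℕ}

theorem zero (f : ℕ → ℕ → ℝ) (h : ℕ) (r : ℝ) (a c : ℕ) (ctr : ℕ → ℕ) :
    GreedyInv f h r 0 0 a c ctr where
  pos := by simp
  last := by simp
  strict := by simp
  cover_before := by simp
  cover_after := by simp
  anchors := ⟨∅, by simp⟩

/-- As long as `m` is within `r` of the left end `a`, it can serve as center: everything in between
is at most as far from `m` as `a` is. -/
theorem move (H : GreedyInv f h r m cnt a c ctr) (hf : IntervalMono f h) (hm : m < h)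
    (hc : 0 < cnt) (ham : f a m ≤ r) :
    GreedyInv f h r (m + 1) cnt a m (Function.update ctr (cnt - 1) m) where
  pos _ := hc
  last _ := by
    have := H.last hc
    simp only [Function.update_self, true_and]
    omega
  strict t t' ht ht' := by
    have h₁ := H.last hc
    rw [Function.update_of_ne (by omega)]
    by_cases h' : t' = cnt - 1
    · subst h'
      rw [Function.update_self]
      have := H.strict t (cnt - 1) ht ht'
      omega
    · rw [Function.update_of_ne h']
      exact H.strict t t' ht ht'
  cover_before q hq hqa := by
    have h₁ := H.last hc
    obtain ⟨t, ht, h'⟩ := H.cover_before q (by omega) hqa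
    exact ⟨t, ht, by rwa [Function.update_of_ne (by omega)]⟩
  cover_after q hq haq := by
    rw [hf.symm]
    exact (hf.mono a q m m haq (by omega) le_rfl hm).trans ham
  anchors := by
    have h₁ := H.last hc
    obtain ⟨A, hA, h₂, h₃, h₄⟩ := H.anchors
    exact ⟨A, hA, fun a' ha' => ⟨(h₂ a' ha').1, by have := h₂ a' ha'; omega⟩,
      fun a' ha' q hq _ => by omega, h₄⟩

/-- The index `m` is too far from `a`, hence by monotonicity from all earlier anchors, so `c`
remains an upper bound for the centers of every anchor. -/
theorem stay (H : GreedyInv f h r m cnt a c ctr) (hf : IntervalMono f h) (hm : m < h)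
    (hc : 0 < cnt) (ham : ¬ f a m ≤ r) (hcm : f c m ≤ r) :
    GreedyInv f h r (m + 1) cnt a c ctr where
  pos _ := hc
  last _ := by have := H.last hc; omega
  strict := H.strict
  cover_before q hq hqa := H.cover_before q (by have := H.last hc; omega) hqa
  cover_after q hq haq := by
    rcases Nat.lt_or_ge q m with h' | h'
    · exact H.cover_after q h' haq
    · rwa [show q = m by omega]
  anchors := by
    have h₁ := H.last hc
    obtain ⟨A, hA, h₂, h₃, h₄⟩ := H.anchors
    refine ⟨A, hA, fun a' ha' => ⟨(h₂ a' ha').1, by have := h₂ a' ha'; omega⟩,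
      fun a' ha' q hq hqa => ?_, h₄⟩
    rcases Nat.lt_or_ge q m with h' | h'
    · exact h₃ a' ha' q h' hqa
    · obtain rfl : q = m := by omega
      rw [hf.symm] at hqa
      exact absurd ((hf.mono a' a q q (h₂ a' ha').1 (by omega) le_rfl hm).trans hqa) ham

/-- Suppose `q` served both an old anchor `a'` and `m`. If `q < m`, then `q ≤ c`, so `c` would be
within `r` of `m`. If `q ≥ m`, then `[c, m]` lies in `[a', q]`, with the same contradiction. So `m`
is a further anchor. -/
theorem new (H : GreedyInv f h r m cnt a c ctr) (hf : IntervalMono f h) (hm : m < h)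
    (hr : 0 ≤ r) (hcm : 0 < cnt → ¬ f c m ≤ r) :
    GreedyInv f h r (m + 1) (cnt + 1) m m (Function.update ctr cnt m) where
  pos _ := Nat.succ_pos _
  last _ := by simp
  strict t t' ht ht' := by
    have h₁ := H.last
    rw [Function.update_of_ne (by omega)]
    rcases Nat.lt_or_ge t' cnt with h' | h'
    · rw [Function.update_of_ne (by omega)]
      exact H.strict t t' ht h'
    · obtain rfl : t' = cnt := by omega
      rw [Function.update_self]
      have h₂ := h₁ (by omega)
      rcases Nat.lt_or_ge t (t' - 1) with h'' | h''
      · have := H.strict t (t' - 1) h'' (by omega)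
        omega
      · rw [show t = t' - 1 by omega]
        omega
  cover_before q hq hqm := by
    have hc := H.pos (by omega)
    have h₁ := H.last hc
    rcases Nat.lt_or_ge q a with h' | h'
    · obtain ⟨t, ht, h''⟩ := H.cover_before q hqm h'
      exact ⟨t, by omega, by rwa [Function.update_of_ne (by omega)]⟩
    · refine ⟨cnt - 1, by omega, ?_⟩
      rw [Function.update_of_ne (by omega), h₁.1]
      exact H.cover_after q hqm h'
  cover_after q hq hmq := by
    rwa [show q = m by omega, hf.self]
  anchors := by
    have h₁ := H.last
    obtain ⟨A, hA, h₂, h₃, h₄⟩ := H.anchors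
    have key : ∀ a' ∈ A, ∀ q < h, f q a' ≤ r → ¬ f q m ≤ r := by
      intro a' ha' q hq hqa hqm
      have hc : 0 < cnt := by rw [← hA]; exact Finset.card_pos.2 ⟨a', ha'⟩
      have h₅ := h₁ hc
      have h₆ := h₂ a' ha'
      rcases Nat.lt_or_ge q m with h' | h'
      · have := h₃ a' ha' q h' hqa
        exact hcm hc ((hf.mono q c m m this (by omega) le_rfl hm).trans hqm)
      · rw [hf.symm] at hqa
        exact hcm hc ((hf.mono a' c m q (by omega) (by omega) h' hq).trans hqa)
    refine ⟨insert m A, ?_, ?_, ?_, ?_⟩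
    · rw [Finset.card_insert_of_notMem, hA]
      exact fun hmA => (h₂ m hmA).2.false
    · intro a' ha'
      rcases Finset.mem_insert.1 ha' with rfl | ha'
      · omega
      · have := h₂ a' ha'
        omega
    · intro a' _ q hq _
      omega
    · intro a₁ ha₁ a₂ ha₂ hne q hq h₅ h₆
      rcases Finset.mem_insert.1 ha₁ with h₇ | h₇ <;> rcases Finset.mem_insert.1 ha₂ with h₈ | h₈
      · exact hne (h₇.trans h₈.symm)
      · exact key a₂ h₈ q hq h₆ (h₇ ▸ h₅)
      · exact key a₁ h₇ q hq h₅ (h₈ ▸ h₆)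
      · exact h₄ a₁ h₇ a₂ h₈ hne q hq h₅ h₆

theorem ctr_lt (H : GreedyInv f h r m cnt a c ctr) {t : ℕ} (ht : t < cnt) : ctr t < m := by
  have h₁ := H.last (by omega)
  rcases Nat.lt_or_ge t (cnt - 1) with h'' | h''
  · have := H.strict t (cnt - 1) h'' (by omega)
    omega
  · rw [show t = cnt - 1 by omega]
    omega

theorem exists_center (H : GreedyInv f h r h cnt a c ctr) {q : ℕ} (hq : q < h) :
    ∃ t < cnt, f (ctr t) q ≤ r := by
  have hc := H.pos (by omega)
  rcases Nat.lt_or_ge q a with h' | h'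
  · obtain ⟨t, ht, h''⟩ := H.cover_before q hq h'
    exact ⟨t, by omega, h''⟩
  · exact ⟨cnt - 1, by omega, by rw [(H.last hc).1]; exact H.cover_after q hq h'⟩

/-- Assigning to each anchor a center of `Q` that covers it is injective, since two anchors never
share a center. -/
theorem le_card (H : GreedyInv f h r h cnt a c ctr) {Q : Finset ℕ} (hQ : Covers f h r Q) :
    cnt ≤ Q.card := by
  obtain ⟨A, hA, h₂, h₃, h₄⟩ := H.anchors
  choose! g hg using hQ.2
  rw [← hA]
  refine Finset.card_le_card_of_injOn g (fun a' ha' => (hg a' (h₂ a' ha').2).1) ?_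
  intro a₁ ha₁ a₂ ha₂ heq
  by_contra hne
  refine h₄ a₁ ha₁ a₂ ha₂ hne (g a₁) (hQ.1 _ (hg a₁ (h₂ a₁ ha₁).2).1) (hg a₁ (h₂ a₁ ha₁).2).2 ?_
  rw [heq]
  exact (hg a₂ (h₂ a₂ ha₂).2).2

end GreedyInv

/-! ### The greedy decision procedure -/

namespace RealRAM

/-- The squared distance of the `i`-th and the `j`-th pair of the arrays `10`, `11`. -/
abbrev RExpr.dsq (i j : IExpr) : RExpr :=
  .add (.mul (.sub (.cell 10 i) (.cell 10 j)) (.sub (.cell 10 i) (.cell 10 j)))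
    (.mul (.sub (.cell 11 i) (.cell 11 j)) (.sub (.cell 11 i) (.cell 11 j)))

/-- The squared distance of the `i`-th and the `j`-th pair of the arrays `10`, `11`. -/
def State.dsq (s : State) (i j : ℕ) : ℝ :=
  (s.rarr 10 i - s.rarr 10 j) * (s.rarr 10 i - s.rarr 10 j) +
    (s.rarr 11 i - s.rarr 11 j) * (s.rarr 11 i - s.rarr 11 j)

/-- The greedy cover with squared radius in the real variable `6`. -/
def greedy : Cmd :=
  .setI 2 (.const 0) ;; .setI 24 (.const 0) ;;
  .loop (.ilt (.var 24) (.var 3))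
    (.cond (.conj (.ile (.const 1) (.var 2)) (.rle (.dsq (.var 22) (.var 24)) (.var 6)))
      (.setI 23 (.var 24) ;; .storeR 2 (.sub (.var 2) (.const 1)) (.cell 10 (.var 24)) ;;
        .storeR 3 (.sub (.var 2) (.const 1)) (.cell 11 (.var 24)))
      (.cond (.conj (.ile (.const 1) (.var 2)) (.rle (.dsq (.var 23) (.var 24)) (.var 6)))
        .skip
        (.setI 22 (.var 24) ;; .setI 23 (.var 24) ;; .storeR 2 (.var 2) (.cell 10 (.var 24)) ;;
          .storeR 3 (.var 2) (.cell 11 (.var 24)) ;; .setI 2 (.succ (.var 2)))) ;;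
    .setI 24 (.succ (.var 24)))

/-- The loop performs one of `GreedyInv.move`, `GreedyInv.stay` and `GreedyInv.new` per index; the
conclusion says that the computed cover is a smallest one. -/
theorem greedy_spec (s : State) {h : ℕ} (hh : s.ivar 3 = h) (hf : IntervalMono s.dsq h)
    (hr : 0 ≤ s.rvar 6) :
    Run greedy s fun s' t => t ≤ 200 * h + 10 ∧ ∃ ctr : ℕ → ℕ,
      (∀ t < s'.ivar 2, ctr t < h ∧ s'.pairs 2 3 t = s.pairs 10 11 (ctr t)) ∧
      (∀ t t', t < t' → t' < s'.ivar 2 → ctr t < ctr t') ∧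
      (∀ q < h, ∃ t < s'.ivar 2, s.dsq (ctr t) q ≤ s.rvar 6) ∧
      ∀ Q, Covers s.dsq h (s.rvar 6) Q → s'.ivar 2 ≤ Q.card := by
  simp only [greedy, run_seq, run_setI]
  refine (Run.loop (fun s' => ∃ m ≤ h, ∃ cnt a c ctr, s'.ivar 3 = h ∧ s'.ivar 24 = m ∧
    s'.ivar 2 = cnt ∧ s'.ivar 22 = a ∧ s'.ivar 23 = c ∧ s'.rvar 6 = s.rvar 6 ∧
    s'.rarr 10 = s.rarr 10 ∧ s'.rarr 11 = s.rarr 11 ∧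
    (∀ t < cnt, s'.pairs 2 3 t = s.pairs 10 11 (ctr t)) ∧
    GreedyInv s.dsq h (s.rvar 6) m cnt a c ctr)
    (fun s' => 200 * (h - s'.ivar 24))
    ?_ ?_).mono ?_
  -- The variables for `a` and `c` hold arbitrary values at first; without centers the invariant
  -- claims nothing about them, and the test `1 ≤ cnt` guards their use.
  · exact ⟨0, Nat.zero_le _, 0, s.ivar 22, s.ivar 23, id, by simp [hh], by simp [IExpr.eval],
      by simp [IExpr.eval], by simp, by simp, rfl, rfl, rfl, by simp,
      GreedyInv.zero _ _ _ _ _ _⟩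
  · rintro s' ⟨m, hm, cnt, a, c, ctr, h3, h24, h2, h22, h23, hr6, hX, hY, hout, hG⟩ hb
    simp only [BExpr.Holds, IExpr.eval, h3, h24, not_le] at hb
    simp only [run_seq, run_cond, run_storeR, run_skip, run_setI, BExpr.Holds, IExpr.eval,
      RExpr.eval, h3, h24, h2, h22, h23, hr6, hX, hY, IExpr.cost, RExpr.cost, BExpr.cost,
      State.storeR_ivar, State.storeR_rvar, State.setI_rvar, State.setI_ivar, State.setI_rarr,
      State.storeR_rarr, ↓reduceIte, Nat.reduceEqDiff]
    refine ⟨fun hc => ⟨⟨m + 1, hb, cnt, a, m, Function.update ctr (cnt - 1) m, ?_⟩, by omega⟩,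
      fun hc => ⟨fun hc' => ⟨⟨m + 1, hb, cnt, a, c, ctr, ?_⟩, by omega⟩,
        fun hc' => ⟨⟨m + 1, hb, cnt + 1, m, m, Function.update ctr cnt m, ?_⟩, by omega⟩⟩⟩
    · simp only [true_and]
      refine ⟨?_, hG.move hf hb hc.1 hc.2⟩
      intro t ht
      rw [State.pairs_update (s := s') (o := cnt - 1) (x := s.rarr 10 m) (y := s.rarr 11 m)
        (by simp) (by simp)]
      by_cases h' : t = cnt - 1
      · subst h'
        simp [State.pairs]
      · rw [Function.update_of_ne h', Function.update_of_ne h']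
        exact hout t ht
    · simp only [true_and]
      exact ⟨hout, hG.stay hf hb hc'.1 (fun h => hc ⟨hc'.1, h⟩) hc'.2⟩
    · simp only [true_and]
      refine ⟨?_, hG.new hf hb hr fun h h' => hc' ⟨h, h'⟩⟩
      intro t ht
      rw [State.pairs_update (s := s') (o := cnt) (x := s.rarr 10 m) (y := s.rarr 11 m)
        (by simp) (by simp)]
      by_cases h' : t = cnt
      · subst h'
        simp [State.pairs]
      · rw [Function.update_of_ne h', Function.update_of_ne h']
        exact hout t (by omega)
  · rintro s' t ⟨⟨m, hm, cnt, a, c, ctr, h3, h24, h2, h22, h23, hr6, hX, hY, hout, hG⟩, hb, ht⟩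
    simp only [BExpr.Holds, IExpr.eval, h3, h24, not_not] at hb
    simp only [BExpr.cost, IExpr.cost, IExpr.eval, State.setI_ivar, ↓reduceIte] at ht ⊢
    obtain rfl : m = h := by omega
    subst h2
    exact ⟨by omega, ctr, fun t ht => ⟨hG.ctr_lt ht, hout t ht⟩, hG.strict,
      fun q hq => hG.exists_center hq, fun Q hQ => hG.le_card hQ⟩

end RealRAM

namespace RealRAM

theorem State.setI_self (s : State) (x : ℕ) : s.setI x (s.ivar x) = s := by simp [State.setI]

theorem State.setR_self (s : State) (x : ℕ) : s.setR x (s.rvar x) = s := by simp [State.setR]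

-- Merges the two branches into one state with a conditional value, which avoids duplicating the
-- rest of the proof.
open Classical in
theorem run_condSetI {b : BExpr} {x : ℕ} {e : IExpr} {s : State} {Q : State → ℕ → Prop}
    (h : ∀ t ≤ b.cost + e.cost + 2,
      Q (s.setI x (if b.Holds s then e.eval s else s.ivar x)) t) :
    Run (.cond b (.setI x e) .skip) s Q := by
  simp only [run_cond, run_setI, run_skip]
  refine ⟨fun hb => ?_, fun hb => ?_⟩
  · have := h (b.cost + 1 + (e.cost + 1)) (by omega)
    rwa [if_pos hb] at this
  · have := h (b.cost + 1 + 1) (by omega)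
    rwa [if_neg hb, State.setI_self] at this

open Classical in
theorem run_condSetR {b : BExpr} {x : ℕ} {e : RExpr} {s : State} {Q : State → ℕ → Prop}
    (h : ∀ t ≤ b.cost + e.cost + 2,
      Q (s.setR x (if b.Holds s then e.eval s else s.rvar x)) t) :
    Run (.cond b (.setR x e) .skip) s Q := by
  simp only [run_cond, run_setR, run_skip]
  refine ⟨fun hb => ?_, fun hb => ?_⟩
  · have := h (b.cost + 1 + (e.cost + 1)) (by omega)
    rwa [if_pos hb] at this
  · have := h (b.cost + 1 + 1) (by omega)
    rwa [if_neg hb, State.setR_self] at this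

/-! ## The skyline -/

/-- The lexicographic order by the second entry, then by the first entry. -/
def LexLE (p q : ℝ × ℝ) : Prop := p.2 ≤ q.2 ∧ ¬ (q.2 ≤ p.2 ∧ ¬ p.1 ≤ q.1)

theorem LexLE.refl (p : ℝ × ℝ) : LexLE p p := ⟨le_rfl, fun h => h.2 le_rfl⟩

theorem LexLE.trans {p q r : ℝ × ℝ} (h : LexLE p q) (h' : LexLE q r) : LexLE p r := by
  refine ⟨h.1.trans h'.1, fun h₁ => h₁.2 ?_⟩
  have h₂ : p.1 ≤ q.1 := by
    by_contra hc
    exact h.2 ⟨h'.1.trans h₁.1, hc⟩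
  have h₃ : q.1 ≤ r.1 := by
    by_contra hc
    exact h'.2 ⟨h₁.1.trans h.1, hc⟩
  exact h₂.trans h₃

theorem LexLE.of_not {p q : ℝ × ℝ} (h : ¬ LexLE p q) : LexLE q p := by
  rcases lt_or_ge q.2 p.2 with h₁ | h₁
  · exact ⟨h₁.le, fun h₂ => absurd h₁ h₂.1.not_gt⟩
  · have h₂ : q.2 ≤ p.2 ∧ ¬ p.1 ≤ q.1 := by
      by_contra hc
      exact h ⟨h₁, hc⟩
    exact ⟨h₂.1, fun h₃ => h₃.2 (not_le.1 h₂.2).le⟩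

/-- `p` is the greatest of the terms `A l, …, A (u - 1)`. -/
def BestOn (A : ℕ → ℝ × ℝ) (l u : ℕ) (p : ℝ × ℝ) : Prop :=
  (∃ i, l ≤ i ∧ i < u ∧ A i = p) ∧ ∀ i, l ≤ i → i < u → LexLE (A i) p

open Classical in
theorem BestOn.step {A : ℕ → ℝ × ℝ} {l u : ℕ} {p : ℝ × ℝ} (hlu : l ≤ u)
    (h : l < u → BestOn A l u p) :
    BestOn A l (u + 1) (if u ≤ l ∨ ¬ LexLE (A u) p then A u else p) := by
  split_ifs with hc
  · refine ⟨⟨u, hlu, Nat.lt_succ_self u, rfl⟩, fun i hi hiu => ?_⟩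
    rcases Nat.lt_succ_iff_lt_or_eq.1 hiu with h' | rfl
    · exact ((h (by omega)).2 i hi h').trans (LexLE.of_not (hc.resolve_left (by omega)))
    · exact LexLE.refl _
  · simp only [not_or, not_not, not_le] at hc
    obtain ⟨⟨x, hx⟩, h₂⟩ := h hc.1
    refine ⟨⟨x, hx.1, by omega, hx.2.2⟩, fun i hi hiu => ?_⟩
    rcases Nat.lt_succ_iff_lt_or_eq.1 hiu with h' | rfl
    · exact h₂ i hi h'
    · exact hc.2

/-- The test whether the pair of `x` and `y` is greater than the pair of the variables `2`, `3`. -/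
abbrev BExpr.better (x y : RExpr) : BExpr :=
  .neg (.conj (.rle y (.var 3)) (.neg (.conj (.rle (.var 3) y) (.neg (.rle x (.var 2))))))

/-- If `b` holds, the variables `2`, `3` are set to `x` and `y`. -/
abbrev Cmd.update (b : BExpr) (x y : RExpr) : Cmd :=
  .cond b (.setR 2 x ;; .setR 3 y) .skip

-- The variable `2` is written before `y` is evaluated, hence the hypothesis `hxy`.
open Classical in
theorem run_update {b : BExpr} {x y : RExpr} {s : State} {Q : State → ℕ → Prop}
    (hxy : ∀ v, y.eval (s.setR 2 v) = y.eval s)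
    (h : ∀ t ≤ b.cost + x.cost + y.cost + 3, ∀ p : ℝ × ℝ,
      p = (if b.Holds s then (x.eval s, y.eval s) else (s.rvar 2, s.rvar 3)) →
      Q ((s.setR 2 p.1).setR 3 p.2) t) :
    Run (Cmd.update b x y) s Q := by
  simp only [run_cond, run_setR, run_skip, run_seq, hxy]
  refine ⟨fun hb => ?_, fun hb => ?_⟩
  · have := h (b.cost + 1 + (x.cost + 1 + (y.cost + 1))) (by omega) _ rfl
    rwa [if_pos hb] at this
  · have := h (b.cost + 1 + 1) (by omega) _ rfl
    rw [if_neg hb] at this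
    convert this using 1
    simp [State.setR]

/-- Computes the greatest terms of the initial parts of the blocks of length `w` (arrays `8`, `9`),
the ends of the blocks (array `0`) and a lower bound for all first entries (variable `1`). -/
def prefixBest : Cmd :=
  .setI 5 (.const 0) ;; .setI 8 (.const 0) ;; .setR 1 (.const 0) ;;
  .loop (.ilt (.var 8) (.var 0))
    (.cond (.ile (.add (.var 5) (.var 4)) (.var 8)) (.setI 5 (.var 8)) .skip ;;
      .update (.disj (.ile (.var 8) (.var 5)) (.better (.cell 0 (.var 8)) (.cell 1 (.var 8))))
        (.cell 0 (.var 8)) (.cell 1 (.var 8)) ;;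
      .cond (.rle (.cell 0 (.var 8)) (.var 1)) (.setR 1 (.sub (.cell 0 (.var 8)) (.const 1)))
        .skip ;;
      .storeR 8 (.var 8) (.var 2) ;; .storeR 9 (.var 8) (.var 3) ;;
      .storeI 0 (.var 5) (.succ (.var 8)) ;; .setI 8 (.succ (.var 8)))

theorem eq_of_dvd_of_between {w b c i : ℕ} (hb : w ∣ b) (hc : w ∣ c) (h₁ : b ≤ i) (h₂ : i < b + w)
    (h₃ : c ≤ i) (h₄ : i < c + w) : b = c := by
  obtain ⟨x, rfl⟩ := hb
  obtain ⟨y, rfl⟩ := hc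
  have h5 : w * x < w * (y + 1) := by rw [mul_add_one]; omega
  have h6 : w * y < w * (x + 1) := by rw [mul_add_one]; omega
  have h7 := Nat.lt_of_mul_lt_mul_left h5
  have h8 := Nat.lt_of_mul_lt_mul_left h6
  rw [show x = y by omega]

theorem add_le_of_dvd_of_lt {w b c : ℕ} (hb : w ∣ b) (hc : w ∣ c) (h : b < c) : b + w ≤ c := by
  obtain ⟨x, rfl⟩ := hb
  obtain ⟨y, rfl⟩ := hc
  have h7 := Nat.lt_of_mul_lt_mul_left h
  rw [← mul_add_one]
  exact Nat.mul_le_mul_left _ h7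

/-- The greatest terms of the initial parts of the blocks of length `w`. -/
def PrefixBest (A B : ℕ → ℝ × ℝ) (n w : ℕ) : Prop :=
  ∀ b, w ∣ b → ∀ i < n, b ≤ i → i < b + w → BestOn A b (i + 1) (B i)

/-- A single sweep that restarts its running maximum at every block. The recorded block ends are the
initial pointers, and the final variable `1` is an abscissa to the left of all points. -/
theorem prefixBest_spec (s : State) {n w : ℕ} (hn : s.ivar 0 = n) (hw : s.ivar 4 = w)
    (hw0 : 0 < w) :
    Run prefixBest s fun s' t => t ≤ 100 * n + 20 ∧
      PrefixBest (s.pairs 0 1) (s'.pairs 8 9) n w ∧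
      (∀ b, w ∣ b → b < n → s'.iarr 0 b = min (b + w) n) ∧
      ∀ i < n, s'.rvar 1 < (s.pairs 0 1 i).1 := by
  simp only [prefixBest, run_seq, run_setI, run_setR]
  refine (Run.loop (fun s' => ∃ i b, i ≤ n ∧ s'.ivar 0 = n ∧ s'.ivar 4 = w ∧ s'.ivar 5 = b ∧
    s'.ivar 8 = i ∧ s'.rarr 0 = s.rarr 0 ∧ s'.rarr 1 = s.rarr 1 ∧ w ∣ b ∧ b ≤ i ∧ i ≤ b + w ∧
    (b < i → BestOn (s.pairs 0 1) b i (s'.rvar 2, s'.rvar 3)) ∧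
    (∀ c, w ∣ c → c < i → s'.iarr 0 c = min (c + w) i) ∧
    PrefixBest (s.pairs 0 1) (s'.pairs 8 9) i w ∧
    ∀ x < i, s'.rvar 1 < (s.pairs 0 1 x).1)
    (fun s' => 100 * (n - s'.ivar 8)) ?_ ?_).mono ?_
  · exact ⟨0, 0, Nat.zero_le _, by simp [hn], by simp [hw], by simp [IExpr.eval],
      by simp [IExpr.eval], rfl, rfl, dvd_zero _, le_rfl, Nat.zero_le _, by simp, by simp,
      by simp [PrefixBest], by simp⟩
  · rintro s₁ ⟨i, b, hi, h0, h4, h5, h8, hX, hY, hwb, hbi, hib, hbest, hptr, hpre, hcx⟩ hlt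
    simp only [BExpr.Holds, IExpr.eval, h0, h8, not_le] at hlt
    have hAi : (s₁.rarr 0 i, s₁.rarr 1 i) = s.pairs 0 1 i := by rw [hX, hY]; rfl
    simp only [run_seq]
    refine run_condSetI fun t₁ ht₁ => ?_
    simp only [BExpr.Holds, IExpr.eval, h4, h5, h8]
    obtain ⟨b', hb', hwb', hbi', hib', hbest'⟩ : ∃ b', (if b + w ≤ i then i else b) = b' ∧ w ∣ b' ∧
        b' ≤ i ∧ i < b' + w ∧ (b' < i → BestOn (s.pairs 0 1) b' i (s₁.rvar 2, s₁.rvar 3)) := by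
      split_ifs with hc
      · refine ⟨i, rfl, ?_, le_rfl, by omega, by simp⟩
        rw [show i = b + w by omega]
        exact (Nat.dvd_add_left (dvd_refl _)).2 hwb
      · exact ⟨b, rfl, hwb, hbi, by omega, hbest⟩
    have hif : ∀ inst : Decidable (b + w ≤ i), @ite _ (b + w ≤ i) inst i b = b' := by
      intro inst
      rw [← hb']
      congr
    rw [hif]
    refine run_update (fun v => rfl) fun t₂ ht₂ p hp => ?_
    simp only [BExpr.Holds, IExpr.eval, RExpr.eval, State.setI_ivar, State.setI_rvar,
      State.setI_rarr, ↓reduceIte, Nat.reduceEqDiff, h8] at hp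
    -- `LexLE` is built from the same connectives as `BExpr.better`, so the evaluated test unfolds
    -- to its negation.
    replace hp : p = open Classical in if i ≤ b' ∨ ¬ LexLE (s.pairs 0 1 i) (s₁.rvar 2, s₁.rvar 3)
        then s.pairs 0 1 i else (s₁.rvar 2, s₁.rvar 3) := by
      rw [hp, ← hAi]
      simp only [LexLE, not_and_or, not_not]
    have hpb := hp ▸ BestOn.step hbi' hbest'
    refine run_condSetR fun t₃ ht₃ => ?_
    -- Lowering the bound to `x - 1` whenever it is not below the new `x` keeps it strictly below
    -- all abscissas seen.
    obtain ⟨cx, hcx', hcx₁⟩ : ∃ cx, (open Classical in if s.rarr 0 i ≤ s₁.rvar 1 then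
        s.rarr 0 i - 1 else s₁.rvar 1) = cx ∧ ∀ x < i + 1, cx < (s.pairs 0 1 x).1 := by
      refine ⟨_, rfl, fun x hx => ?_⟩
      have hA : (s.pairs 0 1 i).1 = s.rarr 0 i := rfl
      rcases Nat.lt_succ_iff_lt_or_eq.1 hx with h | rfl
      · have := hcx x h
        split_ifs <;> linarith
      · split_ifs <;> linarith
    simp only [BExpr.Holds, IExpr.eval, RExpr.eval, State.setI_ivar, State.setR_ivar,
      State.setI_rvar, State.setR_rvar, State.setI_rarr, State.setR_rarr, ↓reduceIte,
      Nat.reduceEqDiff, h8, hX, Int.cast_one, hcx', run_storeR, run_storeI, run_setI,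
      State.storeR_ivar, State.storeR_rvar, State.storeI_ivar, State.storeI_rvar]
    simp only [BExpr.cost, IExpr.cost, RExpr.cost] at ht₁ ht₂ ht₃
    refine ⟨⟨i + 1, b', hlt, ?_⟩, ?_⟩
    · simp only [h0, h4, true_and]
      refine ⟨hX, hY, hwb', by omega, by omega, fun _ => hpb, ?_, ?_, hcx₁⟩
      · intro c hc hci
        by_cases h : c = b'
        · subst h
          simp
          omega
        · have h₂ : c < b' := by
            by_contra hcon
            exact h (eq_of_dvd_of_between (i := c) hc hwb' le_rfl (by omega) (by omega) (by omega))
          have h₁ := add_le_of_dvd_of_lt hc hwb' h₂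
          simp only [State.setI_iarr, State.setR_iarr, State.storeR_iarr, State.storeI_iarr,
            ↓reduceIte, Function.update_of_ne h]
          rw [hptr c hc (by omega)]
          omega
      · intro c hc x hx hcl hxc
        rw [State.pairs_update (s := s₁) (a := 8) (b := 9) (o := i) (x := p.1) (y := p.2) (by simp) (by simp)]
        rcases Nat.lt_succ_iff_lt_or_eq.1 hx with h | rfl
        · rw [Function.update_of_ne (by omega)]
          exact hpre c hc x h hcl hxc
        · rw [Function.update_self, eq_of_dvd_of_between hc hwb' hcl hxc hbi' hib']
          exact hpb
    · simp only [IExpr.cost, RExpr.cost, BExpr.cost]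
      omega
  · rintro s' t ⟨⟨i, b, hi, h0, h4, h5, h8, hX, hY, hwb, hbi, hib, hbest, hptr, hpre, hcx⟩, hb, ht⟩
    simp only [BExpr.Holds, IExpr.eval, h0, h8, not_not] at hb
    simp only [BExpr.cost, IExpr.cost, RExpr.cost, IExpr.eval, State.setI_ivar, State.setR_ivar,
      ↓reduceIte] at ht ⊢
    obtain rfl : i = n := by omega
    exact ⟨by omega, hpre, hptr, hcx⟩

end RealRAM

/-- The number of multiples of `w` below `n`, that is, `n / w` rounded up. -/
def cdiv (n w : ℕ) : ℕ := (n + w - 1) / w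

theorem lt_cdiv {n w x : ℕ} (hw : 0 < w) : x < cdiv n w ↔ x * w < n := by
  rw [cdiv, Nat.lt_iff_add_one_le, Nat.le_div_iff_mul_le hw, add_one_mul]
  omega

theorem cdiv_mul_le {n w : ℕ} (hw : 0 < w) : cdiv n w * w ≤ n + w := by
  rcases Nat.eq_zero_or_pos (cdiv n w) with h | h
  · rw [h]; omega
  · have := (lt_cdiv (n := n) (x := cdiv n w - 1) hw).1 (by omega)
    calc cdiv n w * w = (cdiv n w - 1) * w + w := by
          rw [← add_one_mul]; congr 1; omega
      _ ≤ n + w := by omega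

/-! ### Scanning the blocks with retreating pointers -/

namespace RealRAM

/-- Moves the pointer `12` down, to the end of the part of the block with first entries above the
variable `1`. -/
def retreat : Cmd :=
  .loop (.conj (.ilt (.var 5) (.var 12)) (.rle (.cell 0 (.sub (.var 12) (.const 1))) (.var 1)))
    (.setI 12 (.sub (.var 12) (.const 1)))

/-- The time is stated in amortized form: each unit by which the pointer falls pays 20. -/
theorem retreat_spec (s : State) {b p₀ : ℕ} (hb : s.ivar 5 = b) (hp : s.ivar 12 = p₀)
    (hbp : b ≤ p₀) :
    Run retreat s fun s' t => ∃ p, s'.ivar 12 = p ∧ b ≤ p ∧ p ≤ p₀ ∧ t + 20 * p ≤ 20 * p₀ + 20 ∧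
      (∀ i, p ≤ i → i < p₀ → s.rarr 0 i ≤ s.rvar 1) ∧ (b < p → s.rvar 1 < s.rarr 0 (p - 1)) := by
  refine (Run.loop (fun s' => ∃ p, s'.ivar 5 = b ∧ s'.ivar 12 = p ∧ s'.rarr 0 = s.rarr 0 ∧
    s'.rvar 1 = s.rvar 1 ∧ b ≤ p ∧ p ≤ p₀ ∧ ∀ i, p ≤ i → i < p₀ → s.rarr 0 i ≤ s.rvar 1)
    (fun s' => 20 * s'.ivar 12) ?_ ?_).mono ?_
  · exact ⟨p₀, hb, hp, rfl, rfl, hbp, le_rfl, fun i h₁ h₂ => by omega⟩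
  · rintro s₁ ⟨p, h5, h12, hX, hcx, hbp, hpp, hi⟩ hc
    simp only [BExpr.Holds, IExpr.eval, RExpr.eval, h5, h12, hX, hcx, not_le] at hc
    simp only [run_setI, IExpr.eval, h12, IExpr.cost, RExpr.cost, BExpr.cost, State.setI_ivar,
      ↓reduceIte]
    refine ⟨⟨p - 1, by simp [h5], rfl, hX, hcx, by omega, by omega, fun i h₁ h₂ => ?_⟩, by omega⟩
    rcases Nat.lt_or_ge i p with h | h
    · rw [show i = p - 1 by omega]
      exact hc.2
    · exact hi i h h₂
  · rintro s₁ t ⟨⟨p, h5, h12, hX, hcx, hbp, hpp, hi⟩, hc, ht⟩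
    simp only [BExpr.Holds, IExpr.eval, RExpr.eval, h5, h12, hX, hcx, not_le] at hc
    simp only [IExpr.cost, RExpr.cost, BExpr.cost, hp, h12] at ht
    exact ⟨p, h12, hbp, hpp, by omega, hi, fun h => not_le.1 fun h' => hc ⟨h, h'⟩⟩

/-- `p` is the greatest of those terms `A 0, …, A (m - 1)` whose first entry exceeds `cx`. -/
def BestAbove (A : ℕ → ℝ × ℝ) (cx : ℝ) (m : ℕ) (p : ℝ × ℝ) : Prop :=
  (∃ i < m, A i = p) ∧ cx < p.1 ∧ ∀ i < m, cx < (A i).1 → LexLE (A i) p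

/-- The result of the search among the first `m` terms: `found` tells whether there are terms with
first entry above `cx`, and `p` is then the greatest of them. -/
def Found (A : ℕ → ℝ × ℝ) (cx : ℝ) (m found : ℕ) (p : ℝ × ℝ) : Prop :=
  (found = 0 ∧ ∀ i < m, (A i).1 ≤ cx) ∨ (found = 1 ∧ BestAbove A cx m p)

/-- The pointers are in the blocks, and the terms of the blocks behind them are at most `cx`. -/
def PtrInv (A : ℕ → ℝ × ℝ) (n w : ℕ) (cx : ℝ) (ptr : ℕ → ℕ) : Prop :=
  ∀ b, w ∣ b → b < n → b ≤ ptr b ∧ ptr b ≤ min (b + w) n ∧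
    ∀ i, ptr b ≤ i → i < min (b + w) n → (A i).1 ≤ cx

theorem Found.extend_of_le {A : ℕ → ℝ × ℝ} {cx : ℝ} {m m' found : ℕ} {p : ℝ × ℝ}
    (h : Found A cx m found p) (hm : m ≤ m') (hA : ∀ i, m ≤ i → i < m' → (A i).1 ≤ cx) :
    Found A cx m' found p := by
  rcases h with ⟨h₁, h₂⟩ | ⟨h₁, ⟨x, hx, hx'⟩, h₃, h₄⟩
  · refine Or.inl ⟨h₁, fun i hi => ?_⟩
    rcases Nat.lt_or_ge i m with h | h
    exacts [h₂ i h, hA i h hi]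
  · refine Or.inr ⟨h₁, ⟨x, by omega, hx'⟩, h₃, fun i hi hi' => ?_⟩
    rcases Nat.lt_or_ge i m with h | h
    exacts [h₄ i h hi', absurd (hA i h hi) hi'.not_ge]

open Classical in
theorem Found.extend_of_best {A : ℕ → ℝ × ℝ} {cx : ℝ} {m u m' found : ℕ} {p q : ℝ × ℝ}
    (h : Found A cx m found p) (hu : u ≤ m') (hq : BestOn A m u q)
    (hA : ∀ i, m ≤ i → i < u → cx < (A i).1) (hA' : ∀ i, u ≤ i → i < m' → (A i).1 ≤ cx) :
    Found A cx m' 1 (if found ≤ 0 ∨ ¬ LexLE q p then q else p) := by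
  obtain ⟨⟨x, hmx, hxu, hx⟩, hq₂⟩ := hq
  have hqx : cx < q.1 := hx ▸ hA x hmx hxu
  refine Or.inr ⟨rfl, ?_⟩
  split_ifs with hc
  · refine ⟨⟨x, by omega, hx⟩, hqx, fun i hi hi' => ?_⟩
    rcases Nat.lt_or_ge i m with h₁ | h₁
    · rcases h with ⟨h₂, h₃⟩ | ⟨h₂, h₃, h₄, h₅⟩
      · exact absurd (h₃ i h₁) hi'.not_ge
      · exact (h₅ i h₁ hi').trans (LexLE.of_not (hc.resolve_left (by omega)))
    · rcases Nat.lt_or_ge i u with h₂ | h₂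
      · exact hq₂ i h₁ h₂
      · exact absurd (hA' i h₂ hi) hi'.not_ge
  · simp only [not_or, not_not, not_le] at hc
    obtain ⟨h₂, ⟨y, hy, hy'⟩, h₄, h₅⟩ := h.resolve_left (by omega)
    refine ⟨⟨y, by omega, hy'⟩, h₄, fun i hi hi' => ?_⟩
    rcases Nat.lt_or_ge i m with h₁ | h₁
    · exact h₅ i h₁ hi'
    · rcases Nat.lt_or_ge i u with h₂ | h₂
      · exact (hq₂ i h₁ h₂).trans hc.2
      · exact absurd (hA' i h₂ hi) hi'.not_ge

/-- The number of pointer moves that are left. -/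
def ptrPotential (n w : ℕ) (ptr : ℕ → ℕ) : ℕ :=
  ∑ g ∈ Finset.range (cdiv n w), (ptr (g * w) - g * w)

/-- Only the summand of block `g` changes. The additive form avoids truncated subtraction and fits
the amortized bound of `retreat_spec`. -/
theorem ptrPotential_update {n w g p : ℕ} {ptr : ℕ → ℕ} (hw : 0 < w) (hg : g * w < n)
    (hp : g * w ≤ p) (hp' : p ≤ ptr (g * w)) :
    ptrPotential n w (Function.update ptr (g * w) p) + ptr (g * w) = ptrPotential n w ptr + p := by
  have hmem : g ∈ Finset.range (cdiv n w) := Finset.mem_range.2 ((lt_cdiv hw).2 hg)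
  rw [ptrPotential, ptrPotential, ← Finset.add_sum_erase _ _ hmem, ← Finset.add_sum_erase _ _ hmem,
    Function.update_self]
  have : ∑ x ∈ (Finset.range (cdiv n w)).erase g,
      (Function.update ptr (g * w) p (x * w) - x * w) =
      ∑ x ∈ (Finset.range (cdiv n w)).erase g, (ptr (x * w) - x * w) := by
    refine Finset.sum_congr rfl fun x hx => ?_
    rw [Function.update_of_ne]
    intro h
    exact (Finset.ne_of_mem_erase hx) (Nat.eq_of_mul_eq_mul_right hw h)
  rw [this]
  omega

/-- Finds the greatest pair among those with first entry above the variable `1`. -/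
def scan : Cmd :=
  .setI 13 (.const 0) ;; .setI 5 (.const 0) ;;
  .loop (.ilt (.var 5) (.var 0))
    (.setI 12 (.cell 0 (.var 5)) ;; retreat ;; .storeI 0 (.var 5) (.var 12) ;;
      .cond (.ilt (.var 5) (.var 12))
        (.update (.disj (.ile (.var 13) (.const 0))
            (.better (.cell 8 (.sub (.var 12) (.const 1))) (.cell 9 (.sub (.var 12) (.const 1)))))
          (.cell 8 (.sub (.var 12) (.const 1))) (.cell 9 (.sub (.var 12) (.const 1))) ;;
          .setI 13 (.const 1))
        .skip ;;
      .setI 5 (.add (.var 5) (.var 4)))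

/-- Each block costs a constant plus its pointer moves, which the potential pays for. The relevant
part of a block ends at the pointer, and its best point is read from the table in one access. -/
theorem scan_spec (s : State) {n w : ℕ} (hn : s.ivar 0 = n) (hw : s.ivar 4 = w) (hw0 : 0 < w)
    (hs : BlockSorted (s.pairs 0 1) n w) (hB : PrefixBest (s.pairs 0 1) (s.pairs 8 9) n w)
    (hptr : PtrInv (s.pairs 0 1) n w (s.rvar 1) (s.iarr 0)) :
    Run scan s fun s' t =>
      t + 20 * ptrPotential n w (s'.iarr 0) ≤
        20 * ptrPotential n w (s.iarr 0) + 120 * cdiv n w + 20 ∧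
      PtrInv (s.pairs 0 1) n w (s.rvar 1) (s'.iarr 0) ∧
      Found (s.pairs 0 1) (s.rvar 1) n (s'.ivar 13) (s'.rvar 2, s'.rvar 3) := by
  simp only [scan, run_seq, run_setI]
  refine (Run.loop (fun s' => ∃ g ≤ cdiv n w, s'.ivar 0 = n ∧ s'.ivar 4 = w ∧ s'.ivar 5 = g * w ∧
    s'.rarr 0 = s.rarr 0 ∧ s'.rarr 8 = s.rarr 8 ∧ s'.rarr 9 = s.rarr 9 ∧ s'.rvar 1 = s.rvar 1 ∧
    PtrInv (s.pairs 0 1) n w (s.rvar 1) (s'.iarr 0) ∧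
    Found (s.pairs 0 1) (s.rvar 1) (min (g * w) n) (s'.ivar 13) (s'.rvar 2, s'.rvar 3))
    (fun s' => 20 * ptrPotential n w (s'.iarr 0) + 120 * (cdiv n w - s'.ivar 5 / w)) ?_ ?_).mono ?_
  · exact ⟨0, Nat.zero_le _, by simp [hn], by simp [hw], by simp [IExpr.eval], rfl, rfl, rfl, rfl,
      hptr, Or.inl ⟨by simp [IExpr.eval], by simp⟩⟩
  · rintro s₁ ⟨g, hg, h0, h4, h5, hX, hBX, hBY, hcx, hp, hf⟩ hlt
    simp only [BExpr.Holds, IExpr.eval, h0, h5, not_le] at hlt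
    have hgw : w ∣ g * w := Dvd.intro_left g rfl
    obtain ⟨hp₁, hp₂, hp₃⟩ := hp (g * w) hgw hlt
    have hg' := (lt_cdiv hw0).2 hlt
    simp only [run_seq, run_setI]
    refine (retreat_spec _ (b := g * w) (p₀ := s₁.iarr 0 (g * w)) (by simp [h5])
      (by simp [IExpr.eval, h5]) hp₁).frame.mono ?_
    rintro s₂ t ⟨⟨p, h12, hbp, hpp, ht, hle, hgt⟩, hF⟩
    simp only [State.setI_rarr, State.setI_rvar, hX, hcx] at hle hgt
    have f0 : s₂.ivar 0 = n := by rw [hF.ivar 0 (by decide)]; simp [h0]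
    have f4 : s₂.ivar 4 = w := by rw [hF.ivar 4 (by decide)]; simp [h4]
    have f5 : s₂.ivar 5 = g * w := by rw [hF.ivar 5 (by decide)]; simp [h5]
    have f13 : s₂.ivar 13 = s₁.ivar 13 := by rw [hF.ivar 13 (by decide)]; simp
    have g0 : s₂.rarr 0 = s.rarr 0 := by rw [hF.rarr 0 (by decide)]; simp [hX]
    have g8 : s₂.rarr 8 = s.rarr 8 := by rw [hF.rarr 8 (by decide)]; simp [hBX]
    have g9 : s₂.rarr 9 = s.rarr 9 := by rw [hF.rarr 9 (by decide)]; simp [hBY]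
    have gi : s₂.iarr 0 = s₁.iarr 0 := by rw [hF.iarr 0 (by decide)]; simp
    have r1 : s₂.rvar 1 = s.rvar 1 := by rw [hF.rvar 1 (by decide)]; simp [hcx]
    have r2 : s₂.rvar 2 = s₁.rvar 2 := by rw [hF.rvar 2 (by decide)]; simp
    have r3 : s₂.rvar 3 = s₁.rvar 3 := by rw [hF.rvar 3 (by decide)]; simp
    have hpot := ptrPotential_update (n := n) hw0 hlt hbp hpp
    have hinv : PtrInv (s.pairs 0 1) n w (s.rvar 1)
        (Function.update (s₁.iarr 0) (g * w) p) := by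
      intro b hb hbn
      by_cases h : b = g * w
      · subst h
        rw [Function.update_self]
        refine ⟨hbp, hpp.trans hp₂, fun i hi hi' => ?_⟩
        rcases Nat.lt_or_ge i (s₁.iarr 0 (g * w)) with h' | h'
        · exact hle i hi h'
        · exact hp₃ i h' hi'
      · rw [Function.update_of_ne h]
        exact hp b hb hbn
    obtain ⟨-, -, hinv₃⟩ := hinv (g * w) hgw hlt
    rw [Function.update_self] at hinv₃
    rw [min_eq_left hlt.le] at hf
    have hdiv : g * w / w = g := Nat.mul_div_cancel _ hw0
    have hdiv' : (g * w + w) / w = g + 1 := by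
      rw [← add_one_mul]; exact Nat.mul_div_cancel _ hw0
    simp only [run_storeI, IExpr.eval, f5, h12]
    refine run_cond.2 ⟨fun hc => run_seq.2 ?_, fun hc => ?_⟩ <;>
      simp only [BExpr.Holds, IExpr.eval, State.storeI_ivar, f5, h12, not_le, not_lt] at hc
    · refine run_update (fun v => rfl) fun t₂ ht₂ q hq => ?_
      simp only [BExpr.cost, IExpr.cost, RExpr.cost] at ht₂
      simp only [run_setI, IExpr.eval, State.setI_ivar, State.setR_ivar, State.storeI_ivar,
        State.setI_iarr, State.setR_iarr, State.storeI_iarr, State.setI_rvar, State.setR_rvar,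
        State.setI_rarr, State.setR_rarr, State.storeI_rarr, State.storeI_rvar,
        ↓reduceIte, Nat.reduceEqDiff, f0, f4, f5, g0, g8, g9, gi, r1, h5, hdiv, hdiv']
      refine ⟨⟨g + 1, hg', by trivial, by trivial, by ring, by trivial, by trivial, by trivial,
        by trivial, hinv, ?_⟩, ?_⟩
      · replace hq : q = open Classical in if s₁.ivar 13 ≤ 0 ∨
            ¬ LexLE (s.pairs 8 9 (p - 1)) (s₁.rvar 2, s₁.rvar 3)
            then s.pairs 8 9 (p - 1) else (s₁.rvar 2, s₁.rvar 3) := by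
          rw [hq]
          simp only [BExpr.Holds, IExpr.eval, RExpr.eval, State.storeI_ivar, State.storeI_rarr,
            State.storeI_rvar, h12, f13, g8, g9, r2, r3, LexLE, State.pairs, not_and_or, not_not]
        rw [Prod.mk.eta, hq, add_one_mul]
        refine hf.extend_of_best (u := p) (by omega) ?_ ?_ hinv₃
        -- The part before the pointer `p` is summarized by the table entry at `p - 1`.
        · have := hB (g * w) hgw (p - 1) (by omega) (by omega) (by omega)
          rwa [Nat.sub_add_cancel (by omega)] at this
        -- The entry at `p - 1` exceeds `cx`, and so do all earlier ones, since the block is sorted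
        -- decreasingly.
        · intro i hi hip
          have h₁ := hgt hc
          rcases Nat.lt_or_ge i (p - 1) with h' | h'
          · exact h₁.trans_le (pairwise_seg.1 (hs (g * w) hgw) i (p - 1) hi h' (by omega))
          · rw [show i = p - 1 by omega]
            exact h₁
      · simp only [IExpr.cost, BExpr.cost]
        omega
    · simp only [run_skip, State.setI_ivar, State.storeI_ivar,
        State.setI_iarr, State.storeI_iarr, State.setI_rvar,
        State.setI_rarr, State.storeI_rarr, State.storeI_rvar,
        ↓reduceIte, Nat.reduceEqDiff, f0, f4, f5, f13, g0, g8, g9, gi, r1, r2, r3, h5, hdiv, hdiv']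
      refine ⟨⟨g + 1, hg', by trivial, by trivial, by ring, by trivial, by trivial, by trivial,
        by trivial, hinv, ?_⟩, ?_⟩
      · rw [add_one_mul]
        exact hf.extend_of_le (by omega) fun i hi hi' => hinv₃ i (by omega) hi'
      · simp only [IExpr.cost, BExpr.cost]
        omega
  · rintro s' t ⟨⟨g, hg, h0, h4, h5, hX, hBX, hBY, hcx, hp, hf⟩, hb, ht⟩
    simp only [BExpr.Holds, IExpr.eval, h0, h5, not_not] at hb
    simp only [BExpr.cost, IExpr.cost, IExpr.eval, State.setI_ivar, State.setI_iarr, ↓reduceIte,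
      Nat.zero_div] at ht ⊢
    rw [min_eq_right hb] at hf
    exact ⟨by omega, hp, hf⟩

end RealRAM

/-- The point with the coordinates `p`. -/
noncomputable def pt (p : ℝ × ℝ) : Point := !₂[p.1, p.2]

@[simp] theorem pt_zero (p : ℝ × ℝ) : pt p 0 = p.1 := rfl

@[simp] theorem pt_one (p : ℝ × ℝ) : pt p 1 = p.2 := rfl

theorem pt_injective : Function.Injective pt := fun p q h =>
  Prod.ext (by rw [← pt_zero, h, pt_zero]) (by rw [← pt_one, h, pt_one])

theorem pt_coords (p : Point) : pt (p 0, p 1) = p := by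
  ext i
  fin_cases i <;> rfl

theorem mem_sky {P : Finset Point} {p : Point} :
    p ∈ sky P ↔ p ∈ P ∧ ∀ q ∈ P, q ≠ p → q 0 < p 0 ∨ q 1 < p 1 := by
  simp [sky]

/-- The first `cnt` terms of `S` are the points of the skyline with first coordinate at most `cx`,
from left to right. -/
structure SkyInv (P : Finset Point) (cx : ℝ) (cnt : ℕ) (S : ℕ → ℝ × ℝ) : Prop where
  mem : ∀ t < cnt, pt (S t) ∈ sky P ∧ (S t).1 ≤ cx
  strict : ∀ t t', t < t' → t' < cnt → (S t).1 < (S t').1 ∧ (S t').2 < (S t).2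
  complete : ∀ p ∈ sky P, p 0 ≤ cx → ∃ t < cnt, pt (S t) = p

/-- The first `h` terms of `S` are the points of the skyline from left to right. -/
structure IsSkySeq (P : Finset Point) (h : ℕ) (S : ℕ → ℝ × ℝ) : Prop where
  card : h = (sky P).card
  mem : ∀ t < h, pt (S t) ∈ sky P
  strict : ∀ t t', t < t' → t' < h → (S t).1 < (S t').1 ∧ (S t').2 < (S t).2
  complete : ∀ p ∈ sky P, ∃ t < h, pt (S t) = p

/-! ### The skyline built from left to right -/

namespace SkyInv

variable {P : Finset Point} {cx : ℝ} {cnt n : ℕ} {S A : ℕ → ℝ × ℝ}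

theorem injOn (H : SkyInv P cx cnt S) :
    Set.InjOn (fun t => pt (S t)) (Finset.range cnt : Finset ℕ) := by
  intro t ht t' ht' heq
  simp only [Finset.coe_range, Set.mem_Iio] at ht ht'
  have heq' : S t = S t' := pt_injective heq
  rcases lt_trichotomy t t' with h | h | h
  · have := (H.strict t t' h ht').1
    rw [heq'] at this
    exact absurd this (lt_irrefl _)
  · exact h
  · have := (H.strict t' t h ht).1
    rw [heq'] at this
    exact absurd this (lt_irrefl _)

theorem le_card (H : SkyInv P cx cnt S) : cnt ≤ (sky P).card := by
  have := Finset.card_le_card_of_injOn (fun t => pt (S t))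
    (fun t ht => (H.mem t (Finset.mem_range.1 ht)).1) H.injOn
  simpa using this

/-- Points at or left of `cx` are left of `p`, and no point right of `cx` is higher, so ties aside
nothing dominates `p`; the tie-break towards larger x settles equal heights. A skyline point with
abscissa in `(cx, p.1]` must be `p`, because otherwise `p` dominates it. -/
theorem step (H : SkyInv P cx cnt S) (hA : ∀ p, p ∈ P ↔ ∃ i < n, pt (A i) = p) {p : ℝ × ℝ}
    (hp : RealRAM.BestAbove A cx n p) : SkyInv P p.1 (cnt + 1) (Function.update S cnt p) := by
  classical
  obtain ⟨⟨x, hx, hxp⟩, hcx, hbest⟩ := hp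
  have hpP : pt p ∈ P := (hA _).2 ⟨x, hx, by rw [hxp]⟩
  have hle : ∀ q ∈ P, cx < q 0 → RealRAM.LexLE (q 0, q 1) p := by
    intro q hq hcq
    obtain ⟨i, hi, rfl⟩ := (hA q).1 hq
    exact hbest i hi hcq
  have hpsky : pt p ∈ sky P := by
    refine mem_sky.2 ⟨hpP, fun q hq hne => ?_⟩
    simp only [pt_zero, pt_one]
    rcases lt_or_ge cx (q 0) with h | h
    · by_contra! hc
      have h₁ := hle q hq h
      have h₂ : q 1 = p.2 := le_antisymm h₁.1 hc.2
      have h₃ : q 0 ≤ p.1 := by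
        by_contra h'
        exact h₁.2 ⟨hc.2, h'⟩
      apply hne
      rw [← pt_coords q, h₂, le_antisymm h₃ hc.1]
    · exact Or.inl (h.trans_lt hcx)
  refine ⟨fun t ht => ?_, fun t t' ht ht' => ?_, fun q hq hqp => ?_⟩
  · rcases Nat.lt_succ_iff_lt_or_eq.1 ht with h | rfl
    · rw [Function.update_of_ne h.ne]
      exact ⟨(H.mem t h).1, (H.mem t h).2.trans hcx.le⟩
    · rw [Function.update_self]
      exact ⟨hpsky, le_rfl⟩
  · rw [Function.update_of_ne (by omega)]
    rcases Nat.lt_succ_iff_lt_or_eq.1 ht' with h | rfl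
    · rw [Function.update_of_ne h.ne]
      exact H.strict t t' ht h
    · rw [Function.update_self]
      obtain ⟨h₁, h₂⟩ := H.mem t ht
      have h₃ : (S t).1 < p.1 := h₂.trans_lt hcx
      refine ⟨h₃, ?_⟩
      have := (mem_sky.1 h₁).2 (pt p) hpP fun h => by
        rw [pt_injective h] at h₃
        exact lt_irrefl _ h₃
      exact this.resolve_left fun h => lt_asymm h h₃
  · rcases le_or_gt (q 0) cx with h | h
    · obtain ⟨t, ht, h'⟩ := H.complete q hq h
      exact ⟨t, by omega, by rw [Function.update_of_ne ht.ne, h']⟩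
    · refine ⟨cnt, Nat.lt_succ_self _, ?_⟩
      rw [Function.update_self]
      by_contra hne
      have h₁ := (mem_sky.1 hq).2 _ hpP hne
      have h₂ := (hle q (mem_sky.1 hq).1 h).1
      rcases h₁ with h₁ | h₁
      · exact absurd hqp (not_le.2 h₁)
      · exact absurd h₂ (not_le.2 h₁)

theorem done (H : SkyInv P cx cnt S) (hA : ∀ p, p ∈ P ↔ ∃ i < n, pt (A i) = p)
    (hcx : ∀ i < n, (A i).1 ≤ cx) : IsSkySeq P cnt S := by
  have hc : ∀ p ∈ sky P, ∃ t < cnt, pt (S t) = p := by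
    intro p hp
    refine H.complete p hp ?_
    obtain ⟨i, hi, rfl⟩ := (hA p).1 (mem_sky.1 hp).1
    exact hcx i hi
  refine ⟨le_antisymm H.le_card ?_, fun t ht => (H.mem t ht).1, H.strict, hc⟩
  have : sky P ⊆ (Finset.range cnt).image fun t => pt (S t) := by
    intro p hp
    obtain ⟨t, ht, rfl⟩ := hc p hp
    exact Finset.mem_image_of_mem _ (Finset.mem_range.2 ht)
  simpa using (Finset.card_le_card this).trans Finset.card_image_le

theorem zero (hA : ∀ p, p ∈ P ↔ ∃ i < n, pt (A i) = p) (hcx : ∀ i < n, cx < (A i).1) :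
    SkyInv P cx 0 S := by
  refine ⟨by simp, by simp, fun p hp hpx => ?_⟩
  obtain ⟨i, hi, rfl⟩ := (hA p).1 (mem_sky.1 hp).1
  exact absurd (hcx i hi) hpx.not_gt

end SkyInv

/-! ### Attempts with doubling block width -/

namespace RealRAM

/-- Tries to find the skyline, in at most `w` steps, from sorted blocks of length `w`. -/
def attempt : Cmd :=
  prefixBest ;; .setI 14 (.const 0) ;; .setI 3 (.const 0) ;;
  .loop (.ile (.var 14) (.const 0))
    (scan ;;
      .cond (.ile (.var 13) (.const 0)) (.setI 14 (.const 1))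
        (.cond (.ile (.var 4) (.var 3)) (.setI 14 (.const 2))
          (.storeR 10 (.var 3) (.var 2) ;; .storeR 11 (.var 3) (.var 3) ;; .setR 1 (.var 2) ;;
            .setI 3 (.succ (.var 3)))))

/-- Each of the `cdiv n w` blocks contributes at most its length `w`. -/
theorem ptrPotential_le {n w : ℕ} {ptr : ℕ → ℕ} (hw : 0 < w)
    (h : ∀ b, w ∣ b → b < n → ptr b = min (b + w) n) : ptrPotential n w ptr ≤ n + w := by
  refine le_trans ?_ (cdiv_mul_le hw)
  have : ∀ g ∈ Finset.range (cdiv n w), ptr (g * w) - g * w ≤ w := by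
    intro g hg
    rw [h (g * w) (Dvd.intro_left g rfl) ((lt_cdiv hw).1 (Finset.mem_range.1 hg))]
    omega
  simpa [ptrPotential] using Finset.sum_le_sum this

/-- There are at most `w + 1` scans, each costing O(n/w + 1) besides pointer moves; the pointers
never move up, so their moves total O(n + w). -/
theorem attempt_spec (s : State) {n w : ℕ} {P : Finset Point} (hn : s.ivar 0 = n)
    (hw : s.ivar 4 = w) (hw0 : 0 < w) (hs : BlockSorted (s.pairs 0 1) n w)
    (hP : ∀ p, p ∈ P ↔ ∃ i < n, pt (s.pairs 0 1 i) = p) :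
    Run attempt s fun s' t => t ≤ 500 * (n + w) ∧
      ((s'.ivar 14 = 1 ∧ IsSkySeq P (s'.ivar 3) (s'.pairs 10 11)) ∨
        (s'.ivar 14 = 2 ∧ w < (sky P).card)) := by
  simp only [attempt, run_seq, run_setI]
  refine (prefixBest_spec s hn hw hw0).frame.mono ?_
  rintro s₁ t₁ ⟨⟨ht₁, hB, hptr, hcx⟩, hF₁⟩
  have hA₁ : s₁.pairs 0 1 = s.pairs 0 1 := by
    funext x
    simp only [State.pairs, hF₁.rarr 0 (by decide), hF₁.rarr 1 (by decide)]
  refine (Run.loop (fun s' => ∃ cnt ≤ w, s'.ivar 0 = n ∧ s'.ivar 4 = w ∧ s'.ivar 3 = cnt ∧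
    s'.pairs 0 1 = s.pairs 0 1 ∧
    ((s'.ivar 14 = 0 ∧ PrefixBest (s.pairs 0 1) (s'.pairs 8 9) n w ∧
      PtrInv (s.pairs 0 1) n w (s'.rvar 1) (s'.iarr 0) ∧
      SkyInv P (s'.rvar 1) cnt (s'.pairs 10 11)) ∨
     (s'.ivar 14 = 1 ∧ IsSkySeq P cnt (s'.pairs 10 11)) ∨
     (s'.ivar 14 = 2 ∧ w < (sky P).card)))
    (fun s' => 20 * ptrPotential n w (s'.iarr 0) +
      if s'.ivar 14 = 0 then (w + 1 - s'.ivar 3) * (120 * cdiv n w + 60) else 0) ?_ ?_).mono ?_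
  · refine ⟨0, Nat.zero_le _, ?_, ?_, by simp [IExpr.eval], hA₁, Or.inl ⟨by simp [IExpr.eval], hB,
      ?_, SkyInv.zero hP hcx⟩⟩
    · simp [hF₁.ivar 0 (by decide), hn]
    · simp [hF₁.ivar 4 (by decide), hw]
    · intro b hb hbn
      change b ≤ s₁.iarr 0 b ∧ s₁.iarr 0 b ≤ _ ∧ ∀ i, s₁.iarr 0 b ≤ i → _
      rw [hptr b hb hbn]
      exact ⟨by omega, le_rfl, fun i h₁ h₂ => absurd h₁ h₂.not_ge⟩
  · rintro s₂ ⟨cnt, hcnt, h0, h4, h3, hA, hst⟩ hb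
    simp only [BExpr.Holds, IExpr.eval] at hb
    obtain ⟨h14, hB₂, hptr₂, hsky⟩ := hst.resolve_right (by omega)
    rw [run_seq]
    refine (scan_spec s₂ h0 h4 hw0 (hA ▸ hs) (hA ▸ hB₂) (hA ▸ hptr₂)).frame.mono ?_
    rintro s₃ t ⟨⟨ht, hptr₃, hfound⟩, hF⟩
    have f0 : s₃.ivar 0 = n := by rw [hF.ivar 0 (by decide), h0]
    have f3 : s₃.ivar 3 = cnt := by rw [hF.ivar 3 (by decide), h3]
    have f4 : s₃.ivar 4 = w := by rw [hF.ivar 4 (by decide), h4]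
    have f14 : s₃.ivar 14 = 0 := by rw [hF.ivar 14 (by decide), h14]
    have hA₃ : s₃.pairs 0 1 = s.pairs 0 1 := by
      rw [← hA]
      funext x
      simp only [State.pairs, hF.rarr 0 (by decide), hF.rarr 1 (by decide)]
    have hB₃ : s₃.pairs 8 9 = s₂.pairs 8 9 := by
      funext x
      simp only [State.pairs, hF.rarr 8 (by decide), hF.rarr 9 (by decide)]
    have hS₃ : s₃.pairs 10 11 = s₂.pairs 10 11 := by
      funext x
      simp only [State.pairs, hF.rarr 10 (by decide), hF.rarr 11 (by decide)]
    rw [hA] at hptr₃ hfound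
    obtain ⟨d, hd⟩ := Nat.exists_eq_add_of_le hcnt
    have hmul : (w + 1 - cnt) * (120 * cdiv n w + 60) =
        (w - cnt) * (120 * cdiv n w + 60) + (120 * cdiv n w + 60) := by
      rw [← add_one_mul, show w + 1 - cnt = w - cnt + 1 by omega]
    simp only [run_cond, run_seq, run_setI, run_setR, run_storeR, BExpr.Holds, IExpr.eval,
      RExpr.eval, State.storeR_ivar, State.setI_ivar, State.setR_ivar, State.storeR_rvar,
      State.setI_iarr, State.setR_iarr, State.storeR_iarr, State.setI_rvar, State.setR_rvar,
      ↓reduceIte, Nat.reduceEqDiff, f0, f3, f4, f14, h14, h3, IExpr.cost, RExpr.cost, BExpr.cost,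
      hmul]
    refine ⟨fun hc => ⟨⟨cnt, hcnt, by trivial, by trivial, by trivial, hA₃, Or.inr (Or.inl ⟨by trivial, ?_⟩)⟩, ?_⟩,
      fun hc => ⟨fun hc' => ⟨⟨cnt, hcnt, by trivial, by trivial, by trivial, hA₃, Or.inr (Or.inr ⟨by trivial, ?_⟩)⟩, ?_⟩,
        fun hc' => ⟨⟨cnt + 1, by omega, by trivial, by trivial, by trivial, hA₃, Or.inl ⟨by trivial, ?_, ?_, ?_⟩⟩, ?_⟩⟩⟩
    · change IsSkySeq P cnt (s₃.pairs 10 11)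
      rw [hS₃]
      exact hsky.done hP (hfound.resolve_right fun h => by omega).2
    · omega
    -- The point just found is not stored, but it would be the skyline point number `w + 1`, so the
    -- skyline has more than `w` points.
    · exact (hsky.step hP (hfound.resolve_left fun h => by omega).2).le_card.trans_lt' (by omega)
    · omega
    · change PrefixBest _ (s₃.pairs 8 9) n w
      rwa [hB₃]
    · have hbest := (hfound.resolve_left fun h => by omega).2
      intro b hb hbn
      obtain ⟨h₁, h₂, h₃⟩ := hptr₃ b hb hbn
      exact ⟨h₁, h₂, fun i hi hi' => (h₃ i hi hi').trans hbest.2.1.le⟩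
    · have hbest := (hfound.resolve_left fun h => by omega).2
      have := hsky.step hP hbest
      rw [State.pairs_update (s := s₃) (a := 10) (b := 11) (o := cnt) (x := s₃.rvar 2)
        (y := s₃.rvar 3) (by simp) (by simp), hS₃]
      exact this
    · rw [show w + 1 - (cnt + 1) = w - cnt by omega]
      omega
  · rintro s₂ t ⟨⟨cnt, hcnt, h0, h4, h3, hA, hst⟩, hb, ht⟩
    simp only [BExpr.Holds, IExpr.eval] at hb
    simp only [BExpr.cost, IExpr.cost, IExpr.eval, State.setI_ivar, State.setI_iarr, ↓reduceIte,
      Nat.reduceEqDiff, Nat.sub_zero] at ht ⊢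
    refine ⟨?_, ?_⟩
    · have h₁ := ptrPotential_le hw0 hptr
      have h₂ := cdiv_mul_le (n := n) hw0
      have h₃ : cdiv n w ≤ cdiv n w * w := Nat.le_mul_of_pos_right _ hw0
      have h₄ : (w + 1) * (120 * cdiv n w + 60) =
        120 * (cdiv n w * w) + 120 * cdiv n w + 60 * w + 60 := by ring
      rw [h₄] at ht
      omega
    · rw [h3]
      exact hst.resolve_left (by omega)

/-- Computes the skyline from left to right in the arrays `10`, `11`. -/
def skyline : Cmd :=
  .setI 4 (.const 1) ;; attempt ;; .loop (.ile (.const 2) (.var 14)) (mergePass ;; attempt)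

/-- An attempt that fails at width `2 ^ l` gives `l ≤ log₂ h`, which bounds the number of further
rounds; each round is one merge pass and one attempt, both linear in `n`. -/
theorem skyline_spec (s : State) {n : ℕ} {P : Finset Point} (hn : s.ivar 0 = n) (hn0 : 0 < n)
    (hP : ∀ p, p ∈ P ↔ ∃ i < n, pt (s.pairs 0 1 i) = p) (hPn : P.card ≤ n) :
    Run skyline s fun s' t => t ≤ 2000 * n * (Nat.log 2 (sky P).card + 2) ∧
      IsSkySeq P (s'.ivar 3) (s'.pairs 10 11) := by
  simp only [skyline, run_seq, run_setI]
  refine (attempt_spec (s.setI 4 _) (n := n) (w := 1) (P := P) (by simp [hn]) (by simp [IExpr.eval]) one_pos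
    (blockSorted_one _ _) hP).frame.mono ?_
  rintro s₁ t₁ ⟨⟨ht₁, hst₁⟩, hF₁⟩
  have hcard : (sky P).card ≤ n := (Finset.card_le_card (Finset.filter_subset _ _)).trans hPn
  have hA₁ : s₁.pairs 0 1 = s.pairs 0 1 := by
    funext x
    simp only [State.pairs, hF₁.rarr 0 (by decide), hF₁.rarr 1 (by decide)]
    rfl
  refine (Run.loop (fun s' => ∃ l, s'.ivar 0 = n ∧ s'.ivar 4 = 2 ^ l ∧
    BlockSorted (s'.pairs 0 1) n (2 ^ l) ∧ (∀ p, p ∈ P ↔ ∃ i < n, pt (s'.pairs 0 1 i) = p) ∧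
    ((s'.ivar 14 = 1 ∧ IsSkySeq P (s'.ivar 3) (s'.pairs 10 11)) ∨
        (s'.ivar 14 = 2 ∧ 2 ^ l < (sky P).card)))
    (fun s' => if s'.ivar 14 = 2 then
      2000 * n * (Nat.log 2 (sky P).card + 1 - Nat.log 2 (s'.ivar 4)) else 0) ?_ ?_).mono ?_
  · refine ⟨0, ?_, ?_, ?_, ?_, hst₁⟩
    · rw [hF₁.ivar 0 (by decide)]; simp [hn]
    · rw [hF₁.ivar 4 (by decide)]; simp [IExpr.eval]
    · exact blockSorted_one _ _
    · rwa [hA₁]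
  · rintro s₂ ⟨l, h0, h4, hs, hP₂, hst⟩ hb
    simp only [BExpr.Holds, IExpr.eval] at hb
    obtain ⟨h14, hl⟩ := hst.resolve_left (by omega)
    rw [run_seq]
    refine (mergePass_spec s₂ h0 h4 (by positivity) hs).frame.mono ?_
    rintro s₃ t₃ ⟨⟨ht₃, h4', hperm, hs₃⟩, hF₃⟩
    have f0 : s₃.ivar 0 = n := by rw [hF₃.ivar 0 (by decide), h0]
    have hP₃ : ∀ p, p ∈ P ↔ ∃ i < n, pt (s₃.pairs 0 1 i) = p := by
      intro p
      rw [hP₂ p]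
      have := fun q => (hperm.mem_iff (a := q))
      simp only [mem_seg, Nat.zero_le, true_and] at this
      constructor
      · rintro ⟨i, hi, rfl⟩
        obtain ⟨j, hj, h⟩ := (this _).2 ⟨i, hi, rfl⟩
        exact ⟨j, hj, by rw [h]⟩
      · rintro ⟨i, hi, rfl⟩
        obtain ⟨j, hj, h⟩ := (this _).1 ⟨i, hi, rfl⟩
        exact ⟨j, hj, by rw [h]⟩
    refine (attempt_spec s₃ f0 h4' (by positivity) hs₃ hP₃).frame.mono ?_
    rintro s₄ t₄ ⟨⟨ht₄, hst₄⟩, hF₄⟩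
    have hA₄ : s₄.pairs 0 1 = s₃.pairs 0 1 := by
      funext x
      simp only [State.pairs, hF₄.rarr 0 (by decide), hF₄.rarr 1 (by decide)]
    have f4 : s₄.ivar 4 = 2 ^ (l + 1) := by
      rw [hF₄.ivar 4 (by decide), h4', pow_succ]; ring
    have h2 : 2 ^ l + 2 ^ l = 2 ^ (l + 1) := by ring
    refine ⟨⟨l + 1, ?_, f4, ?_, ?_, ?_⟩, ?_⟩
    · rw [hF₄.ivar 0 (by decide), f0]
    · rwa [hA₄, ← h2]
    · rwa [hA₄]
    · rwa [← h2]
    · have hlog : l ≤ Nat.log 2 (sky P).card :=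
        (Nat.le_log_iff_pow_le one_lt_two (by omega)).2 hl.le
      simp only [h14, h4, f4, Nat.log_pow one_lt_two, ↓reduceIte, BExpr.cost, IExpr.cost]
      obtain ⟨d, hd⟩ := Nat.exists_eq_add_of_le hlog
      rw [hd, show l + d + 1 - (l + 1) = d by omega, show l + d + 1 - l = d + 1 by omega,
        mul_add_one]
      -- The failed attempt gave `2 ^ l < h ≤ n`, so the doubled width is at most `2 * n`.
      have : 500 * (n + (2 ^ l + 2 ^ l)) ≤ 1500 * n := by omega
      split_ifs <;> omega
  · rintro s₂ t ⟨⟨l, h0, h4, hs, hP₂, hst⟩, hb, ht⟩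
    simp only [BExpr.Holds, IExpr.eval] at hb
    simp only [BExpr.cost, IExpr.cost] at ht ⊢
    refine ⟨?_, (hst.resolve_right (by omega)).2⟩
    have h₁ : (if s₁.ivar 14 = 2 then
        2000 * n * (Nat.log 2 (sky P).card + 1 - Nat.log 2 (s₁.ivar 4)) else 0) ≤
        2000 * n * (Nat.log 2 (sky P).card + 1) := by
      split_ifs
      · exact Nat.mul_le_mul_left _ (Nat.sub_le _ _)
      · exact Nat.zero_le _
    rw [show Nat.log 2 (sky P).card + 2 = Nat.log 2 (sky P).card + 1 + 1 by rfl, mul_add_one]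
    omega

end RealRAM

/-! ## Sorted matrices -/

open Classical in
/-- The positions `(a, b)`, `a ≤ b`, on the grid of width `g` whose values lie between `l` and
`u`. -/
noncomputable def active (f : ℕ → ℕ → ℝ) (h g : ℕ) (l u : ℝ) : Finset (ℕ × ℕ) :=
  (Finset.range (cdiv h g) ×ˢ Finset.range (cdiv h g)).filter fun p =>
    p.1 ≤ p.2 ∧ l < f (p.1 * g) (p.2 * g) ∧ f (p.1 * g) (p.2 * g) < u

theorem mem_active {f : ℕ → ℕ → ℝ} {h g : ℕ} {l u : ℝ} (hg : 0 < g) {a b : ℕ} :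
    (a, b) ∈ active f h g l u ↔
      a ≤ b ∧ b * g < h ∧ l < f (a * g) (b * g) ∧ f (a * g) (b * g) < u := by
  simp only [active, Finset.mem_filter, Finset.mem_product, Finset.mem_range, lt_cdiv hg]
  constructor
  · rintro ⟨⟨_, h₁⟩, h₂, h₃⟩
    exact ⟨h₂, h₁, h₃⟩
  · rintro ⟨h₁, h₂, h₃⟩
    exact ⟨⟨(Nat.mul_le_mul_right g h₁).trans_lt h₂, h₂⟩, h₁, h₃⟩

/-- Round the interval `[a, b]` inwards to the coarser grid. At most four intervals have the same
rounding, which gives the first term when the rounding is active. On each of the fewer than `2 *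
cdiv h g` antidiagonals `a + b = const`, at most one active position has an inactive rounding. -/
theorem card_active_le {f : ℕ → ℕ → ℝ} {h g : ℕ} {l u : ℝ} (hf : IntervalMono f h) (hg : 0 < g) :
    (active f h g l u).card ≤ 4 * (active f h (2 * g) l u).card + 2 * cdiv h g := by
  classical
  set R : ℕ × ℕ → ℕ × ℕ := fun p => ((p.1 + 1) / 2, p.2 / 2) with hR
  rw [← Finset.card_filter_add_card_filter_not (s := active f h g l u)
    (fun p => R p ∈ active f h (2 * g) l u)]
  refine Nat.add_le_add ?_ ?_
  · refine (Finset.card_le_mul_card_image (f := R) _ 4 fun q _ => ?_).trans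
      (Nat.mul_le_mul_left _ (Finset.card_le_card ?_))
    · refine (Finset.card_le_card (t := ({2 * q.1 - 1, 2 * q.1} : Finset ℕ) ×ˢ
        ({2 * q.2, 2 * q.2 + 1} : Finset ℕ)) fun p hp => ?_).trans ?_
      · have := (Finset.mem_filter.1 hp).2
        rw [← this]
        simp only [hR, Finset.mem_product, Finset.mem_insert, Finset.mem_singleton]
        omega
      · rw [Finset.card_product]
        exact Nat.mul_le_mul Finset.card_le_two Finset.card_le_two
    · intro q hq
      obtain ⟨p, hp, rfl⟩ := Finset.mem_image.1 hq
      exact (Finset.mem_filter.1 hp).2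
  · rw [show 2 * cdiv h g = (Finset.range (2 * cdiv h g)).card by simp]
    -- With equal sums and `a₁ < a₂`, the interval `[a₂, b₂]` lies strictly inside `[a₁, b₁]` on
    -- both sides. The rounding of the latter lies between the two, so its value is squeezed between
    -- two active ones.
    have key : ∀ a₁ b₁ a₂ b₂, (a₁, b₁) ∈ active f h g l u → (a₂, b₂) ∈ active f h g l u →
        a₁ + b₁ = a₂ + b₂ → a₁ < a₂ → R (a₁, b₁) ∈ active f h (2 * g) l u := by
      intro a₁ b₁ a₂ b₂ h₁ h₂ hsum hlt
      rw [mem_active hg] at h₁ h₂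
      obtain ⟨h₃, h₄, h₅, h₆⟩ := h₁
      obtain ⟨h₇, h₈, h₉, h₁₀⟩ := h₂
      rw [hR, mem_active (by omega)]
      simp only [← mul_assoc]
      have e₁ : b₁ / 2 * 2 * g ≤ b₁ * g := Nat.mul_le_mul_right _ (by omega)
      have e₂ : b₂ * g ≤ b₁ / 2 * 2 * g := Nat.mul_le_mul_right _ (by omega)
      have e₃ : (a₁ + 1) / 2 * 2 * g ≤ a₂ * g := Nat.mul_le_mul_right _ (by omega)
      have e₄ : a₁ * g ≤ (a₁ + 1) / 2 * 2 * g := Nat.mul_le_mul_right _ (by omega)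
      have e₅ : a₂ * g ≤ b₂ * g := Nat.mul_le_mul_right _ h₇
      refine ⟨by omega, by omega, h₉.trans_le ?_, h₆.trans_le' ?_⟩
      · exact hf.mono _ _ _ _ e₃ e₅ e₂ (by omega)
      · exact hf.mono _ _ _ _ e₄ (e₃.trans (e₅.trans e₂)) e₁ h₄
    refine Finset.card_le_card_of_injOn (fun p => p.1 + p.2) ?_ ?_
    · rintro ⟨a, b⟩ hp
      have h₁ := (mem_active hg).1 (Finset.mem_filter.1 hp).1
      have h₂ := (lt_cdiv hg).2 h₁.2.1
      simp only [Finset.coe_range, Set.mem_Iio]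
      omega
    · rintro ⟨a₁, b₁⟩ h₁ ⟨a₂, b₂⟩ h₂ heq
      obtain ⟨h₁, n₁⟩ := Finset.mem_filter.1 h₁
      obtain ⟨h₂, n₂⟩ := Finset.mem_filter.1 h₂
      simp only at heq
      rcases lt_trichotomy a₁ a₂ with h' | h' | h'
      · exact absurd (key _ _ _ _ h₁ h₂ heq h') n₁
      · exact Prod.ext h' (by simp only; omega)
      · exact absurd (key _ _ _ _ h₂ h₁ heq.symm h') n₂

open Classical in
/-- The active positions before `(a, b)` in the order of the rows. -/
noncomputable def activeBefore (f : ℕ → ℕ → ℝ) (h g : ℕ) (l u : ℝ) (a b : ℕ) : Finset (ℕ × ℕ) :=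
  (active f h g l u).filter fun p => p.1 < a ∨ p.1 = a ∧ p.2 < b

theorem activeBefore_congr {f : ℕ → ℕ → ℝ} {h g : ℕ} {l u : ℝ} {a b a' b' : ℕ}
    (H : ∀ x y, (x, y) ∈ active f h g l u →
      ((x < a ∨ x = a ∧ y < b) ↔ (x < a' ∨ x = a' ∧ y < b'))) :
    activeBefore f h g l u a b = activeBefore f h g l u a' b' :=
  Finset.filter_congr fun ⟨x, y⟩ hp => H x y hp

theorem activeBefore_succ {f : ℕ → ℕ → ℝ} {h g : ℕ} {l u : ℝ} {a b : ℕ}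
    (H : (a, b) ∈ active f h g l u) :
    (activeBefore f h g l u a (b + 1)).val = (a, b) ::ₘ (activeBefore f h g l u a b).val := by
  classical
  have hnot : (a, b) ∉ activeBefore f h g l u a b := by simp [activeBefore]
  have : activeBefore f h g l u a (b + 1) = insert (a, b) (activeBefore f h g l u a b) := by
    ext ⟨x, y⟩
    simp only [activeBefore, Finset.mem_filter, Finset.mem_insert, Prod.mk.injEq]
    constructor
    · rintro ⟨h₁, h₂⟩
      by_cases h₃ : x = a ∧ y = b
      · exact Or.inl h₃
      · exact Or.inr ⟨h₁, by omega⟩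
    · rintro (⟨rfl, rfl⟩ | ⟨h₁, h₂⟩)
      · exact ⟨H, by omega⟩
      · exact ⟨h₁, by omega⟩
  rw [this, Finset.insert_val_of_notMem hnot]

/-! ### Enumeration of the active positions along a staircase -/

namespace RealRAM

/-- Moves the start `17` of the row `8` to the first position with a value above the variable
`4`. -/
def advance : Cmd :=
  .loop (.conj (.ilt (.var 17) (.var 3))
      (.disj (.ilt (.var 17) (.var 8)) (.rle (.dsq (.var 8) (.var 17)) (.var 4))))
    (.setI 17 (.add (.var 17) (.var 15)))

/-- The search for the start of a row resumes from the start of the previous row, so the time is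
charged to the columns passed. Positions below the diagonal are skipped too. -/
theorem advance_spec (s : State) {h g a σ₀ : ℕ} (hh : s.ivar 3 = h) (hg : s.ivar 15 = g)
    (hg0 : 0 < g) (hi : s.ivar 8 = a * g) (hσ : s.ivar 17 = σ₀ * g) (hσh : σ₀ ≤ cdiv h g) :
    Run advance s fun s' t => ∃ σ, s'.ivar 17 = σ * g ∧ σ₀ ≤ σ ∧ σ ≤ cdiv h g ∧
      t + 80 * σ₀ ≤ 80 * σ + 80 ∧
      (∀ b, σ₀ ≤ b → b < σ → a ≤ b → s.dsq (a * g) (b * g) ≤ s.rvar 4) ∧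
      (σ * g < h → a ≤ σ ∧ s.rvar 4 < s.dsq (a * g) (σ * g)) := by
  refine (Run.loop (fun s' => ∃ σ, s'.ivar 3 = h ∧ s'.ivar 15 = g ∧ s'.ivar 8 = a * g ∧
    s'.ivar 17 = σ * g ∧ s'.rarr 10 = s.rarr 10 ∧ s'.rarr 11 = s.rarr 11 ∧
    s'.rvar 4 = s.rvar 4 ∧ σ₀ ≤ σ ∧ σ ≤ cdiv h g ∧
    ∀ b, σ₀ ≤ b → b < σ → a ≤ b → s.dsq (a * g) (b * g) ≤ s.rvar 4)
    (fun s' => 80 * (cdiv h g - s'.ivar 17 / g)) ?_ ?_).mono ?_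
  · exact ⟨σ₀, hh, hg, hi, hσ, rfl, rfl, rfl, le_rfl, hσh, fun b h₁ h₂ => by omega⟩
  · rintro s₁ ⟨σ, h3, h15, h8, h17, hX, hY, h4, h₁, h₂, h₃⟩ hc
    simp only [BExpr.Holds, IExpr.eval, RExpr.eval, h3, h8, h17, hX, hY, h4, not_le] at hc
    have hd : σ * g / g = σ := Nat.mul_div_cancel _ hg0
    have hd' : (σ * g + g) / g = σ + 1 := by
      rw [← add_one_mul]; exact Nat.mul_div_cancel _ hg0
    have hlt := (lt_cdiv hg0).2 hc.1
    simp only [run_setI, IExpr.eval, h15, h17, IExpr.cost, RExpr.cost, BExpr.cost, State.setI_ivar,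
      ↓reduceIte, hd, hd']
    refine ⟨⟨σ + 1, by simp [h3], by simp [], by simp [h8], by ring, hX, hY, h4, by omega, hlt,
      fun b hb hb' hab => ?_⟩, by omega⟩
    rcases Nat.lt_succ_iff_lt_or_eq.1 hb' with h | rfl
    · exact h₃ b hb h hab
    · by_contra hcon
      exact hc.2 ⟨fun h => absurd (Nat.lt_of_mul_lt_mul_right h) hab.not_gt, not_le.1 hcon⟩
  · rintro s₁ t ⟨⟨σ, h3, h15, h8, h17, hX, hY, h4, h₁, h₂, h₃⟩, hc, ht⟩
    simp only [BExpr.Holds, IExpr.eval, RExpr.eval, h3, h8, h17, hX, hY, h4, not_le] at hc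
    simp only [IExpr.cost, RExpr.cost, BExpr.cost, hσ, h17, Nat.mul_div_cancel _ hg0] at ht
    refine ⟨σ, h17, h₁, h₂, by omega, h₃, fun hlt => ?_⟩
    have h₅ : σ * g ≥ a * g ∧ s.rvar 4 < s.dsq (a * g) (σ * g) := by
      refine ⟨?_, ?_⟩
      · by_contra hcon
        exact hc ⟨hlt, fun h => h.1 (not_le.1 hcon)⟩
      · by_contra hcon
        exact hc ⟨hlt, fun h => h.2.not_ge (not_lt.1 hcon)⟩
    exact ⟨Nat.le_of_mul_le_mul_right h₅.1 hg0, h₅.2⟩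

/-- Appends the values below the variable `5` of the row `8`, from the column `9` on, to the
array `0`. -/
def collect : Cmd :=
  .loop (.conj (.ilt (.var 9) (.var 3)) (.rlt (.dsq (.var 8) (.var 9)) (.var 5)))
    (.storeR 0 (.var 0) (.dsq (.var 8) (.var 9)) ;; .setI 0 (.succ (.var 0)) ;;
      .setI 9 (.add (.var 9) (.var 15)))

/-- The multiset of the values at the positions in `S`. -/
def gridValues (f : ℕ → ℕ → ℝ) (g : ℕ) (S : Finset (ℕ × ℕ)) : Multiset ℝ :=
  S.val.map fun p => f (p.1 * g) (p.2 * g)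

/-- Values increase along a row, so its active positions form one run that begins at `σ` and ends
before the first value not below the upper bound. Each step is charged to a value appended. -/
theorem collect_spec (s : State) {h g a σ : ℕ} (hh : s.ivar 3 = h) (hg : s.ivar 15 = g)
    (hg0 : 0 < g) (hi : s.ivar 8 = a * g) (hj : s.ivar 9 = σ * g) (hf : IntervalMono s.dsq h)
    (hσ : σ * g < h → a ≤ σ ∧ s.rvar 4 < s.dsq (a * g) (σ * g))
    (hM : (seg (s.rarr 0) 0 (s.ivar 0) : Multiset ℝ) =
      gridValues s.dsq g (activeBefore s.dsq h g (s.rvar 4) (s.rvar 5) a σ)) :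
    Run collect s fun s' t => t + 80 * s.ivar 0 ≤ 80 * s'.ivar 0 + 80 ∧
      (seg (s'.rarr 0) 0 (s'.ivar 0) : Multiset ℝ) =
        gridValues s.dsq g (activeBefore s.dsq h g (s.rvar 4) (s.rvar 5) (a + 1) 0) := by
  set L := (active s.dsq h g (s.rvar 4) (s.rvar 5)).card with hL
  -- The list never outgrows the active set, so `L` minus its length decreases with every append and
  -- can serve as potential.
  have hcard : ∀ (T : ℕ) (A : ℕ → ℝ) (x y : ℕ), (seg A 0 T : Multiset ℝ) =
      gridValues s.dsq g (activeBefore s.dsq h g (s.rvar 4) (s.rvar 5) x y) → T ≤ L := by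
    intro T A x y hxy
    have := congrArg Multiset.card hxy
    simp only [Multiset.coe_card, length_seg, gridValues, Multiset.card_map,
      Finset.card_val, Nat.sub_zero] at this
    rw [this]
    exact Finset.card_le_card (Finset.filter_subset _ _)
  refine (Run.loop (fun s' => ∃ b T, s'.ivar 3 = h ∧ s'.ivar 15 = g ∧ s'.ivar 8 = a * g ∧
    s'.ivar 9 = b * g ∧ s'.ivar 0 = T ∧ s'.rarr 10 = s.rarr 10 ∧ s'.rarr 11 = s.rarr 11 ∧
    s'.rvar 5 = s.rvar 5 ∧ σ ≤ b ∧ (seg (s'.rarr 0) 0 T : Multiset ℝ) =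
      gridValues s.dsq g (activeBefore s.dsq h g (s.rvar 4) (s.rvar 5) a b))
    (fun s' => 80 * (L - s'.ivar 0)) ?_ ?_).mono ?_
  · exact ⟨σ, s.ivar 0, hh, hg, hi, hj, rfl, rfl, rfl, rfl, le_rfl, hM⟩
  · rintro s₁ ⟨b, T, h3, h15, h8, h9, h0, hX, hY, h5, hσb, hM₁⟩ hc
    simp only [BExpr.Holds, IExpr.eval, RExpr.eval, h3, h8, h9, hX, hY, h5, not_le] at hc
    have hmem : (a, b) ∈ active s.dsq h g (s.rvar 4) (s.rvar 5) := by
      have e₁ : σ * g ≤ b * g := Nat.mul_le_mul_right _ hσb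
      obtain ⟨h₁, h₂⟩ := hσ (e₁.trans_lt hc.1)
      exact (mem_active hg0).2 ⟨h₁.trans hσb, hc.1, h₂.trans_le
        (hf.mono _ _ _ _ le_rfl (Nat.mul_le_mul_right _ h₁) e₁ hc.1), hc.2⟩
    have hM₂ : (seg (Function.update (s₁.rarr 0) T (s.dsq (a * g) (b * g))) 0 (T + 1) :
        Multiset ℝ) =
        gridValues s.dsq g (activeBefore s.dsq h g (s.rvar 4) (s.rvar 5) a (b + 1)) := by
      rw [seg_update_succ _ (Nat.zero_le _), gridValues, activeBefore_succ hmem, Multiset.map_cons,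
        ← Multiset.coe_add, hM₁, Multiset.coe_singleton, add_comm, Multiset.singleton_add]
      rfl
    have hT := hcard _ _ _ _ hM₂
    simp only [run_seq, run_storeR, run_setI, IExpr.eval, RExpr.eval, h0, h8, h9, h15, hX, hY,
      IExpr.cost, RExpr.cost, BExpr.cost, State.setI_ivar, State.storeR_ivar, State.setI_rarr,
      State.storeR_rarr, ↓reduceIte, Nat.reduceEqDiff]
    exact ⟨⟨b + 1, T + 1, h3, by trivial, by trivial, by ring, by trivial, by trivial, by trivial,
      h5, by omega, hM₂⟩, by omega⟩
  · rintro s₁ t ⟨⟨b, T, h3, h15, h8, h9, h0, hX, hY, h5, hσb, hM₁⟩, hc, ht⟩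
    simp only [BExpr.Holds, IExpr.eval, RExpr.eval, h3, h8, h9, hX, hY, h5, not_le] at hc
    simp only [IExpr.cost, RExpr.cost, BExpr.cost, h0] at ht
    have h₁ := hcard _ _ _ _ hM
    have h₂ := hcard _ _ _ _ hM₁
    rw [h0]
    refine ⟨by omega, ?_⟩
    rw [hM₁]
    congr 1
    refine activeBefore_congr fun x y hxy => ?_
    have h₃ : x = a → y < b := by
      rintro rfl
      by_contra hcon
      rw [mem_active hg0] at hxy
      have e₁ : b * g ≤ y * g := Nat.mul_le_mul_right _ (not_lt.1 hcon)
      have e₂ : b * g < h := e₁.trans_lt hxy.2.1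
      have e₃ : σ * g ≤ b * g := Nat.mul_le_mul_right _ hσb
      have h₁ := (hσ (e₃.trans_lt e₂)).1
      refine hc ⟨e₂, lt_of_le_of_lt ?_ hxy.2.2.2⟩
      exact hf.mono _ _ _ _ le_rfl (Nat.mul_le_mul_right _ (h₁.trans hσb)) e₁ hxy.2.1
    omega

/-- Writes the active values on the grid of width `15` to the array `0`, their number to the
variable `0` and the number of rows to the variable `16`. -/
def enumerate : Cmd :=
  .setI 0 (.const 0) ;; .setI 16 (.const 0) ;; .setI 8 (.const 0) ;; .setI 17 (.const 0) ;;
  .loop (.ilt (.var 8) (.var 3))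
    (.setI 16 (.succ (.var 16)) ;; advance ;; .setI 9 (.var 17) ;; collect ;;
      .setI 8 (.add (.var 8) (.var 15)))

theorem State.dsq_congr {s s' : State} (hX : s'.rarr 10 = s.rarr 10)
    (hY : s'.rarr 11 = s.rarr 11) : s'.dsq = s.dsq := by
  funext i j
  simp only [State.dsq, hX, hY]

/-- For a fixed column the values decrease as the row index approaches it. A column dismissed as too
small in one row therefore stays dismissed in later rows, and the row starts form a monotone
staircase: the time is linear in rows plus output. -/
theorem enumerate_spec (s : State) {h g : ℕ} (hh : s.ivar 3 = h) (hg : s.ivar 15 = g)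
    (hg0 : 0 < g) (hf : IntervalMono s.dsq h) :
    Run enumerate s fun s' t =>
      t ≤ 300 * cdiv h g + 80 * (active s.dsq h g (s.rvar 4) (s.rvar 5)).card + 20 ∧
      s'.ivar 16 = cdiv h g ∧ (seg (s'.rarr 0) 0 (s'.ivar 0) : Multiset ℝ) =
        gridValues s.dsq g (active s.dsq h g (s.rvar 4) (s.rvar 5)) := by
  set L := (active s.dsq h g (s.rvar 4) (s.rvar 5)).card with hL
  have hcard : ∀ (T : ℕ) (A : ℕ → ℝ) (x y : ℕ), (seg A 0 T : Multiset ℝ) =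
      gridValues s.dsq g (activeBefore s.dsq h g (s.rvar 4) (s.rvar 5) x y) → T ≤ L := by
    intro T A x y hxy
    have := congrArg Multiset.card hxy
    simp only [Multiset.coe_card, length_seg, gridValues, Multiset.card_map,
      Finset.card_val, Nat.sub_zero] at this
    rw [this]
    exact Finset.card_le_card (Finset.filter_subset _ _)
  simp only [enumerate, run_seq, run_setI]
  refine (Run.loop (fun s' => ∃ a σ T, s'.ivar 3 = h ∧ s'.ivar 15 = g ∧ s'.ivar 16 = a ∧
    s'.ivar 8 = a * g ∧ s'.ivar 17 = σ * g ∧ s'.ivar 0 = T ∧ s'.rarr 10 = s.rarr 10 ∧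
    s'.rarr 11 = s.rarr 11 ∧ s'.rvar 4 = s.rvar 4 ∧ s'.rvar 5 = s.rvar 5 ∧ a ≤ cdiv h g ∧
    σ ≤ cdiv h g ∧
    (∀ a' b, a ≤ a' → b < σ → a' ≤ b → s.dsq (a' * g) (b * g) ≤ s.rvar 4) ∧
    (seg (s'.rarr 0) 0 T : Multiset ℝ) =
      gridValues s.dsq g (activeBefore s.dsq h g (s.rvar 4) (s.rvar 5) a 0))
    (fun s' => 220 * (cdiv h g - s'.ivar 16) + 80 * (cdiv h g - s'.ivar 17 / g) +
      80 * (L - s'.ivar 0)) ?_ ?_).mono ?_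
  · refine ⟨0, 0, 0, by simp [hh], by simp [hg], by simp [IExpr.eval], by simp [IExpr.eval],
      by simp [IExpr.eval], by simp [IExpr.eval], rfl, rfl, rfl, rfl, by simp, by simp, by simp, ?_⟩
    simp [seg, gridValues, activeBefore]
  · rintro s₁ ⟨a, σ₀, T, h3, h15, h16, h8, h17, h0, hX, hY, h4, h5, ha, hσ₀, hlow, hM⟩ hc
    simp only [BExpr.Holds, IExpr.eval, h3, h8, not_le] at hc
    have ha' := (lt_cdiv hg0).2 hc
    simp only [run_seq, run_setI]
    have hd₁ : ∀ v, (s₁.setI 16 v).dsq = s.dsq := fun v => State.dsq_congr hX hY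
    refine (advance_spec (s₁.setI 16 _) (h := h) (g := g) (a := a) (σ₀ := σ₀) (by simp [h3])
      (by simp [h15]) hg0 (by simp [h8]) (by simp [h17]) hσ₀).frame.mono ?_
    rintro s₂ t₂ ⟨⟨σ, k17, hσσ, hσ, ht₂, hle, hgt⟩, hF⟩
    rw [hd₁] at hle hgt
    simp only [State.setI_rvar, h4] at hle hgt
    have k0 : s₂.ivar 0 = T := by rw [hF.ivar 0 (by decide)]; simp [h0]
    have k3 : s₂.ivar 3 = h := by rw [hF.ivar 3 (by decide)]; simp [h3]
    have k8 : s₂.ivar 8 = a * g := by rw [hF.ivar 8 (by decide)]; simp [h8]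
    have k15 : s₂.ivar 15 = g := by rw [hF.ivar 15 (by decide)]; simp [h15]
    have k16 : s₂.ivar 16 = a + 1 := by rw [hF.ivar 16 (by decide)]; simp [h16, IExpr.eval]
    have k4 : s₂.rvar 4 = s.rvar 4 := by rw [hF.rvar 4 (by decide)]; simp [h4]
    have k5 : s₂.rvar 5 = s.rvar 5 := by rw [hF.rvar 5 (by decide)]; simp [h5]
    have kA : s₂.rarr 0 = s₁.rarr 0 := by rw [hF.rarr 0 (by decide)]; simp
    have kX : s₂.rarr 10 = s.rarr 10 := by rw [hF.rarr 10 (by decide)]; simp [hX]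
    have kY : s₂.rarr 11 = s.rarr 11 := by rw [hF.rarr 11 (by decide)]; simp [hY]
    have hd₂ : ∀ v, (s₂.setI 9 v).dsq = s.dsq := fun v => State.dsq_congr kX kY
    have hlow' : ∀ a' b, a ≤ a' → b < σ → a' ≤ b → b * g < h →
        s.dsq (a' * g) (b * g) ≤ s.rvar 4 := by
      intro a' b h₁ h₂ h₃ h₄
      rcases Nat.lt_or_ge b σ₀ with h' | h'
      · exact hlow a' b h₁ h' h₃
      · exact (hf.mono _ _ _ _ (Nat.mul_le_mul_right _ h₁) (Nat.mul_le_mul_right _ h₃) le_rfl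
          h₄).trans (hle b h' h₂ (h₁.trans h₃))
    refine (collect_spec (s₂.setI 9 _) (h := h) (g := g) (a := a) (σ := σ) (by simp [k3])
      (by simp [k15]) hg0 (by simp [k8]) (by simp [k17, IExpr.eval]) (by rwa [hd₂]) ?_
      ?_).frame.mono ?_
    · rw [hd₂, State.setI_rvar, k4]
      exact hgt
    · rw [hd₂, State.setI_rvar, k4, k5, State.setI_rarr, State.setI_ivar, if_neg (by decide), k0,
        kA, hM]
      congr 1
      refine activeBefore_congr fun x y hxy => ?_
      have : ¬ (x = a ∧ y < σ) := by
        rintro ⟨rfl, h₁⟩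
        have h₂ := (mem_active hg0).1 hxy
        exact absurd (hlow' x y le_rfl h₁ h₂.1 h₂.2.1) h₂.2.2.1.not_ge
      omega
    rintro s₃ t₃ ⟨⟨ht₃, hM₃⟩, hF₃⟩
    rw [hd₂, State.setI_rvar, k4, k5] at hM₃
    have hT₃ := hcard _ _ _ _ hM₃
    have hT := hcard _ _ _ _ hM
    simp only [State.setI_ivar, Nat.reduceEqDiff, ↓reduceIte, k0] at ht₃
    have l3 : s₃.ivar 3 = h := by rw [hF₃.ivar 3 (by decide)]; simp [k3]
    have l8 : s₃.ivar 8 = a * g := by rw [hF₃.ivar 8 (by decide)]; simp [k8]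
    have l15 : s₃.ivar 15 = g := by rw [hF₃.ivar 15 (by decide)]; simp [k15]
    have l16 : s₃.ivar 16 = a + 1 := by rw [hF₃.ivar 16 (by decide)]; simp [k16]
    have l17 : s₃.ivar 17 = σ * g := by rw [hF₃.ivar 17 (by decide)]; simp [k17]
    have l4 : s₃.rvar 4 = s.rvar 4 := by rw [hF₃.rvar 4 (by decide)]; simp [k4]
    have l5 : s₃.rvar 5 = s.rvar 5 := by rw [hF₃.rvar 5 (by decide)]; simp [k5]
    have lX : s₃.rarr 10 = s.rarr 10 := by rw [hF₃.rarr 10 (by decide)]; simp [kX]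
    have lY : s₃.rarr 11 = s.rarr 11 := by rw [hF₃.rarr 11 (by decide)]; simp [kY]
    simp only [IExpr.eval, State.setI_ivar, State.setI_rarr, State.setI_rvar, ↓reduceIte,
      Nat.reduceEqDiff, l3, l8, l15, l16, l17, l4, l5, lX, lY, h16, h17, h0,
      Nat.mul_div_cancel _ hg0, IExpr.cost, BExpr.cost]
    refine ⟨⟨a + 1, σ, s₃.ivar 0, by trivial, by trivial, by trivial, by ring, by trivial,
      by trivial, by trivial, by trivial, by trivial, by trivial, ha', hσ,
      fun a' b h₁ h₂ h₃ => hlow' a' b (by omega) h₂ h₃ ((lt_cdiv hg0).1 (by omega)), hM₃⟩, ?_⟩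
    omega
  · rintro s₁ t ⟨⟨a, σ₀, T, h3, h15, h16, h8, h17, h0, hX, hY, h4, h5, ha, hσ₀, hlow, hM⟩, hc, ht⟩
    simp only [BExpr.Holds, IExpr.eval, h3, h8, not_not] at hc
    simp only [BExpr.cost, IExpr.cost, IExpr.eval, State.setI_ivar, ↓reduceIte,
      Nat.reduceEqDiff, Nat.sub_zero, Nat.zero_div] at ht ⊢
    have ha' : a = cdiv h g := le_antisymm ha (not_lt.1 fun h => by
      have := (lt_cdiv hg0).1 h
      omega)
    refine ⟨by omega, by omega, ?_⟩
    rw [h0, hM]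
    congr 1
    refine Finset.filter_true_of_mem ?_
    rintro ⟨x, y⟩ hxy
    have h₁ := (mem_active hg0).1 hxy
    have h₂ := (lt_cdiv hg0).2 h₁.2.1
    exact Or.inl (by simp only; omega)

end RealRAM

/-- At most `k` indices cover all indices below `h` within `f`-distance `r`. -/
def Feasible (f : ℕ → ℕ → ℝ) (h k : ℕ) (r : ℝ) : Prop := ∃ Q, Covers f h r Q ∧ Q.card ≤ k

theorem Feasible.mono {f : ℕ → ℕ → ℝ} {h k : ℕ} {r r' : ℝ} (H : Feasible f h k r) (hr : r ≤ r') :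
    Feasible f h k r' := by
  obtain ⟨Q, hQ, hk⟩ := H
  exact ⟨Q, ⟨hQ.1, fun p hp => (hQ.2 p hp).imp fun q hq => ⟨hq.1, hq.2.trans hr⟩⟩, hk⟩

theorem Feasible.nonneg {f : ℕ → ℕ → ℝ} {h k : ℕ} {r : ℝ} (hf : IntervalMono f h) (hh : 0 < h)
    (H : Feasible f h k r) : 0 ≤ r := by
  obtain ⟨Q, hQ, -⟩ := H
  obtain ⟨q, hq, hqr⟩ := hQ.2 0 hh
  exact (hf.nonneg (hQ.1 q hq) hh).trans hqr

theorem feasible_first_last {f : ℕ → ℕ → ℝ} {h k : ℕ} (hf : IntervalMono f h) (hh : 0 < h)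
    (hk : 1 ≤ k) : Feasible f h k (f 0 (h - 1)) := by
  refine ⟨{0}, ⟨by simpa using hh, fun p hp => ⟨0, by simp, ?_⟩⟩, by simpa using hk⟩
  exact hf.mono 0 0 p (h - 1) le_rfl (Nat.zero_le _) (by omega) (by omega)

/-- A round of bisection lowers this potential by one. The factor 2 inside the logarithm makes the
last round count, when the quotient drops from 1 to 0. -/
theorem half_div_log {a a' c : ℕ} (hc : 0 < c) (ha : c ≤ a) (ha' : a' ≤ a / 2) :
    Nat.log 2 (2 * (a' / c)) + 1 ≤ Nat.log 2 (2 * (a / c)) := by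
  have h₁ : 0 < a / c := Nat.div_pos ha hc
  have h₂ : 2 * (a' / c) ≤ a / c := by
    rw [Nat.le_div_iff_mul_le hc]
    have := Nat.div_mul_le_self a' c
    calc 2 * (a' / c) * c = 2 * (a' / c * c) := by ring
      _ ≤ 2 * a' := Nat.mul_le_mul_left _ this
      _ ≤ a := by omega
  rw [mul_comm 2 (a / c), Nat.log_mul_base one_lt_two h₁.ne']
  exact Nat.succ_le_succ (Nat.log_mono_right h₂)

/-- A geometric series, with one extra unit per level for rounding up. -/
theorem sum_cdiv_le (h e : ℕ) :
    ∑ i ∈ Finset.range (e + 1), cdiv h (2 ^ i) ≤ 2 * h + (e + 1) := by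
  have h₁ : ∀ i ∈ Finset.range (e + 1), cdiv h (2 ^ i) ≤ h / 2 ^ i + 1 := by
    intro i _
    rw [cdiv, ← Nat.add_div_right _ (by positivity)]
    exact Nat.div_le_div_right (Nat.sub_le _ _)
  refine (Finset.sum_le_sum h₁).trans ?_
  rw [Finset.sum_add_distrib]
  have := Nat.geom_sum_le (b := 2) le_rfl h (e + 1)
  simp at this ⊢
  omega

/-! ### Binary search with the greedy test -/

namespace RealRAM

/-- Binary search for the optimal value in the window `18`, `19` of the array `0`, until at most
`20` values are left. -/
def bisect : Cmd :=
  .loop (.ilt (.var 20) (.sub (.var 19) (.var 18)))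
    (.setI 21 (.add (.var 18) (.half (.sub (.var 19) (.var 18)))) ;;
      .setR 6 (.cell 0 (.var 21)) ;; greedy ;;
      .cond (.ile (.var 2) (.var 1))
        (.setR 5 (.var 6) ;; .setI 18 (.succ (.var 21)))
        (.setR 4 (.var 6) ;; .setI 19 (.var 21)))

theorem greedy_feasible_iff {f : ℕ → ℕ → ℝ} {h k c : ℕ} {r : ℝ} {ctr : ℕ → ℕ}
    (hlt : ∀ t < c, ctr t < h) (hcov : ∀ q < h, ∃ t < c, f (ctr t) q ≤ r)
    (hmin : ∀ Q, Covers f h r Q → c ≤ Q.card) : c ≤ k ↔ Feasible f h k r := by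
  classical
  constructor
  · intro hc
    refine ⟨(Finset.range c).image ctr, ⟨?_, ?_⟩, Finset.card_image_le.trans (by simpa using hc)⟩
    · intro q hq
      obtain ⟨t, ht, rfl⟩ := Finset.mem_image.1 hq
      exact hlt t (Finset.mem_range.1 ht)
    · intro p hp
      obtain ⟨t, ht, h'⟩ := hcov p hp
      exact ⟨_, Finset.mem_image_of_mem _ (Finset.mem_range.2 ht), h'⟩
  · rintro ⟨Q, hQ, hk⟩
    exact (hmin Q hQ).trans hk

/-- The array is decreasing, so a feasible middle value becomes the new upper bound and eliminates
everything up to and including the middle; an infeasible one becomes the lower bound and eliminates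
the rest. Only the window can still contain values strictly between the bounds. -/
theorem bisect_spec (s : State) {h k T thr : ℕ} (hh : s.ivar 3 = h) (hk : s.ivar 1 = k)
    (hlo : s.ivar 18 = 0) (hhi : s.ivar 19 = T) (hthr : s.ivar 20 = thr)
    (hf : IntervalMono s.dsq h) (hA : ∀ i j, i < j → j < T → s.rarr 0 j ≤ s.rarr 0 i)
    (hA0 : ∀ i < T, 0 ≤ s.rarr 0 i)
    (hAlu : ∀ i < T, s.rvar 4 < s.rarr 0 i ∧ s.rarr 0 i < s.rvar 5) (hl : ¬ Feasible s.dsq h k (s.rvar 4))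
    (hu : Feasible s.dsq h k (s.rvar 5)) :
    Run bisect s fun s' t => t ≤ (200 * h + 60) * Nat.log 2 (2 * (T / (thr + 1))) + 10 ∧
      ¬ Feasible s.dsq h k (s'.rvar 4) ∧ Feasible s.dsq h k (s'.rvar 5) ∧
      s.rvar 4 ≤ s'.rvar 4 ∧ s'.rvar 5 ≤ s.rvar 5 ∧ ∃ lo hi, lo ≤ hi ∧ hi ≤ T ∧ hi - lo ≤ thr ∧
      (∀ i < lo, s'.rvar 5 ≤ s.rarr 0 i) ∧ ∀ i, hi ≤ i → i < T → s.rarr 0 i ≤ s'.rvar 4 := by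
  refine (Run.loop (fun s' => ∃ lo hi, s'.ivar 3 = h ∧ s'.ivar 1 = k ∧ s'.ivar 18 = lo ∧
    s'.ivar 19 = hi ∧ s'.ivar 20 = thr ∧ s'.rarr 0 = s.rarr 0 ∧ s'.rarr 10 = s.rarr 10 ∧
    s'.rarr 11 = s.rarr 11 ∧ ¬ Feasible s.dsq h k (s'.rvar 4) ∧ Feasible s.dsq h k (s'.rvar 5) ∧
      s.rvar 4 ≤ s'.rvar 4 ∧ s'.rvar 5 ≤ s.rvar 5 ∧ lo ≤ hi ∧ hi ≤ T ∧
      (∀ i < lo, s'.rvar 5 ≤ s.rarr 0 i) ∧ ∀ i, hi ≤ i → i < T → s.rarr 0 i ≤ s'.rvar 4)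
    (fun s' => (200 * h + 60) * Nat.log 2 (2 * ((s'.ivar 19 - s'.ivar 18) / (thr + 1))))
    ?_ ?_).mono ?_
  · exact ⟨0, T, hh, hk, hlo, hhi, hthr, rfl, rfl, rfl, hl, hu, le_rfl, le_rfl, Nat.zero_le _,
      le_rfl, by simp, fun i h₁ h₂ => by omega⟩
  · rintro s₁ ⟨lo, hi, h3, h1, h18, h19, h20, hV, hX, hY, hl₁, hu₁, hl₂, hu₂, hlh, hT, hlo₁, hhi₁⟩ hc
    simp only [BExpr.Holds, IExpr.eval, h18, h19, h20, not_le] at hc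
    simp only [run_seq, run_setI, run_setR]
    have hd : ∀ v r, ((s₁.setI 21 v).setR 6 r).dsq = s.dsq := fun v r => State.dsq_congr hX hY
    set m := lo + (hi - lo) / 2 with hm
    have hmT : m < T := by omega
    refine (greedy_spec ((s₁.setI 21 _).setR 6 _) (h := h) (by simp [h3]) (by rwa [hd])
      ?_).frame.mono ?_
    · simp only [IExpr.eval, RExpr.eval, h18, h19, State.setR_rvar, State.setI_ivar,
        State.setI_rarr, ↓reduceIte, hV, ← hm]
      exact hA0 m hmT
    rintro s₂ t ⟨⟨ht, ctr, hctr, hstrict, hcov, hmin⟩, hF⟩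
    simp only [hd, IExpr.eval, RExpr.eval, h18, h19, State.setR_rvar, State.setI_ivar,
        State.setI_rarr, ↓reduceIte, hV, ← hm] at hcov hmin
    have hiff := greedy_feasible_iff (k := k) (fun t ht => (hctr t ht).1) hcov hmin
    have k1 : s₂.ivar 1 = k := by rw [hF.ivar 1 (by decide)]; simp [h1]
    have k3 : s₂.ivar 3 = h := by rw [hF.ivar 3 (by decide)]; simp [h3]
    have k18 : s₂.ivar 18 = lo := by rw [hF.ivar 18 (by decide)]; simp [h18]
    have k19 : s₂.ivar 19 = hi := by rw [hF.ivar 19 (by decide)]; simp [h19]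
    have k20 : s₂.ivar 20 = thr := by rw [hF.ivar 20 (by decide)]; simp [h20]
    have k21 : s₂.ivar 21 = m := by
      rw [hF.ivar 21 (by decide)]; simp [IExpr.eval, h18, h19, hm]
    have r4 : s₂.rvar 4 = s₁.rvar 4 := by rw [hF.rvar 4 (by decide)]; simp
    have r5 : s₂.rvar 5 = s₁.rvar 5 := by rw [hF.rvar 5 (by decide)]; simp
    have r6 : s₂.rvar 6 = s.rarr 0 m := by
      rw [hF.rvar 6 (by decide)]; simp [IExpr.eval, RExpr.eval, h18, h19, hV, hm]
    have kV : s₂.rarr 0 = s.rarr 0 := by rw [hF.rarr 0 (by decide)]; simp [hV]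
    have kX : s₂.rarr 10 = s.rarr 10 := by rw [hF.rarr 10 (by decide)]; simp [hX]
    have kY : s₂.rarr 11 = s.rarr 11 := by rw [hF.rarr 11 (by decide)]; simp [hY]
    simp only [run_cond, run_seq, run_setR, run_setI, BExpr.Holds, IExpr.eval, RExpr.eval,
      State.setI_ivar, State.setR_ivar, State.setR_rvar, State.setI_rvar, State.setI_rarr,
      State.setR_rarr, ↓reduceIte, Nat.reduceEqDiff, k1, k3, k18, k19, k20, k21, r4, r5, r6, kV, kX,
      kY, h18, h19, IExpr.cost, RExpr.cost, BExpr.cost]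
    refine ⟨fun hc' => ⟨⟨m + 1, hi, by trivial, by trivial, by trivial, by trivial, by trivial,
        by trivial, by trivial, by trivial, hl₁, hiff.1 hc', hl₂, ?_, by omega, hT, ?_, hhi₁⟩, ?_⟩,
      fun hc' => ⟨⟨lo, m, by trivial, by trivial, by trivial, by trivial, by trivial,
        by trivial, by trivial, by trivial, fun h => hc' (hiff.2 h), hu₁, ?_, hu₂, by omega,
        by omega, hlo₁, ?_⟩, ?_⟩⟩
    · exact (hAlu m hmT).2.le
    · intro i hi'
      rcases Nat.lt_succ_iff_lt_or_eq.1 hi' with h' | rfl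
      · exact hA i m h' hmT
      · exact le_rfl
    · have := half_div_log (a := hi - lo) (a' := hi - (m + 1)) (c := thr + 1) (by omega) (by omega)
        (by omega)
      have h₂ := Nat.mul_le_mul_left (200 * h + 60) this
      rw [mul_add_one] at h₂
      omega
    · exact (hAlu m hmT).1.le
    · intro i hi' hiT
      rcases Nat.eq_or_lt_of_le hi' with rfl | h'
      · exact le_rfl
      · exact hA m i h' hiT
    · have := half_div_log (a := hi - lo) (a' := m - lo) (c := thr + 1) (by omega) (by omega)
        (by omega)
      have h₂ := Nat.mul_le_mul_left (200 * h + 60) this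
      rw [mul_add_one] at h₂
      omega
  · rintro s₁ t ⟨⟨lo, hi, h3, h1, h18, h19, h20, hV, hX, hY, hl₁, hu₁, hl₂, hu₂, hlh, hT, hlo₁, hhi₁⟩, hc, ht⟩
    simp only [BExpr.Holds, IExpr.eval, h18, h19, h20, not_not] at hc
    simp only [BExpr.cost, IExpr.cost, hlo, hhi, Nat.sub_zero] at ht
    exact ⟨by omega, hl₁, hu₁, hl₂, hu₂, lo, hi, hlh, hT, hc, hlo₁, hhi₁⟩

end RealRAM

theorem map_fst_seg {α β : Type*} (A : ℕ → α × β) (i j : ℕ) :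
    (seg A i j).map Prod.fst = seg (fun x => (A x).1) i j := by
  simp [seg]

theorem countP_seg_le {A : ℕ → ℝ} {T lo hi : ℕ} {l u : ℝ} (h₁ : lo ≤ hi) (h₂ : hi ≤ T)
    (hlo : ∀ i < lo, u ≤ A i) (hhi : ∀ i, hi ≤ i → i < T → A i ≤ l) :
    (seg A 0 T).countP (fun x => open Classical in decide (l < x ∧ x < u)) ≤ hi - lo := by
  rw [← seg_append (Nat.zero_le lo) (h₁.trans h₂), ← seg_append h₁ h₂, List.countP_append,
    List.countP_append]
  have e₁ : (seg A 0 lo).countP (fun x => open Classical in decide (l < x ∧ x < u)) = 0 := by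
    rw [List.countP_eq_zero]
    intro x hx
    obtain ⟨i, _, hi', rfl⟩ := mem_seg.1 hx
    have := hlo i hi'
    simp only [decide_eq_true_eq, not_and, not_lt]
    exact fun _ => this
  have e₂ : (seg A hi T).countP (fun x => open Classical in decide (l < x ∧ x < u)) = 0 := by
    rw [List.countP_eq_zero]
    intro x hx
    obtain ⟨i, hi', hi'', rfl⟩ := mem_seg.1 hx
    have := hhi i hi' hi''
    simp only [decide_eq_true_eq, not_and, not_lt]
    exact fun h => absurd this h.not_ge
  have e₃ := List.countP_le_length (l := seg A lo hi)
    (p := fun x => open Classical in decide (l < x ∧ x < u))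
  rw [length_seg] at e₃
  omega

/-- Narrowing the bounds only removes active positions, so those left can be counted in the list
made for the old bounds. -/
theorem card_active_le_countP {f : ℕ → ℕ → ℝ} {h g : ℕ} {l u l' u' : ℝ} {m : List ℝ}
    (hl : l ≤ l') (hu : u' ≤ u) (hm : (m : Multiset ℝ) = RealRAM.gridValues f g (active f h g l u)) :
    (active f h g l' u').card ≤
      m.countP (fun x => open Classical in decide (l' < x ∧ x < u')) := by
  classical
  have h₁ : m.countP (fun x => decide (l' < x ∧ x < u')) =
      (m : Multiset ℝ).countP (fun x => l' < x ∧ x < u') := by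
    rw [Multiset.coe_countP]
  rw [h₁, hm, RealRAM.gridValues, Multiset.countP_map]
  refine Finset.card_le_card (t := (active f h g l u).filter fun p =>
    l' < f (p.1 * g) (p.2 * g) ∧ f (p.1 * g) (p.2 * g) < u') ?_
  intro p hp
  simp only [active, Finset.mem_filter, Finset.mem_product] at hp ⊢
  obtain ⟨h₂, h₃, h₄, h₅⟩ := hp
  exact ⟨⟨h₂, h₃, hl.trans_lt h₄, h₅.trans_le hu⟩, h₄, h₅⟩

/-! ### One level of the matrix search -/

namespace RealRAM

/-- One level of the search, on the grid of width `15`. -/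
def searchLevel : Cmd :=
  enumerate ;; mergeSort ;;
    .cond (.ile (.var 15) (.const 1)) (.setI 20 (.const 0)) (.setI 20 (.var 16)) ;;
    .setI 18 (.const 0) ;; .setI 19 (.var 0) ;; bisect ;; .setI 15 (.half (.var 15))

/-- A coarse level may keep one active value per row on average, which leaves a linear number after
refinement; only the level `g = 1` has to bisect down to nothing and pays for O(L) greedy tests. -/
theorem searchLevel_spec (s : State) {h k g L : ℕ} (hh : s.ivar 3 = h) (hk : s.ivar 1 = k)
    (hg : s.ivar 15 = g) (hg0 : 0 < g) (hh0 : 0 < h) (hL : 12 * h ≤ 2 ^ L)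
    (hf : IntervalMono s.dsq h) (hl : ¬ Feasible s.dsq h k (s.rvar 4))
    (hu : Feasible s.dsq h k (s.rvar 5))
    (hact : (active s.dsq h g (s.rvar 4) (s.rvar 5)).card ≤ 6 * cdiv h g) :
    Run searchLevel s fun s' t =>
      t ≤ 2000 * (L * cdiv h g + h) + (if g = 1 then 2000 * (h * L) else 0) ∧
      s'.ivar 15 = g / 2 ∧ ¬ Feasible s.dsq h k (s'.rvar 4) ∧ Feasible s.dsq h k (s'.rvar 5) ∧
      (active s.dsq h g (s'.rvar 4) (s'.rvar 5)).card ≤ if g = 1 then 0 else cdiv h g := by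
  have hN1 : 0 < cdiv h g := (lt_cdiv hg0).2 (by simpa using hh0)
  have hNh : cdiv h g ≤ h := by
    by_contra hcon
    have := (lt_cdiv (n := h) hg0).1 (not_le.1 hcon)
    exact absurd this (Nat.le_mul_of_pos_right _ hg0).not_gt
  rw [searchLevel, run_seq]
  refine (enumerate_spec s hh hg hg0 hf).frame.mono ?_
  rintro s₁ t₁ ⟨⟨ht₁, h16, hM₁⟩, hF₁⟩
  set T := s₁.ivar 0 with hT
  have hTcard : T = (active s.dsq h g (s.rvar 4) (s.rvar 5)).card := by
    have := congrArg Multiset.card hM₁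
    simpa [length_seg, gridValues] using this
  have hTL : T ≤ 2 ^ L := by omega
  rw [run_seq]
  refine (mergeSort_spec s₁ hT.symm hTL).frame.mono ?_
  rintro s₂ t₂ ⟨⟨ht₂, hperm, hsort⟩, hF₂⟩
  have hM₂ : (seg (s₂.rarr 0) 0 T : Multiset ℝ) =
      gridValues s.dsq g (active s.dsq h g (s.rvar 4) (s.rvar 5)) := by
    rw [← hM₁, Multiset.coe_eq_coe]
    have := hperm.map Prod.fst
    rwa [map_fst_seg, map_fst_seg] at this
  have hdesc : ∀ i j, i < j → j < T → s₂.rarr 0 j ≤ s₂.rarr 0 i := fun i j hij hj =>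
    pairwise_seg.1 hsort i j (Nat.zero_le _) hij hj
  have hvals : ∀ i < T, 0 ≤ s₂.rarr 0 i ∧ s.rvar 4 < s₂.rarr 0 i ∧ s₂.rarr 0 i < s.rvar 5 := by
    intro i hi
    have h₁ : s₂.rarr 0 i ∈ (seg (s₂.rarr 0) 0 T : Multiset ℝ) :=
      Multiset.mem_coe.2 (mem_seg.2 ⟨i, Nat.zero_le _, hi, rfl⟩)
    rw [hM₂, gridValues, Multiset.mem_map] at h₁
    obtain ⟨⟨a, b⟩, hab, h₂⟩ := h₁
    rw [← h₂]
    obtain ⟨h₃, h₄, h₅⟩ := (mem_active hg0).1 hab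
    refine ⟨hf.nonneg ?_ h₄, h₅⟩
    exact (Nat.mul_le_mul_right g h₃).trans_lt h₄
  have k0 : s₂.ivar 0 = T := by rw [hF₂.ivar 0 (by decide)]
  have k1 : s₂.ivar 1 = k := by rw [hF₂.ivar 1 (by decide), hF₁.ivar 1 (by decide), hk]
  have k3 : s₂.ivar 3 = h := by rw [hF₂.ivar 3 (by decide), hF₁.ivar 3 (by decide), hh]
  have k15 : s₂.ivar 15 = g := by rw [hF₂.ivar 15 (by decide), hF₁.ivar 15 (by decide), hg]
  have k16 : s₂.ivar 16 = cdiv h g := by rw [hF₂.ivar 16 (by decide), h16]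
  have r4 : s₂.rvar 4 = s.rvar 4 := by rw [hF₂.rvar 4 (by decide), hF₁.rvar 4 (by decide)]
  have r5 : s₂.rvar 5 = s.rvar 5 := by rw [hF₂.rvar 5 (by decide), hF₁.rvar 5 (by decide)]
  have kd : s₂.dsq = s.dsq := State.dsq_congr
    (by rw [hF₂.rarr 10 (by decide), hF₁.rarr 10 (by decide)])
    (by rw [hF₂.rarr 11 (by decide), hF₁.rarr 11 (by decide)])
  have hlogs : (200 * h + 60) * Nat.log 2 (2 * (T / ((if g = 1 then 0 else cdiv h g) + 1))) ≤
      if g = 1 then 260 * (h * L) else 780 * h := by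
    split_ifs with hg1
    · have h₁ : Nat.log 2 (2 * (T / (0 + 1))) ≤ L := by
        rw [zero_add, Nat.div_one]
        calc Nat.log 2 (2 * T) ≤ Nat.log 2 (2 ^ L) := Nat.log_mono_right (by omega)
          _ = L := Nat.log_pow one_lt_two _
      calc (200 * h + 60) * Nat.log 2 (2 * (T / (0 + 1))) ≤ 260 * h * L :=
            Nat.mul_le_mul (by omega) h₁
        _ = 260 * (h * L) := by ring
    -- The list has at most 6 values per row, so the quotient is at most 5 and three greedy tests
    -- suffice, as log₂ 10 < 4.
    · have h₁ : T / (cdiv h g + 1) < 6 := by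
        rw [Nat.div_lt_iff_lt_mul (by omega)]
        omega
      have h₂ : Nat.log 2 (2 * (T / (cdiv h g + 1))) ≤ 3 :=
        (Nat.log_mono_right (b := 2) (m := 15) (by omega)).trans (by decide)
      calc _ ≤ (200 * h + 60) * 3 := Nat.mul_le_mul_left _ h₂
        _ ≤ 780 * h := by omega
  -- The remainder of the level is proved once, for the thresholds of both branches.
  have key : ∀ s₃ : State, ∀ t₃ ≤ 12,
      s₃ = s₂.setI 20 (if g = 1 then 0 else cdiv h g) →
      Run (.setI 18 (.const 0) ;; .setI 19 (.var 0) ;; bisect ;; .setI 15 (.half (.var 15))) s₃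
        fun s' t => t₁ + (t₂ + (t₃ + t)) ≤
          2000 * (L * cdiv h g + h) + (if g = 1 then 2000 * (h * L) else 0) ∧
          s'.ivar 15 = g / 2 ∧ ¬ Feasible s.dsq h k (s'.rvar 4) ∧
          Feasible s.dsq h k (s'.rvar 5) ∧
          (active s.dsq h g (s'.rvar 4) (s'.rvar 5)).card ≤ if g = 1 then 0 else cdiv h g := by
    rintro s₃ t₃ ht₃ rfl
    simp only [run_seq, run_setI]
    refine (bisect_spec (((s₂.setI 20 _).setI 18 _).setI 19 _) (h := h) (k := k) (T := T)
      (thr := if g = 1 then 0 else cdiv h g) (by simp [k3]) (by simp [k1]) (by simp [IExpr.eval])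
      (by simp [IExpr.eval, k0]) (by simp) (by change IntervalMono s₂.dsq h; rwa [kd]) hdesc
      (fun i hi => (hvals i hi).1) ?_ ?_ ?_).frame.mono ?_
    · intro i hi
      simp only [State.setI_rvar, State.setI_rarr, r4, r5]
      exact (hvals i hi).2
    · change ¬ Feasible s₂.dsq h k (s₂.rvar 4)
      rwa [kd, r4]
    · change Feasible s₂.dsq h k (s₂.rvar 5)
      rwa [kd, r5]
    rintro s₄ t₄ ⟨⟨ht₄, hl₄, hu₄, hll, huu, lo, hi, hlh, hhT, hwin, hlo, hhi⟩, hF₄⟩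
    change ¬ Feasible s₂.dsq h k _ at hl₄
    change Feasible s₂.dsq h k _ at hu₄
    rw [kd] at hl₄ hu₄
    simp only [State.setI_rvar, State.setI_rarr, r4, r5] at hll huu hlo hhi
    simp only [State.setI_ivar, State.setI_rvar, ↓reduceIte, IExpr.eval, IExpr.cost]
    refine ⟨?_, ?_, hl₄, hu₄, ?_⟩
    · have h₁ : (180 * T + 50) * L ≤ 1130 * (L * cdiv h g) := by
        calc (180 * T + 50) * L ≤ (1130 * cdiv h g) * L := Nat.mul_le_mul_right _ (by omega)
          _ = 1130 * (L * cdiv h g) := by ring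
      have hL1 : 1 ≤ L := by
        by_contra hcon
        rw [show L = 0 by omega] at hL
        omega
      have h₂ : cdiv h g ≤ L * cdiv h g := Nat.le_mul_of_pos_left _ hL1
      have h₃ : h ≤ h * L := Nat.le_mul_of_pos_right _ hL1
      split_ifs at ht₄ hlogs ⊢ <;> omega
    · rw [hF₄.ivar 15 (by decide)]
      simp [k15]
    · exact (card_active_le_countP hll huu hM₂).trans ((countP_seg_le hlh hhT hlo hhi).trans hwin)
  rw [run_seq]
  refine run_cond.2 ⟨fun hc => run_setI.2 ?_, fun hc => run_setI.2 ?_⟩ <;>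
    simp only [BExpr.Holds, IExpr.eval, k15] at hc <;>
    simp only [IExpr.eval, k16, BExpr.cost, IExpr.cost]
  · refine (key _ 6 (by omega) (by rw [if_pos (by omega)])).mono ?_
    intro s' t ht
    refine ⟨?_, ht.2⟩
    have := ht.1
    omega
  · refine (key _ 6 (by omega) (by rw [if_neg (by omega)])).mono ?_
    intro s' t ht
    refine ⟨?_, ht.2⟩
    have := ht.1
    omega

end RealRAM

theorem cdiv_anti {h g g' : ℕ} (hg : 0 < g) (hgg : g ≤ g') : cdiv h g' ≤ cdiv h g := by
  by_contra hcon
  have h₁ := (lt_cdiv (n := h) (hg.trans_le hgg)).1 (not_le.1 hcon)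
  have h₂ := (lt_cdiv hg).2 ((Nat.mul_le_mul_left (cdiv h g) hgg).trans_lt h₁)
  exact lt_irrefl _ h₂

/-! ### The complete search -/

namespace RealRAM

/-- Sets the variable `15` to the least power of two that is at least the variable `3`. -/
def startWidth : Cmd :=
  .setI 15 (.const 1) ;; .loop (.ilt (.var 15) (.var 3)) (.setI 15 (.add (.var 15) (.var 15)))

theorem startWidth_spec (s : State) {h : ℕ} (hh : s.ivar 3 = h) (hh0 : 0 < h) :
    Run startWidth s fun s' t => t ≤ 10 * Nat.log 2 h + 20 ∧
      ∃ e, s'.ivar 15 = 2 ^ e ∧ h ≤ 2 ^ e ∧ e ≤ Nat.log 2 h + 1 := by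
  simp only [startWidth, run_seq, run_setI]
  refine (Run.loop (fun s' => ∃ e, s'.ivar 3 = h ∧ s'.ivar 15 = 2 ^ e ∧ e ≤ Nat.log 2 h + 1)
    (fun s' => 10 * (Nat.log 2 h + 1 - Nat.log 2 (s'.ivar 15))) ?_ ?_).mono ?_
  · exact ⟨0, by simp [hh], by simp [IExpr.eval], Nat.zero_le _⟩
  · rintro s₁ ⟨e, h3, h15, he⟩ hc
    simp only [BExpr.Holds, IExpr.eval, h3, h15, not_le] at hc
    have he' : e ≤ Nat.log 2 h := (Nat.le_log_iff_pow_le one_lt_two hh0.ne').2 hc.le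
    have h2 : 2 ^ e + 2 ^ e = 2 ^ (e + 1) := by ring
    simp only [run_setI, IExpr.eval, h15, h2, State.setI_ivar, ↓reduceIte,
      Nat.log_pow one_lt_two, IExpr.cost, BExpr.cost]
    exact ⟨⟨e + 1, by simp [h3], rfl, by omega⟩, by omega⟩
  · rintro s₁ t ⟨⟨e, h3, h15, he⟩, hc, ht⟩
    simp only [BExpr.Holds, IExpr.eval, h3, h15, not_not] at hc
    simp only [IExpr.cost, BExpr.cost, IExpr.eval, State.setI_ivar, ↓reduceIte,
      Nat.log_one_right, Nat.sub_zero] at ht ⊢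
    exact ⟨by omega, e, h15, hc, he⟩

/-- Computes the optimal value and an optimal solution from the skyline in the arrays `10`, `11`. -/
def search : Cmd :=
  startWidth ;; .setR 4 (.const (-1)) ;;
    .setR 5 (.dsq (.const 0) (.sub (.var 3) (.const 1))) ;;
    .loop (.ile (.const 1) (.var 15)) searchLevel ;;
    .setR 6 (.var 5) ;; greedy ;; .setR 0 (.sqrt (.var 6))

/-- The time for the levels of width `g`, `g / 2`, …, `1`. -/
def searchPotential (h L g : ℕ) : ℕ :=
  if g = 0 then 0 else
    2010 * (L * ∑ i ∈ Finset.range (Nat.log 2 g + 1), cdiv h (2 ^ i) + h * (Nat.log 2 g + 1) + h * L)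

/-- The current level takes the last summand of the sum and one `h`; the term `h * L` is reserved
for the bisection at width 1. -/
theorem searchPotential_half {h L e : ℕ} (hh : 0 < h) :
    2000 * (L * cdiv h (2 ^ e) + h) + (if 2 ^ e = 1 then 2000 * (h * L) else 0) + 10 +
      searchPotential h L (2 ^ e / 2) ≤ searchPotential h L (2 ^ e) := by
  rcases e with _ | e
  · simp only [searchPotential, pow_zero, Nat.reduceDiv, ↓reduceIte, one_ne_zero,
      Nat.log_one_right, zero_add, Finset.sum_range_one, mul_one]
    omega
  · have h₁ : 2 ^ (e + 1) / 2 = 2 ^ e := by rw [pow_succ]; omega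
    have h₂ : (2 : ℕ) ^ e ≠ 0 := by positivity
    have h₃ : (2 : ℕ) ^ (e + 1) ≠ 0 := by positivity
    have h₄ : (2 : ℕ) ^ (e + 1) ≠ 1 := by rw [pow_succ]; omega
    simp only [searchPotential, h₁, h₂, h₃, h₄, ↓reduceIte, Nat.log_pow one_lt_two]
    rw [Finset.sum_range_succ _ (e + 1), mul_add L, mul_add_one h (e + 1)]
    omega

/-- The final bounds enclose no entry, so each entry below the feasible `u` is at most the
infeasible lower bound. `L` is chosen so that `2 ^ L` exceeds twice the at most `6 * h` values of
any level. -/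
theorem search_spec (s : State) {h k : ℕ} (hh : s.ivar 3 = h) (hk : s.ivar 1 = k) (hh0 : 0 < h)
    (hk1 : 1 ≤ k) (hf : IntervalMono s.dsq h) :
    Run search s fun s' t => t ≤ 13000 * (h * (Nat.log 2 h + 5)) ∧
      ∃ u, 0 ≤ u ∧ s'.rvar 0 = Real.sqrt u ∧ s'.ivar 2 ≤ k ∧
      (∀ i j, i ≤ j → j < h → s.dsq i j < u → ¬ Feasible s.dsq h k (s.dsq i j)) ∧
      ∃ ctr : ℕ → ℕ, (∀ t < s'.ivar 2, ctr t < h ∧ s'.pairs 2 3 t = s.pairs 10 11 (ctr t)) ∧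
      (∀ t t', t < t' → t' < s'.ivar 2 → ctr t < ctr t') ∧
      (∀ q < h, ∃ t < s'.ivar 2, s.dsq (ctr t) q ≤ u) := by
  set L := Nat.log 2 h + 5 with hLdef
  have hL : 12 * h ≤ 2 ^ L := by
    have : h < 2 ^ (Nat.log 2 h + 1) := Nat.lt_pow_succ_log_self one_lt_two h
    rw [hLdef, show Nat.log 2 h + 5 = Nat.log 2 h + 1 + 4 by ring, pow_add]
    omega
  have hlogh : Nat.log 2 h < h := Nat.log_lt_self 2 hh0.ne'
  rw [search, run_seq]
  refine (startWidth_spec s hh hh0).frame.mono ?_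
  rintro s₁ t₁ ⟨⟨ht₁, e₀, h15, hhe, he₀⟩, hF₁⟩
  have a1 : s₁.ivar 1 = k := by rw [hF₁.ivar 1 (by decide), hk]
  have a3 : s₁.ivar 3 = h := by rw [hF₁.ivar 3 (by decide), hh]
  have aX : s₁.rarr 10 = s.rarr 10 := hF₁.rarr 10 (by decide)
  have aY : s₁.rarr 11 = s.rarr 11 := hF₁.rarr 11 (by decide)
  rw [run_seq, run_setR, run_seq, run_setR, run_seq]
  refine (Run.loop (fun s' => s'.ivar 1 = k ∧ s'.ivar 3 = h ∧ s'.rarr 10 = s.rarr 10 ∧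
    s'.rarr 11 = s.rarr 11 ∧ ¬ Feasible s.dsq h k (s'.rvar 4) ∧ Feasible s.dsq h k (s'.rvar 5) ∧
    ((∃ e, s'.ivar 15 = 2 ^ e ∧
      (active s.dsq h (2 ^ e) (s'.rvar 4) (s'.rvar 5)).card ≤ 6 * cdiv h (2 ^ e)) ∨
     (s'.ivar 15 = 0 ∧ (active s.dsq h 1 (s'.rvar 4) (s'.rvar 5)).card ≤ 0)))
    (fun s' => searchPotential h L (s'.ivar 15)) ?_ ?_).frame.mono ?_
  · refine ⟨by simp [a1], by simp [a3], aX, aY, ?_, ?_, Or.inl ⟨e₀, by simp [h15], ?_⟩⟩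
    -- The initial lower bound is `-1`, infeasible because squared distances are nonnegative.
    · intro hcon
      have := hcon.nonneg hf hh0
      simp [RExpr.eval] at this
      norm_num at this
    · convert feasible_first_last hf hh0 hk1 using 1
      simp [RExpr.eval, IExpr.eval, a3, aX, aY, State.dsq]
    -- The first grid is at least as wide as the sequence is long, so it has a single position.
    · have h₁ : cdiv h (2 ^ e₀) = 1 := by
        refine le_antisymm ?_ ((lt_cdiv (by positivity)).2 (by simpa using hh0))
        by_contra hcon
        have := (lt_cdiv (n := h) (w := 2 ^ e₀) (by positivity)).1 (not_le.1 hcon)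
        omega
      refine (Finset.card_le_card (Finset.filter_subset _ _)).trans ?_
      rw [Finset.card_product, Finset.card_range, h₁]
      norm_num
  · rintro s₂ ⟨b1, b3, bX, bY, hl, hu, hst⟩ hc
    simp only [BExpr.Holds, IExpr.eval] at hc
    obtain ⟨e, b15, hact⟩ := hst.resolve_right (by omega)
    have hd : s₂.dsq = s.dsq := State.dsq_congr bX bY
    rw [← hd] at hl hu hact
    refine (searchLevel_spec s₂ b3 b1 b15 (by positivity) hh0 hL (hd ▸ hf) hl hu hact).frame.mono ?_
    rintro s₃ t₃ ⟨⟨ht₃, c15, hl₃, hu₃, hact₃⟩, hF₃⟩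
    rw [hd] at hl₃ hu₃ hact₃
    refine ⟨⟨by rw [hF₃.ivar 1 (by decide), b1], by rw [hF₃.ivar 3 (by decide), b3],
      by rw [hF₃.rarr 10 (by decide), bX], by rw [hF₃.rarr 11 (by decide), bY], hl₃, hu₃, ?_⟩, ?_⟩
    · rcases e with _ | e
      · exact Or.inr ⟨by simpa using c15, by simpa using hact₃⟩
      · refine Or.inl ⟨e, by rw [c15, pow_succ]; omega, ?_⟩
        rw [if_neg (by rw [pow_succ]; omega)] at hact₃
        have h₁ := card_active_le (g := 2 ^ e) (l := s₃.rvar 4) (u := s₃.rvar 5) hf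
          (by positivity)
        rw [← pow_succ'] at h₁
        have h₂ := cdiv_anti (h := h) (g := 2 ^ e) (g' := 2 ^ (e + 1)) (by positivity)
          (Nat.pow_le_pow_right two_pos (Nat.le_succ e))
        omega
    · have := searchPotential_half (L := L) (e := e) hh0
      simp only [c15, b15, BExpr.cost, IExpr.cost]
      omega
  rintro s₂ t₂ ⟨⟨⟨b1, b3, bX, bY, hl, hu, hst⟩, hc, ht₂⟩, hF₂⟩
  simp only [BExpr.Holds, IExpr.eval] at hc
  obtain ⟨b15, hact⟩ := hst.resolve_left (by
    rintro ⟨e, he, -⟩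
    have : 0 < 2 ^ e := by positivity
    omega)
  have hu0 := hu.nonneg hf hh0
  have hd : ∀ v, (s₂.setR 6 v).dsq = s.dsq := fun v => State.dsq_congr bX bY
  rw [run_seq, run_setR, run_seq]
  refine (greedy_spec (s₂.setR 6 _) (h := h) (by simp [b3]) (by rwa [hd])
    (by simpa [RExpr.eval] using hu0)).frame.mono ?_
  rintro s₃ t₃ ⟨⟨ht₃, ctr, hctr, hstrict, hcov, hmin⟩, hF₃⟩
  simp only [hd, RExpr.eval, State.setR_rvar, ↓reduceIte] at hcov hmin
  have hiff := greedy_feasible_iff (k := k) (fun t ht => (hctr t ht).1) hcov hmin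
  rw [run_setR]
  refine ⟨?_, s₂.rvar 5, hu0, ?_, hiff.2 hu, ?_, ctr, ?_, hstrict, hcov⟩
  · simp only [State.setR_ivar, h15, searchPotential, b15, ↓reduceIte, Nat.log_pow one_lt_two,
      BExpr.cost, IExpr.cost, RExpr.cost, if_neg (show (2 : ℕ) ^ e₀ ≠ 0 by positivity)] at ht₂ ⊢
    have h₁ : L * ∑ i ∈ Finset.range (e₀ + 1), cdiv h (2 ^ i) ≤ L * (4 * h) :=
      Nat.mul_le_mul_left _ ((sum_cdiv_le h e₀).trans (by omega))
    have h₂ : h * (e₀ + 1) ≤ h * L := Nat.mul_le_mul_left _ (by omega)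
    have h₃ : L * (4 * h) = 4 * (h * L) := by ring
    have h₄ : h * 5 ≤ h * L := Nat.mul_le_mul_left _ (by omega)
    omega
  · simp only [State.setR_rvar, ↓reduceIte, RExpr.eval]
    rw [hF₃.rvar 6 (by decide)]
    simp [RExpr.eval]
  · intro i j hij hj hlt hfeas
    have h₁ : ¬ (s.dsq i j ≤ s₂.rvar 4) := fun h => hl (hfeas.mono h)
    have h₂ : (i, j) ∈ active s.dsq h 1 (s₂.rvar 4) (s₂.rvar 5) := by
      rw [mem_active one_pos]
      simp only [mul_one]
      exact ⟨hij, hj, not_le.1 h₁, hlt⟩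
    rw [Finset.card_eq_zero.1 (Nat.le_zero.1 hact)] at h₂
    simp at h₂
  · intro t ht
    refine ⟨(hctr t ht).1, ?_⟩
    have h₁ : s₂.pairs 10 11 = s.pairs 10 11 := by
      funext x
      simp only [State.pairs, bX, bY]
    rw [← h₁]
    exact (hctr t ht).2

end RealRAM

/-! ## Optimal solutions -/

/-- Reduces part (2) to part (1) with `P` replaced by its skyline. -/
theorem sky_sky (P : Finset Point) : sky (sky P) = sky P := by
  ext p
  rw [mem_sky (P := sky P)]
  exact ⟨fun h => h.1, fun h => ⟨h, fun q hq hne => (mem_sky.1 h).2 q (mem_sky.1 hq).1 hne⟩⟩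

theorem opt_sky (P : Finset Point) (k : ℕ) : opt (sky P) k = opt P k := by
  simp only [opt, feasible, psi, sky_sky]

theorem isOptimalSolution_sky {P : Finset Point} {k : ℕ} {Q : Finset Point} :
    IsOptimalSolution (sky P) k Q ↔ IsOptimalSolution P k Q := by
  simp only [IsOptimalSolution, opt_sky, feasible, psi, sky_sky]

namespace RealRAM

theorem edist_pt_pairs (s : State) (i j : ℕ) :
    edist (pt (s.pairs 10 11 i)) (pt (s.pairs 10 11 j)) = ENNReal.ofReal (Real.sqrt (s.dsq i j)) := by
  rw [edist_dist, EuclideanSpace.dist_eq, Fin.sum_univ_two]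
  simp only [pt_zero, pt_one, Real.dist_eq, State.pairs, State.dsq, sq, abs_mul_abs_self]

/-- Along the skyline x increases and y decreases, so enlarging an interval of indices enlarges both
coordinate differences in absolute value. -/
theorem intervalMono_dsq {s : State} {P : Finset Point} {h : ℕ}
    (H : IsSkySeq P h (s.pairs 10 11)) : IntervalMono s.dsq h where
  symm i j := by simp only [State.dsq]; ring
  self i := by simp only [State.dsq]; ring
  mono i i' j' j hi hij hj hjh := by
    have hx : ∀ a b, a ≤ b → b < h →
        s.rarr 10 a ≤ s.rarr 10 b ∧ s.rarr 11 b ≤ s.rarr 11 a := by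
      intro a b hab hb
      rcases Nat.eq_or_lt_of_le hab with rfl | hab
      · exact ⟨le_rfl, le_rfl⟩
      · exact ⟨(H.strict a b hab hb).1.le, (H.strict a b hab hb).2.le⟩
    have h₁ := hx i i' hi (by omega)
    have h₂ := hx i' j' hij (by omega)
    have h₃ := hx j' j hj hjh
    simp only [State.dsq]
    refine add_le_add ?_ ?_
    · nlinarith
    · nlinarith

/-- If a solution `R` beat `√u`, its largest squared distance from a skyline point to a chosen
center closer than `√u` would be an entry below `u` that is feasible, against `hopt`. -/
theorem opt_of_search {s : State} {P : Finset Point} {h k c : ℕ} {u : ℝ} {ctr : ℕ → ℕ}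
    (H : IsSkySeq P h (s.pairs 10 11)) (hh : 0 < h) (hc : c ≤ k)
    (hopt : ∀ i j, i ≤ j → j < h → s.dsq i j < u → ¬ Feasible s.dsq h k (s.dsq i j))
    (hctr : ∀ t < c, ctr t < h) (hcov : ∀ q < h, ∃ t < c, s.dsq (ctr t) q ≤ u) :
    opt P k = ENNReal.ofReal (Real.sqrt u) ∧ ∃ Q : Finset Point, IsOptimalSolution P k Q ∧
      (Q : Set Point) = (fun t => pt (s.pairs 10 11 (ctr t))) '' Set.Iio c := by
  classical
  have hf := intervalMono_dsq H
  set Q := (Finset.range c).image fun t => pt (s.pairs 10 11 (ctr t)) with hQ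
  have hfeas : Q ∈ feasible P k := by
    refine Finset.mem_filter.2 ⟨Finset.mem_powerset.2 fun p hp => ?_,
      Finset.card_image_le.trans (by simpa using hc)⟩
    obtain ⟨t, ht, rfl⟩ := Finset.mem_image.1 hp
    exact H.mem _ (hctr t (Finset.mem_range.1 ht))
  have hpsi : psi Q P ≤ ENNReal.ofReal (Real.sqrt u) := by
    refine Finset.sup_le fun p hp => ?_
    obtain ⟨j, hj, rfl⟩ := H.complete p hp
    obtain ⟨t, ht, hle⟩ := hcov j hj
    refine (Finset.inf_le (Finset.mem_image_of_mem _ (Finset.mem_range.2 ht))).trans ?_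
    rw [edist_pt_pairs, hf.symm]
    exact ENNReal.ofReal_le_ofReal (Real.sqrt_le_sqrt hle)
  have hlow : ENNReal.ofReal (Real.sqrt u) ≤ opt P k := by
    refine Finset.le_inf fun R hR => ?_
    by_contra hlt
    rw [not_le] at hlt
    -- A strict bound on a supremum over a finite set requires the bound to exceed `⊥`.
    have hpos : (⊥ : ENNReal) < ENNReal.ofReal (Real.sqrt u) := bot_le.trans_lt hlt
    obtain ⟨hRsky, hRk⟩ := Finset.mem_filter.1 hR
    rw [Finset.mem_powerset] at hRsky
    have h₁ : ∀ p < h, ∃ q < h, pt (s.pairs 10 11 q) ∈ R ∧ s.dsq q p < u := by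
      intro p hp
      have := (Finset.sup_lt_iff hpos).1 hlt _ (H.mem p hp)
      obtain ⟨q', hq', hlt'⟩ := Finset.inf_lt_iff.1 this
      obtain ⟨q, hq, rfl⟩ := H.complete q' (hRsky hq')
      refine ⟨q, hq, hq', ?_⟩
      rw [edist_pt_pairs, hf.symm] at hlt'
      by_contra hcon
      exact absurd (ENNReal.ofReal_le_ofReal (Real.sqrt_le_sqrt (not_lt.1 hcon))) hlt'.not_ge
    choose! c hc₁ hc₂ hc₃ using h₁
    obtain ⟨p, hp, hmax⟩ := Finset.exists_max_image (Finset.range h) (fun p => s.dsq (c p) p)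
      ⟨0, Finset.mem_range.2 hh⟩
    rw [Finset.mem_range] at hp
    have hF : Feasible s.dsq h k (s.dsq (c p) p) := by
      refine ⟨(Finset.range h).filter fun q => pt (s.pairs 10 11 q) ∈ R,
        ⟨fun q hq => Finset.mem_range.1 (Finset.mem_filter.1 hq).1, fun p' hp' =>
          ⟨c p', Finset.mem_filter.2 ⟨Finset.mem_range.2 (hc₁ p' hp'), hc₂ p' hp'⟩,
            hmax p' (Finset.mem_range.2 hp')⟩⟩, le_trans ?_ hRk⟩
      refine Finset.card_le_card_of_injOn (fun q => pt (s.pairs 10 11 q))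
        (fun q hq => (Finset.mem_filter.1 hq).2) ?_
      -- With the largest abscissa as `cx`, the whole sequence satisfies `SkyInv`, which is used
      -- here only for injectivity.
      have hinv : SkyInv P ((sky P).sup' ⟨_, H.mem 0 hh⟩ fun p => p 0) h (s.pairs 10 11) :=
        ⟨fun t ht => ⟨H.mem t ht, Finset.le_sup' (f := fun p : Point => p 0) (H.mem t ht)⟩,
          H.strict, fun p hp _ => H.complete p hp⟩
      exact hinv.injOn.mono fun q hq => (Finset.mem_filter.1 hq).1
    rcases le_total (c p) p with h' | h'
    · exact hopt _ _ h' hp (hc₃ p hp) hF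
    · rw [hf.symm] at hF
      exact hopt _ _ h' (hc₁ p hp) (hf.symm _ _ ▸ hc₃ p hp) hF
  have hle : opt P k ≤ psi Q P := Finset.inf_le hfeas
  refine ⟨le_antisymm (hle.trans hpsi) hlow, Q, ⟨hfeas, le_antisymm (hpsi.trans hlow) hle⟩, ?_⟩
  simp [hQ]

/-- The program: it computes the skyline, and from it the optimal value and solution. -/
def representatives : Cmd := skyline ;; search

theorem representatives_spec {P : Finset Point} {k : ℕ} {s : State} (hk : 1 ≤ k)
    (hkh : k ≤ (sky P).card) (hs : s.IsInput P k) :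
    Run representatives s fun s' t => s'.IsOutput P k ∧
      t ≤ 70000 * (P.card * (Nat.log 2 (sky P).card + 1)) := by
  obtain ⟨h0, h1, hlist⟩ := hs
  have hhn : (sky P).card ≤ P.card := Finset.card_le_card (Finset.filter_subset _ _)
  have hP : ∀ p, p ∈ P ↔ ∃ i < P.card, pt (s.pairs 0 1 i) = p := by
    intro p
    have := hlist.image_eq
    rw [← Finset.mem_coe, ← this]
    rfl
  rw [representatives, run_seq]
  refine (skyline_spec s h0 (by omega) hP le_rfl).frame.mono ?_
  rintro s₁ t₁ ⟨⟨ht₁, hsky⟩, hF₁⟩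
  have hh0 : 0 < s₁.ivar 3 := by rw [hsky.card]; omega
  refine (search_spec s₁ rfl (by rw [hF₁.ivar 1 (by decide), h1]) hh0 hk
    (intervalMono_dsq hsky)).mono ?_
  rintro s₂ t₂ ⟨ht₂, u, hu, hr, hc, hopt, ctr, hctr, hstrict, hcov⟩
  obtain ⟨ho, Q, hQ, hQc⟩ := opt_of_search hsky hh0 hc hopt (fun t ht => (hctr t ht).1) hcov
  refine ⟨⟨by rw [hr]; positivity, by rw [hr, ho], Q, hQ, ?_⟩, ?_⟩
  · have heq : Set.EqOn (fun t => pt (s₁.pairs 10 11 (ctr t)))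
        (fun i => (!₂[s₂.rarr 2 i, s₂.rarr 3 i] : Point)) (Set.Iio (s₂.ivar 2)) := by
      intro t ht
      simp only
      rw [← (hctr t ht).2]
      rfl
    rw [State.Lists, hQc, ← heq.bijOn_iff]
    refine Set.InjOn.bijOn_image ?_
    intro t ht t' ht' hpt
    have hpt' := congrArg Prod.fst (pt_injective hpt)
    rcases lt_trichotomy t t' with h | h | h
    · exact absurd hpt' (hsky.strict _ _ (hstrict t t' h ht') (hctr t' ht').1).1.ne
    · exact h
    · exact absurd hpt' (hsky.strict _ _ (hstrict t' t h ht) (hctr t ht).1).1.ne'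
  · rw [hsky.card] at ht₂
    set l := Nat.log 2 (sky P).card
    have h₁ : (sky P).card * (l + 5) ≤ P.card * (5 * (l + 1)) :=
      Nat.mul_le_mul hhn (by omega)
    have h₂ : P.card * (l + 2) ≤ P.card * (2 * (l + 1)) := Nat.mul_le_mul_left _ (by omega)
    have h₃ : 2000 * P.card * (l + 2) = 2000 * (P.card * (l + 2)) := by ring
    have h₄ : P.card * (5 * (l + 1)) = 5 * (P.card * (l + 1)) := by ring
    have h₅ : P.card * (2 * (l + 1)) = 2 * (P.card * (l + 1)) := by ring
    omega

/-- Translates binary logarithms into natural ones; the factor 2 suffices because log 2 > 1/2. -/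
theorem natLog_two_le (h : ℕ) (hh : 0 < h) : (Nat.log 2 h : ℝ) ≤ 2 * Real.log h := by
  have h₁ : (2 : ℝ) ^ Nat.log 2 h ≤ h := by exact_mod_cast Nat.pow_log_le_self 2 hh.ne'
  have h₂ := Real.log_le_log (by positivity) h₁
  rw [Real.log_pow] at h₂
  have h₃ := Real.log_two_gt_d9
  have h₄ : (0 : ℝ) ≤ Nat.log 2 h := Nat.cast_nonneg _
  nlinarith

theorem representatives_run {P : Finset Point} {k : ℕ} {s : State} (hk : 1 ≤ k)
    (hkh : k ≤ (sky P).card) (hs : s.IsInput P k) :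
    ∃ s' t, Exec representatives s s' t ∧ s'.IsOutput P k ∧
      (t : ℝ) ≤ 140000 * (P.card * (1 + Real.log (sky P).card)) := by
  obtain ⟨s', t, he, ho, ht⟩ := representatives_spec hk hkh hs
  refine ⟨s', t, he, ho, ?_⟩
  have h₁ : (t : ℝ) ≤ 70000 * (P.card * (Nat.log 2 (sky P).card + 1)) := by exact_mod_cast ht
  have h₂ := natLog_two_le (sky P).card (by omega)
  have h₃ : (P.card : ℝ) * (Nat.log 2 (sky P).card + 1) ≤
      P.card * (2 * (1 + Real.log (sky P).card)) :=
    mul_le_mul_of_nonneg_left (by linarith) (Nat.cast_nonneg _)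
  linarith

end RealRAM

theorem mainTheorem3 :
    (∃ (prog : RealRAM.Cmd) (C : ℝ), ∀ (P : Finset Point) (k : ℕ) (s : RealRAM.State),
      1 ≤ k → k ≤ (sky P).card → s.IsInput P k →
      ∃ (s' : RealRAM.State) (t : ℕ), RealRAM.Exec prog s s' t ∧ s'.IsOutput P k ∧
        (t : ℝ) ≤ C * (P.card * (1 + Real.log (sky P).card))) ∧
    (∃ (prog : RealRAM.Cmd) (C : ℝ), ∀ (P : Finset Point) (k : ℕ) (s : RealRAM.State),
      1 ≤ k → k ≤ (sky P).card → s.IsInput (sky P) k →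
      ∃ (s' : RealRAM.State) (t : ℕ), RealRAM.Exec prog s s' t ∧ s'.IsOutput P k ∧
        (t : ℝ) ≤ C * ((sky P).card * (1 + Real.log (sky P).card))) := by
  refine ⟨⟨RealRAM.representatives, 140000, fun P k s hk hkh hs =>
    RealRAM.representatives_run hk hkh hs⟩, RealRAM.representatives, 140000,
    fun P k s hk hkh hs => ?_⟩
  -- On the input `sky P` the number of points is h itself, so O(n log h) becomes O(h log h).
  have := RealRAM.representatives_run (P := sky P) hk (by rwa [sky_sky]) hs
  simpa only [RealRAM.State.IsOutput, sky_sky, opt_sky, isOptimalSolution_sky] using this
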